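/- Let $k$ be an algebraically closed field of characteristic zero. A basic object $B=(W,(J,b),E)$ of dimension $d$ over $k$ consists of a smooth variety $W$ over $k$ of dimension $d$, a coherent ideal sheaf $J\subset\mathcal O_W$, an integer $b\ge 1$, and an ordered simple normal crossings divisor $E=(H_1,\dots,H_r)$, where each $H_j$ is a finite (possibly empty) disjoint union of smooth irreducible divisors $H_{j,l}$, and $H_i,H_j$ have no common component for $i\ne j$. Put $\mathrm{Sing}(J,b)=\{p\in W:\nu_p(J)\ge b\}$, where $\nu_p(J)=\max\{n: J_p\subset\mathfrak m_p^n\}$. $B$ is monomial if $J=\prod_{j,l} I(H_{j,l})^{a_{j,l}}$, where $a_{j,l}$ is the order of $J$ at the generic point of $H_{j,l}$. For $p\in H_j$ let $a_j(p)$ be the exponent of the component of $H_j$ that contains $p$. For a monomial basic object $B$ and $p\in\mathrm{Sing}(J,b)$ call a set of distinct indices $j_1>\dots>j_n$ admissible at $p$ if $p\in H_{j_1}\cap\dots\cap H_{j_n}$ and $a_{j_1}(p)+\dots+a_{j_n}(p)\ge b$. Define $\Gamma_B(p)=(\Gamma_1(p),\Gamma_2(p),\Gamma_3(p))\in\mathbb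 Z_{\ge -d}\times\frac1b\mathbb Z_{\ge0}\times\mathbb Z_{\ge0}^d$, ordered lexicographically, as follows: $-\Gamma_1(p)$ is the least size $n$ of an admissible set at $p$; $\Gamma_2(p)$ is the maximum of $\frac1b(a_{j_1}(p)+\dots+a_{j_n}(p))$ over the admissible sets of that size; $\Gamma_3(p)$ is the lexicographic maximum of $(j_1,\dots,j_n,0,\dots,0)$ over the admissible sets of that size that attain $\Gamma_2(p)$. When $\mathrm{Sing}(J,b)\neq\emptyset$, let $\max\Gamma_B$ be the maximal value of $\Gamma_B$ and $\underline{\mathrm{Max}}\,\Gamma_B$ the set of points of $\mathrm{Sing}(J,b)$ where it is attained. A closed subset $Y\subset W$ is permissible if it is smooth and at every closed point there is a regular system of parameters such that $Y$ is locally defined by the vanishing of some of the parameters and the components of $E$ through the point are the zero loci of single parameters. The transformation of $B$ with permissible center $Y\subset\mathrm{Sing}(J,b)$ is $B'=(W',(J',b),E')$, where $\pi:W'\to W$ is the blowup along $Y$, $E'=(H_1',\dots,H_r',H_{r+1})$ with $H_j'$ the union of the strict transforms of those components of $H_j$ that are not contained in $Y$, and $H_{r+1}=\pi^{-1}(Y)$,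 and $J'$ is defined by $J\mathcal O_{W'}=I(H_{r+1})^b\cdot J'$. Theorem. Let $B_0$ be a monomial basic object of dimension $d$ over $k$. (1) If $\mathrm{Sing}(J_0,b)\ne\emptyset$, then $\max\Gamma_{B_0}$ exists, $Y_0=\underline{\mathrm{Max}}\,\Gamma_{B_0}$ is a closed subset that is smooth and permissible, the transformation $B_1$ of $B_0$ with center $Y_0$ exists, and $B_1$ is a monomial basic object with $\Gamma_{B_1}(p)<\max\Gamma_{B_0}$ for all $p\in\mathrm{Sing}(J_1,b)$. (2) There is a finite sequence of transformations of monomial basic objects $$B_0\xleftarrow{\pi_1}B_1\xleftarrow{\pi_2}\cdots\xleftarrow{\pi_N}B_N$$ such that for each $i=1,\dots,N$ the maximum $\max\Gamma_{B_{i-1}}$ exists, $\pi_i$ has center $Y_{i-1}=\underline{\mathrm{Max}}\,\Gamma_{B_{i-1}}$, and $\Gamma_{B_i}(p)<\max\Gamma_{B_{i-1}}$ for all $p\in\mathrm{Sing}(J_i,b)$, and such that $\mathrm{Sing}(J_N,b)=\emptyset$. -/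

import Mathlib

open AlgebraicGeometry CategoryTheory TopologicalSpace

universe u

noncomputable section

namespace MonomialResolution

/-! ### Ideal sheaves on schemes: stalks, order, blowups -/

section Schemes

variable {X : Scheme.{u}}

/-- The stalk `J_p ⊆ 𝒪_{X,p}` of an ideal sheaf `J` at a point `p`. -/
def stalkIdeal (J : X.IdealSheafData) (p : X) : Ideal (X.presheaf.stalk p) :=
  ⨆ (U : X.affineOpens) (h : p ∈ U.1), (J.ideal U).map (X.presheaf.germ U.1 p h).hom

/-- The order `ν_p(J) = max {n | J_p ⊆ m_p ^ n}` (which is `⊤` if there is no maximum). -/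
def order (J : X.IdealSheafData) (p : X) : ℕ∞ :=
  ⨆ n ∈ {n : ℕ | stalkIdeal J p ≤ IsLocalRing.maximalIdeal (X.presheaf.stalk p) ^ n}, (n : ℕ∞)

/-- The ideal `I(Z)` of all functions vanishing on a closed subset `Z`. -/
abbrev idealOf (Z : Closeds X) : X.IdealSheafData :=
  Scheme.IdealSheafData.vanishingIdeal Z

/-- An irreducible closed subset as a closed subset. -/
def toCloseds (C : IrreducibleCloseds X) : Closeds X := ⟨C, C.isClosed⟩

/-- The order of `J` at the generic point of an irreducible closed subset. -/
def orderAlong (J : X.IdealSheafData) (C : IrreducibleCloseds X) : ℕ∞ :=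
  order J C.isIrreducible.genericPoint

/-- `I` is invertible: locally it is generated by one nonzerodivisor. -/
def IsInvertible (I : X.IdealSheafData) : Prop :=
  ∀ p : X, ∃ U : X.affineOpens, p ∈ U.1 ∧
    ∃ f ∈ nonZeroDivisors Γ(X, U.1), I.ideal U = Ideal.span {f}

/-- `π : X' ⟶ X` is the blowup of `X` along the ideal sheaf `I`: the inverse image ideal
`I 𝒪_{X'}` is invertible, and `π` is universal with this property. -/
structure IsBlowup {X' : Scheme.{u}} (π : X' ⟶ X) (I : X.IdealSheafData) : Prop where
  invertible : IsInvertible (I.comap π)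
  existsUnique_lift : ∀ {T : Scheme.{u}} (f : T ⟶ X), IsInvertible (I.comap f) →
    ∃! g : T ⟶ X', g ≫ π = f

/-- A family `x` of `d` elements of the local ring at `p` generates the maximal ideal and is adapted
to a set `S` of irreducible closed subsets: those members of `S` which pass through `p` are defined
at `p` by single members of the family, different ones for different members of `S`.
At a closed point of a smooth `d`-dimensional variety over an algebraically closed field the local
ring is regular of dimension `d`, so `x` is then a regular system of parameters. -/
def IsAdapted {d : ℕ} (S : Set (IrreducibleCloseds X)) (p : X)
    (x : Fin d → X.presheaf.stalk p) : Prop :=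
  Ideal.span (Set.range x) = IsLocalRing.maximalIdeal (X.presheaf.stalk p) ∧
    ∃ σ : {C : IrreducibleCloseds X // C ∈ S ∧ p ∈ C} → Fin d, Function.Injective σ ∧
      ∀ C, stalkIdeal (idealOf (toCloseds C.1)) p = Ideal.span {x (σ C)}

end Schemes

/-! ### Basic objects -/

/-- A basic object `(W, (J, b), E)` of dimension `d` over `k`: a smooth variety `W` of dimension `d`,
an ideal `J` of `𝒪_W`, a positive integer `b`, and an (ordered) simple normal crossings divisor
`E = (H_1, …, H_r)`. Each `H_j` is recorded as the (finite, possibly empty) set of its irreducible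
components `H_{j,l}`; these are smooth and pairwise disjoint, and different `H_i`, `H_j` share no
component. -/
structure BasicObject (k : Type u) [Field k] (d : ℕ) where
  W : Scheme.{u}
  toSpec : W ⟶ Spec (CommRingCat.of k)
  isIntegral : IsIntegral W
  isSeparated : IsSeparated toSpec
  quasiCompact : QuasiCompact toSpec
  smooth : SmoothOfRelativeDimension d toSpec
  J : W.IdealSheafData
  b : ℕ
  b_pos : 0 < b
  E : List (Set (IrreducibleCloseds W))
  finite : ∀ H ∈ E, H.Finite
  smooth_component : ∀ H ∈ E, ∀ C ∈ H, Smooth ((idealOf (toCloseds C)).subschemeι ≫ toSpec)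
  disjoint_components : ∀ H ∈ E, H.PairwiseDisjoint (fun C => (C : Set W))
  no_common_component : E.Pairwise Disjoint
  /-- simple normal crossings -/
  snc : ∀ p : W, IsClosed ({p} : Set W) →
    ∃ x : Fin d → W.presheaf.stalk p, IsAdapted {C | ∃ H ∈ E, C ∈ H} p x

namespace BasicObject

variable {k : Type u} [Field k] {d : ℕ} (B : BasicObject k d)

/-- All irreducible components `H_{j,l}` of the boundary divisor. -/
def components : Set (IrreducibleCloseds B.W) := {C | ∃ H ∈ B.E, C ∈ H}

/-- The singular locus `Sing(J, b) = {p | ν_p(J) ≥ b}`. -/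
def Sing : Set B.W := {p | (B.b : ℕ∞) ≤ order B.J p}

/-- The exponent `a_{j,l}` of a boundary component: the order of `J` at its generic point. -/
def exponent (C : IrreducibleCloseds B.W) : ℕ := (orderAlong B.J C).toNat

/-- `B` is monomial: `J = I(H_1)^{a_1} ⋯ I(H_r)^{a_r}`, where
`I(H_j)^{a_j} = ∏_l I(H_{j,l})^{a_{j,l}}`. -/
def IsMonomial : Prop :=
  B.J = (B.E.map fun H => ∏ᶠ (C : IrreducibleCloseds B.W) (_ : C ∈ H),
    idealOf (toCloseds C) ^ B.exponent C).prod

/-! #### The invariant `Γ` -/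

/-- `p ∈ H_j`. (The list index `j` starts at `0`.) -/
def Through (j : Fin B.E.length) (p : B.W) : Prop := ∃ C ∈ B.E.get j, p ∈ C

/-- `a_j(p)`: the exponent of the component of `H_j` that contains `p` (there is at most one;
the value is `0` if there is none). -/
def exponentAt (j : Fin B.E.length) (p : B.W) : ℕ :=
  ∑ᶠ (C : IrreducibleCloseds B.W) (_ : C ∈ B.E.get j ∧ p ∈ C), B.exponent C

/-- `a_{j_1}(p) + ⋯ + a_{j_n}(p)` for a set of indices `{j_1, …, j_n}`. -/
def exponentSum (p : B.W) (S : Finset (Fin B.E.length)) : ℕ := ∑ j ∈ S, B.exponentAt j p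

open Classical in
/-- The sets of indices `{j_1, …, j_n}` with `p ∈ H_{j_1} ∩ ⋯ ∩ H_{j_n}` and
`a_{j_1}(p) + ⋯ + a_{j_n}(p) ≥ b`. -/
def admissible (p : B.W) : Finset (Finset (Fin B.E.length)) :=
  Finset.univ.filter fun S => (∀ j ∈ S, B.Through j p) ∧ B.b ≤ B.exponentSum p S

/-- `- Γ_1(p)`: the least number of elements of an admissible set. -/
def negΓ₁ (p : B.W) : ℕ := sInf {n | ∃ S ∈ B.admissible p, S.card = n}

/-- The admissible sets with `- Γ_1(p)` elements. -/
def minimalSets (p : B.W) : Finset (Finset (Fin B.E.length)) :=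
  (B.admissible p).filter fun S => S.card = B.negΓ₁ p

/-- `b Γ_2(p)`. -/
def bΓ₂ (p : B.W) : ℕ := (B.minimalSets p).sup (B.exponentSum p)

/-- The decreasing list `j_1 > ⋯ > j_n` of the elements of a set of indices, filled up with zeros,
as an element of `ℤ_{≥0}^d` with the lexicographical order. Here indices start at `1`. -/
def indexTuple (d : ℕ) {r : ℕ} (S : Finset (Fin r)) : Lex (Fin d → ℕ) :=
  toLex fun i => ((S.sort (· ≥ ·)).map fun j : Fin r => (j : ℕ) + 1).getD i 0

/-- `Γ_3(p)`. -/
def Γ₃ (p : B.W) : Lex (Fin d → ℕ) :=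
  ((B.minimalSets p).filter fun S => B.exponentSum p S = B.bΓ₂ p).sup (indexTuple d)

/-- The invariant `Γ(p) = (Γ_1(p), Γ_2(p), Γ_3(p))`, with values ordered lexicographically. It is
meant for monomial `B` and `p ∈ Sing(J, b)` only. -/
def Γ (p : B.W) : ℤ ×ₗ ℚ ×ₗ Lex (Fin d → ℕ) :=
  toLex (-(B.negΓ₁ p : ℤ), toLex ((B.bΓ₂ p : ℚ) / B.b, B.Γ₃ p))

/-- `Max Γ`, the set of points of `Sing(J, b)` at which `Γ` is maximal. -/
def MaxΓ : Set B.W := {p ∈ B.Sing | ∀ q ∈ B.Sing, B.Γ q ≤ B.Γ p}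

/-! #### Transformations -/

/-- A closed subset `Y` (with its reduced structure) is permissible with respect to `E`: it is smooth
and at every closed point there is a regular system of parameters such that the components of `E`
through that point are given by members of the system, and `Y` by the vanishing of some of them. -/
structure IsPermissible (Y : Closeds B.W) : Prop where
  smooth : Smooth ((idealOf Y).subschemeι ≫ B.toSpec)
  coordinates : ∀ p : B.W, IsClosed ({p} : Set B.W) →
    ∃ x : Fin d → B.W.presheaf.stalk p, IsAdapted B.components p x ∧
      (p ∈ Y → ∃ M : Set (Fin d), stalkIdeal (idealOf Y) p = Ideal.span (x '' M))

variable {B} {B' : BasicObject k d}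

/-- The strict transforms of those members of `H` which are not contained in `Y`. -/
def strictTransforms (π : B'.W ⟶ B.W) (Y : Closeds B.W) (H : Set (IrreducibleCloseds B.W)) :
    Set (IrreducibleCloseds B'.W) :=
  {C' | ∃ C ∈ H, ¬ (C : Set B.W) ⊆ Y ∧ (C' : Set B'.W) = closure (π ⁻¹' ((C : Set B.W) \ Y))}

/-- The irreducible components of the exceptional divisor `π⁻¹(Y)`. -/
def exceptionalComponents (π : B'.W ⟶ B.W) (Y : Closeds B.W) : Set (IrreducibleCloseds B'.W) :=
  {C' | Maximal (fun D : IrreducibleCloseds B'.W => (D : Set B'.W) ⊆ π ⁻¹' (Y : Set B.W)) C'}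

/-- `π` makes `B'` the transformation of the basic object `B` with center `Y`. -/
structure IsTransformation (π : B'.W ⟶ B.W) (Y : Closeds B.W) : Prop where
  comp_toSpec : π ≫ B.toSpec = B'.toSpec
  permissible : B.IsPermissible Y
  subset_sing : (Y : Set B.W) ⊆ B.Sing
  isBlowup : IsBlowup π (idealOf Y)
  b_eq : B'.b = B.b
  /-- The new boundary consists of the strict transforms of the old `H_j`, followed by the
  exceptional divisor. Components of `H_j` contained in the center are dropped from `H_j`. -/
  E_eq : B'.E = B.E.map (strictTransforms π Y) ++ [exceptionalComponents π Y]
  /-- `J 𝒪_{W'} = I(H_{r+1})^b J'`, where `I(H_{r+1}) = I(Y) 𝒪_{W'}`. -/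
  J_eq : B.J.comap π = (idealOf Y).comap π ^ B.b * B'.J

end BasicObject

end MonomialResolution

end

noncomputable section

namespace MonomialResolution

/-! ### Regular systems of parameters -/

section RegularSystem

/-- A regular system of parameters of a local ring, recorded through the properties that are used:
it generates the maximal ideal, its subfamilies generate distinct prime ideals, and its monomials
have the expected order. -/
structure RegularSystem {O ι : Type*} [CommRing O] [IsLocalRing O] [Fintype ι] (x : ι → O) :
    Prop where
  span_eq : Ideal.span (Set.range x) = IsLocalRing.maximalIdeal O
  isPrime : ∀ M : Set ι, (Ideal.span (x '' M)).IsPrime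
  notMem : ∀ (M : Set ι) (j : ι), j ∉ M → x j ∉ Ideal.span (x '' M)
  prod_notMem : ∀ a : ι → ℕ, ∏ i, x i ^ a i ∉ IsLocalRing.maximalIdeal O ^ (∑ i, a i + 1)

variable {k O ι : Type*} [Field k] [CommRing O] [IsLocalRing O] [Fintype ι]
  [Algebra k O] {x : ι → O}

lemma exists_aeval_sub_mem_pow (hx : Ideal.span (Set.range x) = IsLocalRing.maximalIdeal O)
    (hk : ∀ f : O, ∃ c : k, f - algebraMap k O c ∈ IsLocalRing.maximalIdeal O) (f : O) (n : ℕ) :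
    ∃ p : MvPolynomial ι k, f - MvPolynomial.aeval x p ∈ IsLocalRing.maximalIdeal O ^ n := by
  induction n generalizing f with
  | zero => exact ⟨0, by simp⟩
  | succ n ih =>
    obtain ⟨c, hc⟩ := hk f
    rw [← hx, Ideal.mem_span_range_iff_exists_fun] at hc
    obtain ⟨g, hg⟩ := hc
    choose p hp using fun i => ih (g i)
    refine ⟨MvPolynomial.C c + ∑ i, p i * MvPolynomial.X i, ?_⟩
    have : f - MvPolynomial.aeval x (MvPolynomial.C c + ∑ i, p i * MvPolynomial.X i) =
        ∑ i, (g i - MvPolynomial.aeval x (p i)) * x i := by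
      simp only [map_add, map_sum, map_mul, MvPolynomial.aeval_X, sub_mul,
        Finset.sum_sub_distrib, hg, MvPolynomial.aeval_C]
      ring
    rw [this, pow_succ]
    refine Ideal.sum_mem _ fun i _ => Ideal.mul_mem_mul (hp i) ?_
    rw [← hx]
    exact Ideal.subset_span ⟨i, rfl⟩

variable (φ : O →ₐ[k] MvPowerSeries ι k) (hφ : ∀ i, φ (x i) = MvPowerSeries.X i)

include hφ

lemma le_order_of_mem_pow (hx : Ideal.span (Set.range x) = IsLocalRing.maximalIdeal O) (n : ℕ)
    {f : O} (hf : f ∈ IsLocalRing.maximalIdeal O ^ n) : (n : ℕ∞) ≤ (φ f).order := by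
  induction n generalizing f with
  | zero => simp
  | succ n ih =>
    rw [pow_succ] at hf
    refine Submodule.mul_induction_on hf (fun a ha b hb => ?_) (fun a b ha hb => ?_)
    · rw [map_mul, Nat.cast_add]
      refine le_trans (add_le_add (ih ha) ?_) MvPowerSeries.le_order_mul
      rw [Nat.cast_one, MvPowerSeries.one_le_order_iff_constCoeff_eq_zero]
      rw [← hx, Ideal.mem_span_range_iff_exists_fun] at hb
      obtain ⟨g, rfl⟩ := hb
      simp [hφ]
    · rw [map_add]
      exact le_trans (le_min ha hb) MvPowerSeries.min_order_le_add

omit [IsLocalRing O] [Fintype ι] in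
lemma map_aeval_eq_coe (p : MvPolynomial ι k) :
    φ (MvPolynomial.aeval x p) = (p : MvPowerSeries ι k) := by
  have : φ.comp (MvPolynomial.aeval x) = MvPolynomial.coeToMvPowerSeries.algHom k := by
    ext i
    simp [hφ]
  simpa using DFunLike.congr_fun this p

omit [IsLocalRing O] [Fintype ι] in
lemma map_mem_of_mem_span {M : Set ι} {f : O} (hf : f ∈ Ideal.span (x '' M)) :
    MvPowerSeries.killCompl (R := k) (Function.Embedding.subtype (· ∈ Mᶜ)) (φ f) = 0 := by
  have : Ideal.span (x '' M) ≤ RingHom.ker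
      ((MvPowerSeries.killCompl (R := k) (Function.Embedding.subtype (· ∈ Mᶜ))).comp φ) := by
    rw [Ideal.span_le]
    rintro _ ⟨i, hi, rfl⟩
    simp only [SetLike.mem_coe, RingHom.mem_ker, AlgHom.comp_apply, hφ]
    exact MvPowerSeries.killCompl_X_eq_zero (by simpa using hi)
  exact this hf

lemma mem_span_of_map_mem [IsNoetherianRing O]
    (hx : Ideal.span (Set.range x) = IsLocalRing.maximalIdeal O)
    (hk : ∀ f : O, ∃ c : k, f - algebraMap k O c ∈ IsLocalRing.maximalIdeal O) {M : Set ι} {f : O}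
    (hf : MvPowerSeries.killCompl (R := k) (Function.Embedding.subtype (· ∈ Mᶜ)) (φ f) = 0) :
    f ∈ Ideal.span (x '' M) := by
  classical
  set I := Ideal.span (x '' M) with hI
  have key : ∀ n, f ∈ I ⊔ IsLocalRing.maximalIdeal O ^ n := by
    intro n
    obtain ⟨p, hp⟩ := exists_aeval_sub_mem_pow hx hk f n
    rw [← sub_add_cancel f (MvPolynomial.aeval x p)]
    refine add_mem (Ideal.mem_sup_right hp) ?_
    rw [p.as_sum, map_sum]
    refine Ideal.sum_mem _ fun a ha => ?_
    rw [MvPolynomial.aeval_monomial]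
    refine Ideal.mul_mem_left _ _ ?_
    by_cases han : a.degree < n
    · apply Ideal.mem_sup_left
      have h1 : MvPowerSeries.coeff a (φ f) = p.coeff a := by
        have := MvPowerSeries.coeff_of_lt_order (f := φ (f - MvPolynomial.aeval x p)) (d := a)
          (lt_of_lt_of_le (by exact_mod_cast han) (le_order_of_mem_pow φ hφ hx n hp))
        rw [map_sub, map_aeval_eq_coe φ hφ, map_sub, MvPolynomial.coeff_coe, sub_eq_zero] at this
        exact this
      have h2 : a ∉ Set.range
          (Finsupp.embDomain (M := ℕ) (Function.Embedding.subtype (· ∈ Mᶜ))) := by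
        rintro ⟨b, rfl⟩
        have := congrArg (MvPowerSeries.coeff b) hf
        rw [MvPowerSeries.coeff_killCompl, h1, map_zero] at this
        exact (MvPolynomial.mem_support_iff.mp ha) this
      rw [Finsupp.mem_range_embDomain_iff] at h2
      obtain ⟨i, hi, hiM⟩ := Set.not_subset.mp h2
      have hiM : i ∈ M := by simpa using hiM
      rw [Finsupp.prod, ← Finset.mul_prod_erase _ _ hi]
      refine Ideal.mul_mem_right _ _ (Ideal.pow_mem_of_mem _ ?_ _ ?_)
      · exact Ideal.subset_span ⟨i, hiM, rfl⟩
      · exact Nat.pos_of_ne_zero (Finsupp.mem_support_iff.mp hi)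
    · apply Ideal.mem_sup_right
      refine Ideal.pow_le_pow_right (not_lt.mp han) ?_
      rw [Finsupp.prod, Finsupp.degree_apply, ← Finset.prod_pow_eq_pow_sum]
      refine Ideal.prod_mem_prod fun i _ => Ideal.pow_mem_pow ?_ _
      rw [← hx]
      exact Ideal.subset_span ⟨i, rfl⟩
  by_cases hI' : I = ⊤
  · rw [hI']; trivial
  have : IsLocalRing (O ⧸ I) :=
    have := Ideal.Quotient.nontrivial_iff.mpr hI'
    .of_surjective' (Ideal.Quotient.mk I) Ideal.Quotient.mk_surjective
  rw [← Ideal.Quotient.eq_zero_iff_mem, ← Ideal.mem_bot]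
  have hne : (IsLocalRing.maximalIdeal O).map (Ideal.Quotient.mk I) ≠ ⊤ := by
    intro h
    have h1 := Ideal.comap_map_of_surjective (Ideal.Quotient.mk I) Ideal.Quotient.mk_surjective
      (IsLocalRing.maximalIdeal O)
    rw [h, Ideal.comap_top, ← RingHom.ker_eq_comap_bot, Ideal.mk_ker,
      sup_eq_left.mpr (IsLocalRing.le_maximalIdeal hI')] at h1
    exact Ideal.IsPrime.ne_top' h1.symm
  rw [← Ideal.iInf_pow_eq_bot_of_isLocalRing _ hne, Ideal.mem_iInf]
  intro n
  rw [← Ideal.map_pow]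
  have := Ideal.mem_map_of_mem (Ideal.Quotient.mk I) (key n)
  rwa [Ideal.map_sup, Ideal.map_quotient_self, bot_sup_eq] at this

theorem RegularSystem.of_algHom [IsNoetherianRing O]
    (hx : Ideal.span (Set.range x) = IsLocalRing.maximalIdeal O)
    (hk : ∀ f : O, ∃ c : k, f - algebraMap k O c ∈ IsLocalRing.maximalIdeal O) :
    RegularSystem x := by
  classical
  have hspan : ∀ M : Set ι, Ideal.span (x '' M) = RingHom.ker
      ((MvPowerSeries.killCompl (R := k) (Function.Embedding.subtype (· ∈ Mᶜ))).comp φ) :=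
    fun M => le_antisymm (fun f hf => map_mem_of_mem_span φ hφ hf)
      (fun f hf => mem_span_of_map_mem φ hφ hx hk hf)
  refine ⟨hx, fun M => ?_, fun M j hj => ?_, fun a ha => ?_⟩
  · rw [hspan]
    have : IsDomain (MvPowerSeries {i // i ∈ Mᶜ} k) := NoZeroDivisors.to_isDomain _
    exact RingHom.ker_isPrime _
  · rw [hspan, RingHom.mem_ker, AlgHom.comp_apply, hφ]
    have := MvPowerSeries.killCompl_X (R := k)
      (e := Function.Embedding.subtype (· ∈ Mᶜ)) (⟨j, hj⟩ : {i // i ∈ Mᶜ})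
    simp only [Function.Embedding.subtype_apply] at this
    rw [this]
    intro h
    have := congrArg (MvPowerSeries.coeff (Finsupp.single ⟨j, hj⟩ 1)) h
    simp at this
  · have h1 := le_order_of_mem_pow φ hφ hx _ ha
    have h2 : φ (∏ i, x i ^ a i) = MvPowerSeries.monomial (Finsupp.equivFunOnFinite.symm a) 1 := by
      rw [map_prod, MvPowerSeries.monomial_one_eq, Finsupp.prod_fintype _ _ (by simp)]
      simp [hφ]
    rw [h2, MvPowerSeries.order_monomial_of_ne_zero one_ne_zero, Finsupp.degree_eq_sum] at h1
    simp only [Finsupp.equivFunOnFinite_symm_apply_apply] at h1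
    norm_cast at h1
    omega

end RegularSystem

end MonomialResolution

end

noncomputable section

namespace MonomialResolution

/-! ### Étale coordinates -/

section Coordinates

/-- The family `x` is a system of étale coordinates of the `k`-algebra `A` (with structure map `c`):
the induced map from the polynomial ring is étale. -/
def IsCoordinates {k A ι : Type*} [CommRing k] [CommRing A] (c : k →+* A) (x : ι → A) : Prop :=
  (MvPolynomial.eval₂Hom c x).Etale

variable {k A ι : Type*} [Field k] [CommRing A] [Finite ι] {c : k →+* A} {x : ι → A}

omit [Finite ι] in
lemma mem_idealOfVars_of_mem (p : Ideal A) [p.IsPrime] (hxp : ∀ i, x i ∈ p)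
    {P : MvPolynomial ι k} (hP : MvPolynomial.eval₂Hom c x P ∈ p) :
    P ∈ MvPolynomial.idealOfVars ι k := by
  have h1 : P - MvPolynomial.C (MvPolynomial.constantCoeff P) ∈ MvPolynomial.idealOfVars ι k := by
    rw [← pow_one (MvPolynomial.idealOfVars ι k), MvPolynomial.mem_pow_idealOfVars_iff']
    intro a ha
    have : a = 0 := (Finsupp.degree_eq_zero_iff a).mp (by omega)
    subst this
    simp [MvPolynomial.constantCoeff_eq]
  have h2 : MvPolynomial.idealOfVars ι k ≤ p.comap (MvPolynomial.eval₂Hom c x) := by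
    rw [MvPolynomial.idealOfVars, Ideal.span_le]
    rintro _ ⟨i, rfl⟩
    simpa using hxp i
  have h3 : c (MvPolynomial.constantCoeff P) ∈ p := by
    have := h2 h1
    rw [Ideal.mem_comap, map_sub] at this
    simpa using (Submodule.sub_mem_iff_right p hP).mp this
  have h4 : MvPolynomial.constantCoeff P = 0 := by
    by_contra h
    exact Ideal.IsPrime.ne_top' (Ideal.eq_top_of_isUnit_mem p h3 ((Ne.isUnit h).map c))
  rwa [h4, map_zero, sub_zero] at h1

omit [Finite ι] in
lemma IsCoordinates.exists_mul_mem_span (h : IsCoordinates c x) (p : Ideal A) [p.IsPrime]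
    (hxp : ∀ i, x i ∈ p) {f : A} (hf : f ∈ p) :
    ∃ s ∉ p, s * f ∈ Ideal.span (Set.range x) := by
  let R := MvPolynomial ι k
  algebraize [MvPolynomial.eval₂Hom c x]
  have : Algebra.Etale R A := h
  let p₀ : Ideal R := p.under R
  let := Localization.AtPrime.algebraOfLiesOver p₀ p
  have key := ((Algebra.isUnramifiedAt_iff_map_eq R p₀ p).mp inferInstance).2
  have hle : p₀.map (algebraMap R A) ≤ Ideal.span (Set.range x) := by
    rw [Ideal.map_le_iff_le_comap]
    intro P hP
    have := mem_idealOfVars_of_mem (c := c) p hxp hP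
    rw [MvPolynomial.idealOfVars] at this
    have h2 := Ideal.mem_map_of_mem (algebraMap R A) this
    rw [Ideal.map_span] at h2
    rw [Ideal.mem_comap]
    convert h2
    ext y
    constructor
    · rintro ⟨i, rfl⟩
      exact ⟨_, ⟨i, rfl⟩, MvPolynomial.eval₂Hom_X' c x i⟩
    · rintro ⟨_, ⟨i, rfl⟩, rfl⟩
      exact ⟨i, (MvPolynomial.eval₂Hom_X' c x i).symm⟩
  have h1 : algebraMap A (Localization.AtPrime p) f ∈
      (Ideal.span (Set.range x)).map (algebraMap A (Localization.AtPrime p)) := by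
    refine Ideal.map_mono hle ?_
    rw [Ideal.map_map, ← IsScalarTower.algebraMap_eq, key,
      ← Localization.AtPrime.map_eq_maximalIdeal]
    exact Ideal.mem_map_of_mem _ hf
  obtain ⟨s, hs, hs'⟩ := (IsLocalization.algebraMap_mem_map_algebraMap_iff p.primeCompl _ _ _).mp h1
  exact ⟨s, hs, hs'⟩

lemma IsCoordinates.exists_toMvPowerSeries (h : IsCoordinates c x) (p : Ideal A) [p.IsPrime]
    (hxp : ∀ i, x i ∈ p) (hk : ∀ f : A, ∃ a : k, f - c a ∈ p) :
    ∃ φ : A →+* MvPowerSeries ι k, (∀ i, φ (x i) = MvPowerSeries.X i) ∧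
      (∀ a, φ (c a) = MvPowerSeries.C a) ∧
      ∀ f ∉ p, MvPowerSeries.constantCoeff (φ f) ≠ 0 := by
  let R := MvPolynomial ι k
  algebraize [MvPolynomial.eval₂Hom c x]
  have : Algebra.Etale R A := h
  have hbij : Function.Bijective ((Ideal.Quotient.mk p).comp c) := by
    refine ⟨RingHom.injective _, fun y => ?_⟩
    obtain ⟨f, rfl⟩ := Ideal.Quotient.mk_surjective y
    obtain ⟨a, ha⟩ := hk f
    exact ⟨a, (Ideal.Quotient.eq.mpr ha).symm⟩
  let e := RingEquiv.ofBijective _ hbij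
  let I := MvPolynomial.idealOfVars ι k
  let ψ : A →+* R ⧸ I := ((Ideal.Quotient.mk I).comp MvPolynomial.C).comp
    ((e.symm : A ⧸ p →+* k).comp (Ideal.Quotient.mk p))
  have hψc : ∀ a, ψ (c a) = Ideal.Quotient.mk I (MvPolynomial.C a) := by
    intro a
    have : e a = Ideal.Quotient.mk p (c a) := rfl
    simp [ψ, ← this]
  have hψx : ∀ i, ψ (x i) = 0 := by
    intro i
    simp [ψ, Ideal.Quotient.eq_zero_iff_mem.mpr (hxp i)]
  let ψ' : A →ₐ[R] R ⧸ I := 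
    { ψ with
      commutes' := by
        have : ψ.comp (MvPolynomial.eval₂Hom c x) = Ideal.Quotient.mk I := by
          ext i
          · simp [hψc]
          · simp only [RingHom.comp_apply, MvPolynomial.eval₂Hom_X', hψx]
            have hXi : MvPolynomial.X i ∈ I := Ideal.subset_span (Set.mem_range_self i)
            exact (Ideal.Quotient.eq_zero_iff_mem.mpr hXi).symm
        intro r
        exact DFunLike.congr_fun this r }
  obtain ⟨g, hg⟩ := Algebra.FormallySmooth.exists_adicCompletionEvalOneₐ_comp_eq ψ'
  let E := MvPowerSeries.toAdicCompletionAlgEquiv ι k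
  let φ : A →ₐ[R] MvPowerSeries ι k := (E.symm : _ →ₐ[R] _).comp g
  have hφ : ∀ r : R, φ (MvPolynomial.eval₂Hom c x r) = (r : MvPowerSeries ι k) := by
    intro r
    have h1 : φ (algebraMap R A r) = algebraMap R (MvPowerSeries ι k) r := φ.commutes r
    exact h1
  refine ⟨(φ : A →+* MvPowerSeries ι k), fun i => ?_, fun a => ?_, fun f hf h0 => ?_⟩
  · simpa using hφ (MvPolynomial.X i)
  · simpa using hφ (MvPolynomial.C a)
  · obtain ⟨a, ha⟩ := hk f
    have hfa : f = c a + (f - c a) := by ring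
    have ha0 : a ≠ 0 := by
      rintro rfl
      apply hf
      simpa using ha
    have h1 : ψ f = Ideal.Quotient.mk I (MvPolynomial.C a) := by
      rw [hfa, map_add, hψc]
      simp [ψ, Ideal.Quotient.eq_zero_iff_mem.mpr ha]
    have h2 : AdicCompletion.evalOneₐ I (E (φ f)) = ψ f := by
      have := DFunLike.congr_fun hg f
      simp only [φ, AlgHom.comp_apply]
      rw [AlgEquiv.coe_toAlgHom, AlgEquiv.apply_symm_apply]
      exact this
    have h3 : ∀ F : MvPowerSeries ι k, AdicCompletion.evalOneₐ I (E F) =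
        Ideal.Quotient.mk I (MvPolynomial.C (MvPowerSeries.constantCoeff F)) := by
      intro F
      have : AdicCompletion.evalOneₐ I (E F) =
        Ideal.Quotient.mk I (F.truncTotal 1) := rfl
      rw [this, Ideal.Quotient.eq, ← pow_one I, MvPolynomial.mem_pow_idealOfVars_iff']
      intro b hb
      have : b = 0 := (Finsupp.degree_eq_zero_iff b).mp (by omega)
      subst this
      simp [MvPowerSeries.coeff_truncTotal]
    replace h0 : MvPowerSeries.constantCoeff (φ f) = 0 := h0
    rw [h3, h0, h1] at h2
    have : MvPolynomial.C a ∈ I := by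
      rw [← Ideal.Quotient.eq_zero_iff_mem, ← h2]; simp
    rw [← pow_one I, MvPolynomial.mem_pow_idealOfVars_iff'] at this
    exact ha0 (by simpa using this 0 (by simp))

theorem IsCoordinates.regularSystem {ι : Type*} [Fintype ι] {x : ι → A} (h : IsCoordinates c x)
    (p : Ideal A) [p.IsPrime]
    (hxp : ∀ i, x i ∈ p) (hk : ∀ f : A, ∃ a : k, f - c a ∈ p) (O : Type*) [CommRing O]
    [IsLocalRing O] [IsNoetherianRing O] [Algebra A O] [IsLocalization.AtPrime O p] :
    RegularSystem fun i => algebraMap A O (x i) := by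
  obtain ⟨φ, hφx, hφc, hφ⟩ := h.exists_toMvPowerSeries p hxp hk
  have hu : ∀ y : p.primeCompl, IsUnit (φ y) := fun y => by
    rw [MvPowerSeries.isUnit_iff_constantCoeff]
    exact (hφ y y.2).isUnit
  algebraize [(algebraMap A O).comp c]
  let Φ : O →ₐ[k] MvPowerSeries ι k :=
    { IsLocalization.lift hu with
      commutes' := fun a => by
        have : (algebraMap k O a) = algebraMap A O (c a) := rfl
        rw [this]
        exact (IsLocalization.lift_eq hu _).trans (hφc a) }
  have hmax : ∀ f : A, algebraMap A O f ∈ IsLocalRing.maximalIdeal O ↔ f ∈ p := fun f =>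
    IsLocalization.AtPrime.to_map_mem_maximal_iff O p f
  have hspan : Ideal.span (Set.range fun i => algebraMap A O (x i)) =
      IsLocalRing.maximalIdeal O := by
    apply le_antisymm
    · rw [Ideal.span_le]
      rintro _ ⟨i, rfl⟩
      exact (hmax _).mpr (hxp i)
    · rw [← IsLocalization.AtPrime.map_eq_maximalIdeal p O, Ideal.map_le_iff_le_comap]
      intro f hf
      obtain ⟨s, hs, hsf⟩ := h.exists_mul_mem_span p hxp hf
      have h1 := Ideal.mem_map_of_mem (algebraMap A O) hsf
      rw [Ideal.map_span, ← Set.range_comp, map_mul] at h1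
      exact (Ideal.unit_mul_mem_iff_mem _
        (IsLocalization.map_units O (⟨s, hs⟩ : p.primeCompl))).mp h1
  refine RegularSystem.of_algHom Φ (fun i => ?_) hspan fun f => ?_
  · exact (IsLocalization.lift_eq hu _).trans (hφx i)
  · obtain ⟨g, s, rfl⟩ := IsLocalization.exists_mk'_eq p.primeCompl f
    obtain ⟨a, ha⟩ := hk g
    obtain ⟨b, hb⟩ := hk s
    have hb0 : b ≠ 0 := by
      rintro rfl
      exact s.2 (by simpa using hb)
    refine ⟨a / b, ?_⟩
    rw [← Ideal.unit_mul_mem_iff_mem _ (IsLocalization.map_units O s), mul_sub,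
      IsLocalization.mul_mk'_eq_mk'_of_mul, IsLocalization.mk'_mul_cancel_left]
    have : (algebraMap k O (a / b)) = algebraMap A O (c (a / b)) := rfl
    rw [this, ← map_mul, ← map_sub, hmax]
    have h5 : g - s * c (a / b) = (g - c a) - (s - c b) * c (a / b) := by
      have : c a = c b * c (a / b) := by rw [← map_mul, mul_div_cancel₀ _ hb0]
      rw [this]; ring
    rw [h5]
    exact sub_mem ha (Ideal.mul_mem_right _ _ hb)

end Coordinates

section ExistsCoordinates

variable {k A : Type u} [Field k] [CommRing A] {d : ℕ} {c : k →+* A} {x : Fin d → A}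

open KaehlerDifferential in
lemma isUnramifiedAt_of_span_eq (hc : c.IsStandardSmoothOfRelativeDimension d)
    (p : Ideal A) [p.IsPrime]
    (hxp : ∀ i, x i ∈ p) (hk : ∀ f : A, ∃ a : k, f - c a ∈ p)
    (hx : ∀ f ∈ p, ∃ s ∉ p, s * f ∈ Ideal.span (Set.range x)) :
    ∃ g ∉ p, letI := (MvPolynomial.eval₂Hom c x).toAlgebra
      Algebra.Unramified (MvPolynomial (Fin d) k) (Localization.Away g) := by
  let R := MvPolynomial (Fin d) k
  algebraize [c, MvPolynomial.eval₂Hom c x]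
  have : IsScalarTower k R A := .of_algebraMap_eq fun a => by
    simp [RingHom.algebraMap_toAlgebra, R]
  have : Algebra.IsStandardSmooth k A := Algebra.IsStandardSmoothOfRelativeDimension.isStandardSmooth d
  have : Algebra.FiniteType R A := .of_restrictScalars_finiteType k R A
  have : Algebra.EssFiniteType R (Localization.AtPrime p) := .comp _ A _
  have : Algebra.IsUnramifiedAt R p := by
    let O := Localization.AtPrime p
    have hm : IsLocalRing.maximalIdeal O ≤
        Ideal.span (Set.range fun i => algebraMap A O (x i)) := by
      rw [← Localization.AtPrime.map_eq_maximalIdeal, Ideal.map_le_iff_le_comap]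
      intro f hf
      obtain ⟨s, hs, hsf⟩ := hx f hf
      have h1 := Ideal.mem_map_of_mem (algebraMap A O) hsf
      rw [Ideal.map_span, ← Set.range_comp, map_mul] at h1
      exact (Ideal.unit_mul_mem_iff_mem _
        (IsLocalization.map_units O (⟨s, hs⟩ : p.primeCompl))).mp h1
    constructor
    have hDx : ∀ i, D R O (algebraMap A O (x i)) = 0 := by
      intro i
      have : algebraMap A O (x i) = algebraMap R O (MvPolynomial.X i) := by
        rw [IsScalarTower.algebraMap_apply R A O]
        simp [RingHom.algebraMap_toAlgebra, R]
      rw [this, Derivation.map_algebraMap]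
    have hDA : ∀ f : A, D R O (algebraMap A O f) ∈
        IsLocalRing.maximalIdeal O • (⊤ : Submodule O Ω[O⁄R]) := by
      intro f
      obtain ⟨a, ha⟩ := hk f
      have h1 : algebraMap A O (f - c a) ∈ IsLocalRing.maximalIdeal O :=
        (IsLocalization.AtPrime.to_map_mem_maximal_iff O p _).mpr ha
      have h1' := h1
      replace h1 := hm h1
      rw [Ideal.mem_span_range_iff_exists_fun] at h1
      obtain ⟨g, hg⟩ := h1
      have h2 : D R O (algebraMap A O f) = D R O (algebraMap A O (f - c a)) := by
        have : algebraMap A O (c a) = algebraMap R O (MvPolynomial.C a) := by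
          rw [IsScalarTower.algebraMap_apply R A O]
          simp [RingHom.algebraMap_toAlgebra, R]
        rw [map_sub, map_sub, this, Derivation.map_algebraMap, sub_zero]
      rw [h2, ← hg, map_sum]
      refine Submodule.sum_mem _ fun i _ => ?_
      rw [Derivation.leibniz, hDx, smul_zero, zero_add]
      exact Submodule.smul_mem_smul
        ((IsLocalization.AtPrime.to_map_mem_maximal_iff O p _).mpr (hxp i)) trivial
    have htop : (⊤ : Submodule O Ω[O⁄R]) ≤
        IsLocalRing.maximalIdeal O • (⊤ : Submodule O Ω[O⁄R]) := by
      refine (KaehlerDifferential.span_range_map_derivation_of_isLocalization R A O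
        p.primeCompl).ge.trans (Submodule.span_le.mpr ?_)
      rintro _ ⟨f, rfl⟩
      simpa using hDA f
    have := Submodule.eq_bot_of_le_smul_of_le_jacobson_bot (IsLocalRing.maximalIdeal O) ⊤
      (Module.Finite.fg_top) htop (IsLocalRing.maximalIdeal_le_jacobson _)
    exact (Submodule.subsingleton_iff O).mp (subsingleton_of_bot_eq_top this.symm)
  exact Algebra.exists_unramified_of_isUnramifiedAt p

open KaehlerDifferential in
theorem exists_isCoordinates_localization (hc : c.IsStandardSmoothOfRelativeDimension d)
    (p : Ideal A) [p.IsPrime] (hxp : ∀ i, x i ∈ p) (hk : ∀ f : A, ∃ a : k, f - c a ∈ p)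
    (hx : ∀ f ∈ p, ∃ s ∉ p, s * f ∈ Ideal.span (Set.range x)) :
    ∃ g ∉ p, IsCoordinates ((algebraMap A (Localization.Away g)).comp c)
      fun i => algebraMap A (Localization.Away g) (x i) := by
  obtain ⟨g, hg, hunr⟩ := isUnramifiedAt_of_span_eq hc p hxp hk hx
  refine ⟨g, hg, ?_⟩
  let R := MvPolynomial (Fin d) k
  let B := Localization.Away g
  algebraize [c, MvPolynomial.eval₂Hom c x]
  have : IsScalarTower k R A := .of_algebraMap_eq fun a => by
    simp [RingHom.algebraMap_toAlgebra, R]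
  have : IsScalarTower k R B := .of_algebraMap_eq fun a => by
    rw [IsScalarTower.algebraMap_apply k A B, IsScalarTower.algebraMap_apply R A B,
      IsScalarTower.algebraMap_apply k R A]
  have : Algebra.Unramified R B := hunr
  have : Algebra.IsStandardSmoothOfRelativeDimension d k A := hc
  have : Algebra.IsStandardSmoothOfRelativeDimension 0 A B := .localization_away g
  have : Algebra.IsStandardSmoothOfRelativeDimension d k B := by
    simpa using Algebra.IsStandardSmoothOfRelativeDimension.trans d 0 k A B
  have : Algebra.IsStandardSmooth k B :=
    Algebra.IsStandardSmoothOfRelativeDimension.isStandardSmooth d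
  have : Nontrivial B := by
    rw [← not_subsingleton_iff_nontrivial,
      IsLocalization.subsingleton_iff (M := Submonoid.powers g)]
    rintro ⟨n, hn⟩
    exact hg (Ideal.IsPrime.mem_of_pow_mem ‹_› n (by
      rw [show g ^ n = 0 from hn]; exact p.zero_mem))
  have hfp : Algebra.FinitePresentation R B :=
    .of_restrict_scalars_finitePresentation k R B
  have hsurj : Function.Surjective (KaehlerDifferential.mapBaseChange k R B) := fun y =>
    (KaehlerDifferential.exact_mapBaseChange_map k R B y).mp (Subsingleton.elim _ _)
  let b := (KaehlerDifferential.mvPolynomialBasis k (Fin d)).baseChange B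
  have hr : Module.rank B Ω[B⁄k] = d :=
    Algebra.IsStandardSmoothOfRelativeDimension.rank_kaehlerDifferential d
  have hf : Module.finrank B Ω[B⁄k] = d := Module.finrank_eq_of_rank_eq hr
  have : Module.Free B (TensorProduct R B Ω[R⁄k]) := .of_basis b
  have : Module.Finite B (TensorProduct R B Ω[R⁄k]) := .of_basis b
  let e := LinearEquiv.ofFinrankEq Ω[B⁄k] (TensorProduct R B Ω[R⁄k])
    (by rw [hf, Module.finrank_eq_card_basis b, Fintype.card_fin])
  have hinj : Function.Injective (KaehlerDifferential.mapBaseChange k R B) := by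
    have h1 := OrzechProperty.injective_of_surjective_endomorphism
      (e.toLinearMap ∘ₗ KaehlerDifferential.mapBaseChange k R B) (by
        rw [LinearMap.coe_comp]
        exact e.surjective.comp hsurj)
    rw [LinearMap.coe_comp] at h1
    exact h1.of_comp
  have hH : Subsingleton (Algebra.H1Cotangent R B) := by
    refine subsingleton_of_forall_eq 0 fun y => ?_
    have h1 : Algebra.H1Cotangent.δ k R B y = 0 := by
      apply hinj
      rw [map_zero]
      exact (Algebra.H1Cotangent.exact_δ_mapBaseChange k R B _).mpr ⟨y, rfl⟩
    obtain ⟨z, rfl⟩ := (Algebra.H1Cotangent.exact_map_δ k R B y).mp h1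
    rw [Subsingleton.elim z 0, map_zero]
  have het : Algebra.Etale R B := ⟨⟨inferInstance, hH⟩, hfp⟩
  rw [IsCoordinates]
  convert RingHom.etale_algebraMap.mpr het
  ext i
  · simp only [RingHom.comp_apply, MvPolynomial.eval₂Hom_C]
    rw [← MvPolynomial.algebraMap_eq, ← IsScalarTower.algebraMap_apply k R B,
      IsScalarTower.algebraMap_apply k A B]
    rfl
  · rw [IsScalarTower.algebraMap_apply R A B, MvPolynomial.eval₂Hom_X']
    exact congrArg _ (MvPolynomial.eval₂Hom_X' c x i).symm

end ExistsCoordinates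

end MonomialResolution

end

noncomputable section

namespace MonomialResolution

/-! ### Stalks of ideal sheaves -/

section IdealSheaf

variable {X Y : Scheme.{u}}

open Scheme.IdealSheafData

lemma ideal_eq_of_eq (I : X.IdealSheafData) {U V : X.affineOpens} (h : U.1 = V.1) :
    I.ideal U = (I.ideal V).map (X.presheaf.map (eqToHom h).op).hom :=
  (I.map_ideal' (U := U) (V := V) (eqToHom h).op).symm

lemma ideal_comap_eq_map_appIso (I : Y.IdealSheafData) (f : X ⟶ Y) [IsOpenImmersion f]
    (U : X.affineOpens) :
    (I.comap f).ideal U = (I.ideal ⟨f ''ᵁ U, U.2.image_of_isOpenImmersion f⟩).map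
      (f.appIso U).hom.hom := by
  rw [ideal_comap_of_isOpenImmersion]
  exact (Ideal.map_symm (f.appIso U).commRingCatIsoToRingEquiv.symm).symm

lemma ideal_comap_top_of_isAffine [IsAffine X] [IsAffine Y] (J : Y.IdealSheafData) (f : X ⟶ Y) :
    (J.comap f).ideal ⟨⊤, isAffineOpen_top X⟩ =
      (J.ideal ⟨⊤, isAffineOpen_top Y⟩).map f.appTop.hom := by
  apply le_antisymm
  · have : J.comap f ≤ ofIdealTop ((J.ideal ⟨⊤, isAffineOpen_top Y⟩).map f.appTop.hom) := by
      rw [← le_map_iff_comap_le]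
      apply le_of_isAffine
      rw [ideal_map_of_isAffineHom]
      intro s hs
      rw [Ideal.mem_comap]
      have h2 := Ideal.mem_map_of_mem f.appTop.hom hs
      have h3 := equivOfIsAffine.apply_symm_apply
        ((J.ideal ⟨⊤, isAffineOpen_top Y⟩).map f.appTop.hom)
      rw [← h3] at h2
      exact h2
    refine (this _).trans (le_of_eq ?_)
    simp
  · rw [Ideal.map_le_iff_le_comap]
    have := le_map_comap J f ⟨⊤, isAffineOpen_top Y⟩
    rw [ideal_map_of_isAffineHom] at this
    exact this

lemma ideal_comap_ι_top (J : X.IdealSheafData) (U : X.affineOpens) (h : IsAffineOpen (X := U.1) ⊤) :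
    (J.comap U.1.ι).ideal ⟨⊤, h⟩ = (J.ideal U).map U.1.topIso.inv.hom := by
  rw [ideal_comap_eq_map_appIso, ideal_eq_of_eq J (V := U) (by simp), Ideal.map_map]
  congr 1
  ext s
  simp
  rfl

theorem ideal_comap (J : Y.IdealSheafData) (f : X ⟶ Y) (V : Y.affineOpens) (U : X.affineOpens)
    (e : U.1 ≤ f ⁻¹ᵁ V.1) :
    (J.comap f).ideal U = (J.ideal V).map (f.appLE V.1 U.1 e).hom := by
  have : IsAffine U.1.toScheme := U.2
  have : IsAffine V.1.toScheme := V.2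
  have h1 := ideal_comap_top_of_isAffine (J.comap V.1.ι) (f.resLE V.1 U.1 e)
  rw [← comap_comp, Scheme.Hom.resLE_comp_ι, comap_comp, ideal_comap_ι_top,
    ideal_comap_ι_top, Ideal.map_map] at h1
  have h2 := congrArg (Ideal.map U.1.topIso.hom.hom) h1
  rw [Ideal.map_map, Ideal.map_map] at h2
  have e1 : U.1.topIso.hom.hom.comp U.1.topIso.inv.hom = RingHom.id _ := by
    rw [← CommRingCat.hom_comp, Iso.inv_hom_id]; rfl
  rw [e1, Ideal.map_id] at h2
  rw [h2, ← CommRingCat.hom_comp, ← CommRingCat.hom_comp]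
  congr 2
  rw [Scheme.Hom.appTop, Scheme.Hom.resLE_app_top]
  simp [Scheme.Opens.topIso]
  erw [Iso.inv_hom_id_assoc, Iso.inv_hom_id, Category.comp_id]

theorem stalkIdeal_eq_map (J : X.IdealSheafData) (U : X.affineOpens) {p : X} (h : p ∈ U.1) :
    stalkIdeal J p = (J.ideal U).map (X.presheaf.germ U.1 p h).hom := by
  apply le_antisymm
  · refine iSup₂_le fun V hV => ?_
    obtain ⟨W, hW, hpW, hWUV⟩ := exists_isAffineOpen_mem_and_subset (U := U.1 ⊓ V.1) ⟨h, hV⟩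
    have h1 := J.map_ideal (U := ⟨W, hW⟩) (V := U) (hWUV.trans inf_le_left)
    have h2 := J.map_ideal (U := ⟨W, hW⟩) (V := V) (hWUV.trans inf_le_right)
    have e1 := X.presheaf.germ_res (homOfLE (hWUV.trans inf_le_left)) p hpW
    have e2 := X.presheaf.germ_res (homOfLE (hWUV.trans inf_le_right)) p hpW
    rw [← e1, ← e2, CommRingCat.hom_comp, CommRingCat.hom_comp, ← Ideal.map_map, ← Ideal.map_map]
    exact (congrArg (Ideal.map _) (h2.trans h1.symm)).le
  · exact le_iSup₂_of_le U h le_rfl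

lemma exists_affineOpens_mem (p : X) : ∃ U : X.affineOpens, p ∈ U.1 := by
  obtain ⟨U, hU, hp, -⟩ := exists_isAffineOpen_mem_and_subset (U := ⊤) (x := p) trivial
  exact ⟨⟨U, hU⟩, hp⟩

/-- The stalk of ideal sheaves as a homomorphism of monoids. -/
def stalkIdealHom (p : X) : X.IdealSheafData →* Ideal (X.presheaf.stalk p) where
  toFun J := stalkIdeal J p
  map_one' := by
    obtain ⟨U, hU⟩ := exists_affineOpens_mem p
    rw [stalkIdeal_eq_map _ U hU, one_eq_top, ideal_top, Pi.top_apply, Ideal.map_top,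
      Ideal.one_eq_top]
  map_mul' I J := by
    obtain ⟨U, hU⟩ := exists_affineOpens_mem p
    rw [stalkIdeal_eq_map _ U hU, stalkIdeal_eq_map _ U hU, stalkIdeal_eq_map _ U hU, ideal_mul,
      Pi.mul_apply, Ideal.map_mul]

lemma stalkIdeal_mul (I J : X.IdealSheafData) (p : X) :
    stalkIdeal (I * J) p = stalkIdeal I p * stalkIdeal J p := (stalkIdealHom p).map_mul I J

lemma stalkIdeal_pow (I : X.IdealSheafData) (n : ℕ) (p : X) :
    stalkIdeal (I ^ n) p = stalkIdeal I p ^ n := (stalkIdealHom p).map_pow I n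

theorem stalkIdeal_comap (J : Y.IdealSheafData) (f : X ⟶ Y) (p : X) :
    stalkIdeal (J.comap f) p = (stalkIdeal J (f p)).map (f.stalkMap p).hom := by
  obtain ⟨V, hV⟩ := exists_affineOpens_mem (f p)
  obtain ⟨U, hU, hp, hUV⟩ := exists_isAffineOpen_mem_and_subset (U := f ⁻¹ᵁ V.1) (x := p) hV
  rw [stalkIdeal_eq_map _ ⟨U, hU⟩ hp, stalkIdeal_eq_map _ V hV, ideal_comap J f V ⟨U, hU⟩ hUV,
    Ideal.map_map, Ideal.map_map, ← CommRingCat.hom_comp, ← CommRingCat.hom_comp]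
  congr 2
  rw [Scheme.Hom.germ_stalkMap]
  change (f.app V.1 ≫ X.presheaf.map (homOfLE hUV).op) ≫ _ = _
  rw [Category.assoc]
  congr 1
  exact X.presheaf.germ_res (homOfLE hUV) p hp

lemma stalkIdeal_specializes (J : X.IdealSheafData) {z q : X} (h : z ⤳ q) :
    stalkIdeal J z = (stalkIdeal J q).map (X.presheaf.stalkSpecializes h).hom := by
  obtain ⟨U, hU⟩ := exists_affineOpens_mem q
  have hz : z ∈ U.1 := h.mem_open U.1.2 hU
  rw [stalkIdeal_eq_map _ U hU, stalkIdeal_eq_map _ U hz, Ideal.map_map, ← CommRingCat.hom_comp,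
    TopCat.Presheaf.germ_stalkSpecializes]

lemma le_of_stalkIdeal_le {I J : X.IdealSheafData} (h : ∀ p, stalkIdeal I p ≤ stalkIdeal J p) :
    I ≤ J := by
  intro U
  rw [U.2.ideal_le_iff]
  intro p hp
  rw [← stalkIdeal_eq_map, ← stalkIdeal_eq_map]
  exact h p

lemma exists_isClosed_mem_of_specializes [JacobsonSpace X] (z : X) (U : X.Opens) (hz : z ∈ U) :
    ∃ q, IsClosed ({q} : Set X) ∧ z ⤳ q ∧ q ∈ U := by
  obtain ⟨q, ⟨h1, h2⟩, hq⟩ := nonempty_inter_closedPoints (Z := closure {z} ∩ (U : Set X))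
    ⟨z, subset_closure rfl, hz⟩ (isClosed_closure.isLocallyClosed.inter U.2.isLocallyClosed)
  exact ⟨q, hq, specializes_iff_mem_closure.mpr h1, h2⟩

lemma le_of_stalkIdeal_le_of_isClosed [JacobsonSpace X] {I J : X.IdealSheafData}
    (h : ∀ p, IsClosed ({p} : Set X) → stalkIdeal I p ≤ stalkIdeal J p) : I ≤ J := by
  refine le_of_stalkIdeal_le fun z => ?_
  obtain ⟨q, hq, hzq, -⟩ := exists_isClosed_mem_of_specializes z ⊤ trivial
  rw [stalkIdeal_specializes I hzq, stalkIdeal_specializes J hzq]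
  exact Ideal.map_mono (h q hq)

lemma ext_of_stalkIdeal_of_isClosed [JacobsonSpace X] {I J : X.IdealSheafData}
    (h : ∀ p, IsClosed ({p} : Set X) → stalkIdeal I p = stalkIdeal J p) : I = J :=
  le_antisymm (le_of_stalkIdeal_le_of_isClosed fun p hp => (h p hp).le)
    (le_of_stalkIdeal_le_of_isClosed fun p hp => (h p hp).ge)

/-! ### Generizations and prime ideals of the stalk -/

/-- The prime ideal of the stalk at `q` which corresponds to a generization `z` of `q`. -/
def primeOf {z q : X} (h : z ⤳ q) : Ideal (X.presheaf.stalk q) :=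
  (IsLocalRing.maximalIdeal (X.presheaf.stalk z)).comap (X.presheaf.stalkSpecializes h).hom

instance {z q : X} (h : z ⤳ q) : (primeOf h).IsPrime := by
  unfold primeOf; infer_instance

@[simp] lemma primeOf_refl (q : X) :
    primeOf (specializes_refl q) = IsLocalRing.maximalIdeal (X.presheaf.stalk q) := by
  unfold primeOf
  rw [TopCat.Presheaf.stalkSpecializes_refl]
  exact Ideal.comap_id _

lemma mem_support_iff_stalkIdeal_le (I : X.IdealSheafData) (z : X) :
    z ∈ I.support ↔ stalkIdeal I z ≤ IsLocalRing.maximalIdeal (X.presheaf.stalk z) := by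
  obtain ⟨U, hU⟩ := exists_affineOpens_mem z
  rw [mem_support_iff_of_mem hU, Scheme.mem_zeroLocus_iff, stalkIdeal_eq_map _ U hU,
    Ideal.map_le_iff_le_comap]
  refine forall₂_congr fun f hf => ?_
  rw [Scheme.mem_basicOpen _ _ _ hU]
  rfl

lemma stalkIdeal_le_primeOf_iff (I : X.IdealSheafData) {z q : X} (h : z ⤳ q) :
    stalkIdeal I q ≤ primeOf h ↔ z ∈ I.support := by
  rw [mem_support_iff_stalkIdeal_le, stalkIdeal_specializes I h, Ideal.map_le_iff_le_comap]
  rfl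

lemma stalkIdeal_eq_top_iff (I : X.IdealSheafData) (z : X) :
    stalkIdeal I z = ⊤ ↔ z ∉ I.support := by
  rw [mem_support_iff_stalkIdeal_le]
  exact ⟨fun h h2 => (IsLocalRing.maximalIdeal.isMaximal _).ne_top (top_le_iff.mp (h ▸ h2)),
    fun h => by_contra fun h2 => h (IsLocalRing.le_maximalIdeal h2)⟩

@[simp] lemma mem_support_idealOf (Z : Closeds X) (z : X) : z ∈ (idealOf Z).support ↔ z ∈ Z := by
  rw [← SetLike.mem_coe, coe_support_vanishingIdeal]; rfl

lemma stalkIdeal_idealOf_le_primeOf_iff (Z : Closeds X) {z q : X} (h : z ⤳ q) :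
    stalkIdeal (idealOf Z) q ≤ primeOf h ↔ z ∈ Z := by
  rw [stalkIdeal_le_primeOf_iff, mem_support_idealOf]

lemma germ_mem_primeOf_iff {z q : X} (h : z ⤳ q) {U : X.Opens} (hq : q ∈ U) (f : Γ(X, U)) :
    X.presheaf.germ U q hq f ∈ primeOf h ↔ z ∉ X.basicOpen f := by
  have hz : z ∈ U := h.mem_open U.2 hq
  rw [Scheme.mem_basicOpen _ _ _ hz, primeOf, Ideal.mem_comap, ← CommRingCat.comp_apply,
    TopCat.Presheaf.germ_stalkSpecializes]
  rfl

lemma primeOf_le_primeOf_iff {z₁ z₂ q : X} (h₁ : z₁ ⤳ q) (h₂ : z₂ ⤳ q) :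
    primeOf h₁ ≤ primeOf h₂ ↔ z₁ ⤳ z₂ := by
  constructor
  · intro h
    have h3 := (stalkIdeal_idealOf_le_primeOf_iff ⟨closure {z₁}, isClosed_closure⟩ h₁).mpr
      (subset_closure rfl)
    have h4 := (stalkIdeal_idealOf_le_primeOf_iff _ h₂).mp (h3.trans h)
    exact specializes_iff_mem_closure.mpr h4
  · intro h x hx
    obtain ⟨U, hq, f, rfl⟩ := X.presheaf.exists_germ_eq x
    rw [germ_mem_primeOf_iff] at hx ⊢
    exact fun h5 => hx (h.mem_open (X.basicOpen f).2 h5)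

lemma primeOf_injective {z₁ z₂ q : X} (h₁ : z₁ ⤳ q) (h₂ : z₂ ⤳ q) (h : primeOf h₁ = primeOf h₂) :
    z₁ = z₂ :=
  (((primeOf_le_primeOf_iff h₁ h₂).mp h.le).antisymm ((primeOf_le_primeOf_iff h₂ h₁).mp h.ge)).eq

lemma exists_primeOf_eq (q : X) (P : Ideal (X.presheaf.stalk q)) [hP : P.IsPrime] :
    ∃ (z : X) (h : z ⤳ q), primeOf h = P := by
  let P' : Spec (X.presheaf.stalk q) := ⟨P, hP⟩
  have h : X.fromSpecStalk q P' ⤳ q := by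
    have : X.fromSpecStalk q P' ∈ Set.range (X.fromSpecStalk q) := ⟨P', rfl⟩
    rwa [Scheme.range_fromSpecStalk] at this
  refine ⟨X.fromSpecStalk q P', h, ?_⟩
  ext x
  obtain ⟨U, hq, f, rfl⟩ := X.presheaf.exists_germ_eq x
  rw [germ_mem_primeOf_iff]
  have h1 : X.fromSpecStalk q P' ∈ X.basicOpen f ↔
      P' ∈ (X.fromSpecStalk q) ⁻¹ᵁ X.basicOpen f := Iff.rfl
  rw [h1, Scheme.preimage_basicOpen, Scheme.fromSpecStalk_app hq,
    CommRingCat.comp_apply, CommRingCat.comp_apply, Scheme.basicOpen_res,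
    basicOpen_eq_of_affine]
  have h2 : P' ∈ X.fromSpecStalk q ⁻¹ᵁ U := h.mem_open U.2 hq
  exact ⟨fun h3 => by_contra fun h4 => h3 ⟨h2, h4⟩, fun h3 h4 => h4.2 h3⟩

lemma primeOf_map (f : X ⟶ Y) {z q : X} (h : z ⤳ q) :
    primeOf (h.map f.continuous) = (primeOf h).comap (f.stalkMap q).hom := by
  ext x
  obtain ⟨U, hq, s, rfl⟩ := Y.presheaf.exists_germ_eq x
  rw [germ_mem_primeOf_iff, Ideal.mem_comap, ← CommRingCat.comp_apply, Scheme.Hom.germ_stalkMap,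
    CommRingCat.comp_apply]
  refine Iff.trans ?_ (germ_mem_primeOf_iff h (U := f ⁻¹ᵁ U) hq (f.app U s)).symm
  rw [← Scheme.preimage_basicOpen]
  rfl

lemma isRadical_stalkIdeal_idealOf (Z : Closeds X) (q : X) :
    (stalkIdeal (idealOf Z) q).IsRadical := by
  obtain ⟨U, hU⟩ := exists_affineOpens_mem q
  let := X.presheaf.algebra_section_stalk ⟨q, hU⟩
  have := U.2.isLocalization_stalk ⟨q, hU⟩
  have h1 : ((idealOf Z).ideal U).IsRadical := by
    rw [vanishingIdeal_ideal]
    exact PrimeSpectrum.isRadical_vanishingIdeal _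
  have h2 := IsLocalization.map_radical (U.2.primeIdealOf ⟨q, hU⟩).asIdeal.primeCompl
    (X.presheaf.stalk q) ((idealOf Z).ideal U)
  rw [h1.radical] at h2
  rw [stalkIdeal_eq_map _ U hU]
  exact Ideal.radical_eq_iff.mp h2.symm

theorem mem_stalkIdeal_idealOf_iff (Z : Closeds X) (q : X) (x : X.presheaf.stalk q) :
    x ∈ stalkIdeal (idealOf Z) q ↔ ∀ (z : X) (h : z ⤳ q), z ∈ Z → x ∈ primeOf h := by
  refine ⟨fun hx z h hz => (stalkIdeal_idealOf_le_primeOf_iff Z h).mpr hz hx, fun hx => ?_⟩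
  rw [← (isRadical_stalkIdeal_idealOf Z q).radical, Ideal.radical_eq_sInf, Ideal.mem_sInf]
  rintro P ⟨hP, hP'⟩
  obtain ⟨z, h, rfl⟩ := exists_primeOf_eq q P
  exact hx z h ((stalkIdeal_idealOf_le_primeOf_iff Z h).mp hP)

lemma stalkIdeal_idealOf_eq_primeOf (C : IrreducibleCloseds X) {z q : X} (h : z ⤳ q)
    (hz : closure {z} = (C : Set X)) : stalkIdeal (idealOf (toCloseds C)) q = primeOf h := by
  apply le_antisymm
  · rw [stalkIdeal_idealOf_le_primeOf_iff]
    change z ∈ (C : Set X)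
    exact hz ▸ subset_closure rfl
  · intro x hx
    rw [mem_stalkIdeal_idealOf_iff]
    intro w hw hwC
    refine (primeOf_le_primeOf_iff h hw).mpr ?_ hx
    change w ∈ (C : Set X) at hwC
    exact specializes_iff_mem_closure.mpr (hz ▸ hwC)

lemma isLocalization_stalkSpecializes {z q : X} (h : z ⤳ q) :
    @IsLocalization.AtPrime _ _ (X.presheaf.stalk z) _ (X.presheaf.stalkSpecializes h).hom.toAlgebra
      (primeOf h) _ := by
  obtain ⟨U, hU⟩ := exists_affineOpens_mem q
  have hz : z ∈ U.1 := h.mem_open U.1.2 hU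
  let := X.presheaf.algebra_section_stalk ⟨q, hU⟩
  have := U.2.isLocalization_stalk ⟨q, hU⟩
  let := X.presheaf.algebra_section_stalk ⟨z, hz⟩
  have := U.2.isLocalization_stalk ⟨z, hz⟩
  let := (X.presheaf.stalkSpecializes h).hom.toAlgebra
  have : IsScalarTower Γ(X, U.1) (X.presheaf.stalk q) (X.presheaf.stalk z) :=
    .of_algebraMap_eq' (by
      change _ = (X.presheaf.stalkSpecializes h).hom.comp (X.presheaf.germ U.1 q hU).hom
      rw [← CommRingCat.hom_comp, TopCat.Presheaf.germ_stalkSpecializes]; rfl)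
  let P := (U.2.primeIdealOf ⟨q, hU⟩).asIdeal
  let Q := (U.2.primeIdealOf ⟨z, hz⟩).asIdeal
  have hP' : P = (IsLocalRing.maximalIdeal _).comap (X.presheaf.germ U.1 q hU).hom :=
    congrArg PrimeSpectrum.asIdeal (U.2.primeIdealOf_eq_map_closedPoint ⟨q, hU⟩)
  have hQ' : Q = (IsLocalRing.maximalIdeal _).comap (X.presheaf.germ U.1 z hz).hom :=
    congrArg PrimeSpectrum.asIdeal (U.2.primeIdealOf_eq_map_closedPoint ⟨z, hz⟩)
  have hQ : (primeOf h).comap (algebraMap Γ(X, U.1) (X.presheaf.stalk q)) = Q := by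
    ext a
    rw [hQ', Ideal.mem_comap, Ideal.mem_comap]
    refine (germ_mem_primeOf_iff h hU a).trans ?_
    rw [Scheme.mem_basicOpen _ _ _ hz]
    rfl
  have hle : P.primeCompl ≤ Q.primeCompl := by
    intro a ha ha'
    refine ha ?_
    rw [SetLike.mem_coe, ← hQ, Ideal.mem_comap] at ha'
    rw [SetLike.mem_coe, hP', Ideal.mem_comap]
    exact IsLocalRing.le_maximalIdeal (inferInstance : (primeOf h).IsPrime).ne_top ha'
  have key := IsLocalization.isLocalization_of_submonoid_le (X.presheaf.stalk q)
    (X.presheaf.stalk z) P.primeCompl Q.primeCompl hle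
  refine @IsLocalization.isLocalization_of_is_exists_mul_mem _ _ _ _ _ _ _ key ?_ ?_
  · rintro _ ⟨a, ha, rfl⟩ h2
    exact ha (hQ ▸ h2)
  · rintro ⟨x, hx⟩
    obtain ⟨⟨y, s⟩, e⟩ := IsLocalization.surj P.primeCompl x
    refine ⟨algebraMap _ _ s.1, y, ?_, by rw [mul_comm]; exact e.symm⟩
    intro hy
    rw [SetLike.mem_coe, ← hQ, Ideal.mem_comap, ← e] at hy
    refine ((inferInstance : (primeOf h).IsPrime).mem_or_mem hy).elim hx fun h3 => ?_
    exact (hle s.2) (hQ ▸ h3)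

/-! ### Spreading out -/

lemma exists_forall_mul_mem {R S : Type*} [CommRing R] [CommRing S] [Algebra R S] (M : Submonoid R)
    [IsLocalization M S] {I K : Ideal R} (hI : I.FG)
    (h : I.map (algebraMap R S) ≤ K.map (algebraMap R S)) : ∃ s ∈ M, ∀ x ∈ I, s * x ∈ K := by
  obtain ⟨T, rfl⟩ := hI
  have h1 : ∀ x ∈ T, ∃ s ∈ M, s * x ∈ K := fun x hx =>
    (IsLocalization.algebraMap_mem_map_algebraMap_iff M S K x).mp
      (h (Ideal.mem_map_of_mem _ (Ideal.subset_span hx)))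
  choose! s hs hsx using h1
  refine ⟨∏ x ∈ T, s x, Submonoid.prod_mem _ hs, fun x hx => ?_⟩
  have h2 : Ideal.span (T : Set R) ≤ Submodule.comap (LinearMap.mulLeft R (∏ x ∈ T, s x)) K := by
    rw [Ideal.span, Submodule.span_le]
    intro y hy
    obtain ⟨c, hc⟩ := Finset.dvd_prod_of_mem s hy
    change (∏ x ∈ T, s x) * y ∈ K
    rw [hc, mul_comm (s y), mul_assoc]
    exact K.mul_mem_left _ (hsx y hy)
  exact h2 hx

lemma exists_open_map_germ_le (U : X.affineOpens) {p : X} (hp : p ∈ U.1) {I K : Ideal Γ(X, U.1)}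
    (hI : I.FG) (h : I.map (X.presheaf.germ U.1 p hp).hom ≤ K.map (X.presheaf.germ U.1 p hp).hom) :
    ∃ s : Γ(X, U.1), p ∈ X.basicOpen s ∧ ∀ (q : X) (hq : q ∈ U.1), q ∈ X.basicOpen s →
      I.map (X.presheaf.germ U.1 q hq).hom ≤ K.map (X.presheaf.germ U.1 q hq).hom := by
  let := X.presheaf.algebra_section_stalk ⟨p, hp⟩
  have := U.2.isLocalization_stalk ⟨p, hp⟩
  obtain ⟨s, hs, hsI⟩ := exists_forall_mul_mem (S := X.presheaf.stalk p)
    (U.2.primeIdealOf ⟨p, hp⟩).asIdeal.primeCompl hI h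
  refine ⟨s, ?_, fun q hq hqs => ?_⟩
  · rw [Scheme.mem_basicOpen _ _ _ hp]
    exact IsLocalization.map_units (X.presheaf.stalk p)
      (⟨s, hs⟩ : (U.2.primeIdealOf ⟨p, hp⟩).asIdeal.primeCompl)
  · rw [Scheme.mem_basicOpen _ _ _ hq] at hqs
    rw [Ideal.map_le_iff_le_comap]
    intro x hx
    rw [Ideal.mem_comap, ← Ideal.unit_mul_mem_iff_mem _ hqs]
    have := Ideal.mem_map_of_mem (X.presheaf.germ U.1 q hq).hom (hsI x hx)
    rwa [map_mul] at this

lemma ideal_fg [IsLocallyNoetherian X] (U : X.affineOpens) (I : Ideal Γ(X, U.1)) : I.FG := by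
  have := IsLocallyNoetherian.component_noetherian (X := X) U
  exact IsNoetherian.noetherian I

lemma exists_open_stalkIdeal_le [IsLocallyNoetherian X] {I J : X.IdealSheafData} {p : X}
    (h : stalkIdeal I p ≤ stalkIdeal J p) :
    ∃ N : X.Opens, p ∈ N ∧ ∀ q ∈ N, stalkIdeal I q ≤ stalkIdeal J q := by
  obtain ⟨U, hU⟩ := exists_affineOpens_mem p
  rw [stalkIdeal_eq_map _ U hU, stalkIdeal_eq_map _ U hU] at h
  obtain ⟨s, hs, hs'⟩ := exists_open_map_germ_le U hU (ideal_fg U _) h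
  refine ⟨X.basicOpen s, hs, fun q hq => ?_⟩
  have hqU := X.basicOpen_le s hq
  rw [stalkIdeal_eq_map _ U hqU, stalkIdeal_eq_map _ U hqU]
  exact hs' q hqU hq

/-- If the stalk of an ideal sheaf at `p` is generated by germs of sections over an affine open
neighbourhood, then the ideal sheaf is generated by these sections over a smaller neighbourhood. -/
lemma exists_basicOpen_ideal_eq [IsLocallyNoetherian X] (I : X.IdealSheafData) (U : X.affineOpens)
    {p : X} (hp : p ∈ U.1) (K : Ideal Γ(X, U.1))
    (h : stalkIdeal I p = K.map (X.presheaf.germ U.1 p hp).hom) :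
    ∃ s : Γ(X, U.1), p ∈ X.basicOpen s ∧ ∀ (V : X.affineOpens) (hVU : V.1 ≤ U.1),
      V.1 ≤ X.basicOpen s → I.ideal V = K.map (X.presheaf.map (homOfLE hVU).op).hom := by
  rw [stalkIdeal_eq_map _ U hp] at h
  obtain ⟨s, hs, hs'⟩ := exists_open_map_germ_le U hp (ideal_fg U _) h.le
  obtain ⟨t, ht, ht'⟩ := exists_open_map_germ_le U hp (ideal_fg U _) h.ge
  refine ⟨s * t, ?_, fun V hVU hV => ?_⟩
  · rw [Scheme.basicOpen_mul]; exact ⟨hs, ht⟩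
  · rw [V.2.ideal_ext_iff]
    intro q hq
    rw [← stalkIdeal_eq_map, stalkIdeal_eq_map I U (hVU hq), Ideal.map_map, ← CommRingCat.hom_comp]
    have := X.presheaf.germ_res (homOfLE hVU) q hq
    rw [this]
    have h3 := hV hq
    rw [Scheme.basicOpen_mul] at h3
    exact le_antisymm (hs' q (hVU hq) h3.1) (ht' q (hVU hq) h3.2)

end IdealSheaf

end MonomialResolution

end

noncomputable section

namespace MonomialResolution

/-! ### Affine blowup algebras -/

section BlowupAlgebra

variable {A : Type*} [CommRing A]

/-- The affine blowup algebra `A[I/a]`, as a subalgebra of `A[1/a]`. -/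
def blowupAlgebra (I : Ideal A) (a : A) : Subalgebra A (Localization.Away a) :=
  Algebra.adjoin A {x | ∃ f ∈ I, algebraMap A _ a * x = algebraMap A _ f}

namespace blowupAlgebra

variable (I : Ideal A) (a : A)

lemma isUnit_algebraMap : IsUnit (algebraMap A (Localization.Away a) a) :=
  IsLocalization.Away.algebraMap_isUnit a

lemma algebraMap_mem_nonZeroDivisors :
    algebraMap A (blowupAlgebra I a) a ∈ nonZeroDivisors (blowupAlgebra I a) := by
  rw [mem_nonZeroDivisors_iff_right]
  intro x hx
  have h := congrArg Subtype.val hx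
  exact Subtype.ext (((isUnit_algebraMap a).mul_left_eq_zero).mp h)

lemma exists_mul_eq {f : A} (hf : f ∈ I) :
    ∃ x : blowupAlgebra I a, algebraMap A _ a * x = algebraMap A _ f := by
  obtain ⟨u, hu⟩ := isUnit_algebraMap a
  have h1 : algebraMap A _ a * (↑u⁻¹ * algebraMap A (Localization.Away a) f) =
      algebraMap A _ f := by rw [← hu, Units.mul_inv_cancel_left]
  exact ⟨⟨_, Algebra.subset_adjoin ⟨f, hf, h1⟩⟩, Subtype.ext h1⟩

lemma map_eq_span (ha : a ∈ I) :
    I.map (algebraMap A (blowupAlgebra I a)) = Ideal.span {algebraMap A _ a} := by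
  apply le_antisymm
  · rw [Ideal.map_le_iff_le_comap]
    intro f hf
    obtain ⟨x, hx⟩ := exists_mul_eq I a hf
    exact Ideal.mem_span_singleton'.mpr ⟨x, by rw [← hx, mul_comm]⟩
  · rw [Ideal.span_singleton_le_iff_mem]
    exact Ideal.mem_map_of_mem _ ha

variable {I a} {R : Type*} [CommRing R]

lemma hom_ext {φ ψ : blowupAlgebra I a →+* R}
    (h : φ.comp (algebraMap A _) = ψ.comp (algebraMap A _))
    (ha : φ (algebraMap A _ a) ∈ nonZeroDivisors R) : φ = ψ := by
  have key : ∀ x (hx : x ∈ blowupAlgebra I a), φ ⟨x, hx⟩ = ψ ⟨x, hx⟩ := by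
    intro x hx
    induction hx using Algebra.adjoin_induction with
    | mem x hx =>
      obtain ⟨f, hf, h1⟩ := hx
      have h2 : algebraMap A _ a * (⟨x, Algebra.subset_adjoin ⟨f, hf, h1⟩⟩ : blowupAlgebra I a) =
        algebraMap A _ f := Subtype.ext h1
      have h3 := congrArg φ h2
      have h4 := congrArg ψ h2
      have h5 := RingHom.congr_fun h f
      have h6 := RingHom.congr_fun h a
      simp only [RingHom.comp_apply, map_mul] at h3 h4 h5 h6
      rw [h5, ← h4, ← h6] at h3
      exact mul_cancel_left_mem_nonZeroDivisors ha |>.mp h3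
    | algebraMap r => exact RingHom.congr_fun h r
    | add x y hx hy h1 h2 =>
      exact (map_add φ ⟨x, hx⟩ ⟨y, hy⟩).trans
        ((congrArg₂ (· + ·) h1 h2).trans (map_add ψ ⟨x, hx⟩ ⟨y, hy⟩).symm)
    | mul x y hx hy h1 h2 =>
      exact (map_mul φ ⟨x, hx⟩ ⟨y, hy⟩).trans
        ((congrArg₂ (· * ·) h1 h2).trans (map_mul ψ ⟨x, hx⟩ ⟨y, hy⟩).symm)
  exact RingHom.ext fun x => key x.1 x.2

lemma exists_lift (φ : A →+* R) (ha : φ a ∈ nonZeroDivisors R)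
    (hI : ∀ f ∈ I, φ f ∈ Ideal.span {φ a}) :
    ∃ ψ : blowupAlgebra I a →+* R, ψ.comp (algebraMap A _) = φ := by
  let S := Localization.Away (φ a)
  have hinj : Function.Injective (algebraMap R S) :=
    IsLocalization.injective S (M := Submonoid.powers (φ a)) (Submonoid.powers_le.mpr ha)
  let L : Localization.Away a →+* S :=
    IsLocalization.Away.lift (g := (algebraMap R S).comp φ) a
      (IsLocalization.Away.algebraMap_isUnit (φ a))
  have hL : ∀ f, L (algebraMap A _ f) = algebraMap R S (φ f) := fun f =>
    IsLocalization.Away.lift_eq a _ f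
  have key : ∀ x ∈ blowupAlgebra I a, L x ∈ (algebraMap R S).range := by
    intro x hx
    induction hx using Algebra.adjoin_induction with
    | mem x hx =>
      obtain ⟨f, hf, h1⟩ := hx
      obtain ⟨r, hr⟩ := Ideal.mem_span_singleton'.mp (hI f hf)
      refine ⟨r, ?_⟩
      have h2 := congrArg L h1
      rw [map_mul, hL, hL, ← hr, map_mul, mul_comm] at h2
      exact ((IsLocalization.Away.algebraMap_isUnit (S := S) (φ a)).mul_left_inj.mp h2).symm
    | algebraMap r => exact ⟨φ r, (hL r).symm⟩
    | add x y hx hy h1 h2 => rw [map_add]; exact add_mem h1 h2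
    | mul x y hx hy h1 h2 => rw [map_mul]; exact mul_mem h1 h2
  let L' : blowupAlgebra I a →+* (algebraMap R S).range :=
    (L.comp (blowupAlgebra I a).val.toRingHom).codRestrict _ fun x => key x.1 x.2
  let e : R ≃+* (algebraMap R S).range :=
    RingEquiv.ofBijective (algebraMap R S).rangeRestrict
      ⟨fun x y h => hinj (congrArg Subtype.val h), (algebraMap R S).rangeRestrict_surjective⟩
  refine ⟨e.symm.toRingHom.comp L', RingHom.ext fun f => ?_⟩
  change e.symm (L' _) = _
  rw [RingEquiv.symm_apply_eq]
  exact Subtype.ext (hL f)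

lemma isDomain [IsDomain A] (ha : a ≠ 0) : IsDomain (blowupAlgebra I a) := by
  have : IsDomain (Localization.Away a) :=
    IsLocalization.isDomain_localization (powers_le_nonZeroDivisors_of_noZeroDivisors ha)
  infer_instance

end blowupAlgebra

end BlowupAlgebra

/-! ### Invertible ideal sheaves -/

section Invertible

variable {X Y : Scheme.{u}}

open Scheme.IdealSheafData

/-- A section `f` over `U` generates the ideal sheaf `I` over `U` and is a nonzerodivisor. -/
def IsGenerator (I : X.IdealSheafData) {U : X.Opens} (f : Γ(X, U)) : Prop :=
  ∀ q (hq : q ∈ U), stalkIdeal I q = Ideal.span {X.presheaf.germ U q hq f} ∧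
    X.presheaf.germ U q hq f ∈ nonZeroDivisors (X.presheaf.stalk q)

lemma IsGenerator.map {I : X.IdealSheafData} {U V : X.Opens} {f : Γ(X, U)} (h : IsGenerator I f)
    (i : V ≤ U) : IsGenerator I (X.presheaf.map (homOfLE i).op f) := by
  intro q hq
  have := X.presheaf.germ_res_apply (homOfLE i) q hq f
  rw [this]
  exact h q (i hq)

lemma mem_nonZeroDivisors_of_germ {U : X.Opens} {f : Γ(X, U)}
    (h : ∀ q (hq : q ∈ U), X.presheaf.germ U q hq f ∈ nonZeroDivisors (X.presheaf.stalk q)) :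
    f ∈ nonZeroDivisors Γ(X, U) := by
  rw [mem_nonZeroDivisors_iff_right]
  intro g hg
  refine TopCat.Presheaf.section_ext X.sheaf U _ _ fun q hq => ?_
  have h1 := congrArg (X.presheaf.germ U q hq) hg
  rw [map_mul, map_zero] at h1
  have := (mem_nonZeroDivisors_iff_right.mp (h q hq)) _ h1
  exact this.trans (map_zero _).symm

lemma IsGenerator.mem_nonZeroDivisors {I : X.IdealSheafData} {U : X.Opens} {f : Γ(X, U)}
    (h : IsGenerator I f) : f ∈ nonZeroDivisors Γ(X, U) :=
  mem_nonZeroDivisors_of_germ fun q hq => (h q hq).2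

lemma IsGenerator.ideal_eq {I : X.IdealSheafData} {U : X.affineOpens} {f : Γ(X, U.1)}
    (h : IsGenerator I f) : I.ideal U = Ideal.span {f} := by
  rw [U.2.ideal_ext_iff]
  intro q hq
  rw [← stalkIdeal_eq_map, Ideal.map_span, Set.image_singleton]
  exact (h q hq).1

lemma isGenerator_of_ideal_eq {I : X.IdealSheafData} {U : X.affineOpens} {f : Γ(X, U.1)}
    (hf : f ∈ nonZeroDivisors Γ(X, U.1)) (h : I.ideal U = Ideal.span {f}) : IsGenerator I f := by
  intro q hq
  refine ⟨by rw [stalkIdeal_eq_map _ U hq, h, Ideal.map_span, Set.image_singleton], ?_⟩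
  let := X.presheaf.algebra_section_stalk ⟨q, hq⟩
  have := U.2.isLocalization_stalk ⟨q, hq⟩
  exact IsLocalization.map_nonZeroDivisors_le (U.2.primeIdealOf ⟨q, hq⟩).asIdeal.primeCompl
    (X.presheaf.stalk q) (Submonoid.mem_map_of_mem _ hf)

lemma isInvertible_iff {I : X.IdealSheafData} :
    IsInvertible I ↔ ∀ p : X, ∃ U : X.Opens, p ∈ U ∧ ∃ f : Γ(X, U), IsGenerator I f := by
  refine forall_congr' fun p => ⟨?_, ?_⟩
  · rintro ⟨U, hp, f, hf, h⟩
    exact ⟨U.1, hp, f, isGenerator_of_ideal_eq hf h⟩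
  · rintro ⟨U, hp, f, h⟩
    obtain ⟨V, hV, hpV, hVU⟩ := exists_isAffineOpen_mem_and_subset hp
    have := h.map (V := V) hVU
    exact ⟨⟨V, hV⟩, hpV, _, this.mem_nonZeroDivisors, IsGenerator.ideal_eq (U := ⟨V, hV⟩) this⟩

lemma mem_nonZeroDivisors_of_span_eq {R : Type*} [CommRing R] {f g : R}
    (h : Ideal.span {f} = Ideal.span {g}) (hf : f ∈ nonZeroDivisors R) :
    g ∈ nonZeroDivisors R := by
  obtain ⟨c, hc⟩ := Ideal.mem_span_singleton'.mp (h ▸ Ideal.mem_span_singleton_self f)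
  rw [← hc] at hf
  exact (mul_mem_nonZeroDivisors.mp hf).2

lemma IsInvertible.exists_stalk {I : X.IdealSheafData} (hI : IsInvertible I) (q : X) :
    ∃ g ∈ nonZeroDivisors (X.presheaf.stalk q), stalkIdeal I q = Ideal.span {g} := by
  obtain ⟨U, hU, f, hf⟩ := isInvertible_iff.mp hI q
  exact ⟨_, (hf q hU).2, (hf q hU).1⟩

lemma IsInvertible.isGenerator {I : X.IdealSheafData} (hI : IsInvertible I) {U : X.Opens}
    {f : Γ(X, U)} (h : ∀ q (hq : q ∈ U), stalkIdeal I q = Ideal.span {X.presheaf.germ U q hq f}) :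
    IsGenerator I f := by
  intro q hq
  obtain ⟨g, hg, e⟩ := hI.exists_stalk q
  exact ⟨h q hq, mem_nonZeroDivisors_of_span_eq (e.symm.trans (h q hq)) hg⟩

/-- If a section of an invertible ideal sheaf generates the stalk at a point, then it is a generator
in a neighbourhood. -/
lemma IsInvertible.exists_isGenerator {I : X.IdealSheafData} (hI : IsInvertible I) {U : X.Opens}
    {f : Γ(X, U)} (hf : ∀ q (hq : q ∈ U), X.presheaf.germ U q hq f ∈ stalkIdeal I q) {p : X}
    (hp : p ∈ U) (h : stalkIdeal I p = Ideal.span {X.presheaf.germ U p hp f}) :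
    ∃ (V : X.Opens) (i : V ≤ U), p ∈ V ∧ IsGenerator I (X.presheaf.map (homOfLE i).op f) := by
  obtain ⟨V, hpV, g, hg⟩ := isInvertible_iff.mp hI p
  obtain ⟨N, hN, hpN, hNUV⟩ := exists_isAffineOpen_mem_and_subset (U := U ⊓ V) ⟨hp, hpV⟩
  have hNU : N ≤ U := hNUV.trans inf_le_left
  have hg' := hg.map (V := N) (hNUV.trans inf_le_right)
  set g' := X.presheaf.map (homOfLE (hNUV.trans inf_le_right)).op g
  set f' := X.presheaf.map (homOfLE hNU).op f with hf'
  have e : ∀ q (hq : q ∈ N), X.presheaf.germ N q hq f' = X.presheaf.germ U q (hNU hq) f :=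
    fun q hq => X.presheaf.germ_res_apply (homOfLE hNU) q hq f
  have h1 : f' ∈ Ideal.span {g'} := by
    refine (IsGenerator.ideal_eq (U := ⟨N, hN⟩) hg') ▸ hN.mem_ideal_iff.mpr ?_
    intro q hq
    rw [← stalkIdeal_eq_map I ⟨N, hN⟩, e]
    exact hf q _
  obtain ⟨u, hu⟩ := Ideal.mem_span_singleton'.mp h1
  have hu' : ∀ q (hq : q ∈ N), X.presheaf.germ N q hq f' =
      X.presheaf.germ N q hq u * X.presheaf.germ N q hq g' := fun q hq => by rw [← hu, map_mul]
  have h2 : IsUnit (X.presheaf.germ N p hpN u) := by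
    have h3 := (hg' p hpN).1.symm.trans h
    rw [← e p hpN] at h3
    obtain ⟨c, hc⟩ := Ideal.mem_span_singleton'.mp (h3 ▸ Ideal.mem_span_singleton_self _)
    rw [hu' p hpN, ← mul_assoc] at hc
    have h4 : c * X.presheaf.germ N p hpN u = 1 :=
      mul_cancel_right_mem_nonZeroDivisors (hg' p hpN).2 |>.mp (hc.trans (one_mul _).symm)
    exact IsUnit.of_mul_eq_one _ ((mul_comm _ _).trans h4)
  refine ⟨X.basicOpen u, (X.basicOpen_le u).trans hNU, ?_, ?_⟩
  · rwa [Scheme.mem_basicOpen _ _ _ hpN]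
  · apply hI.isGenerator
    intro q hq
    have hqN := X.basicOpen_le u hq
    have := X.presheaf.germ_res_apply (homOfLE ((X.basicOpen_le u).trans hNU)) q hq f
    rw [this, ← e q hqN, hu' q hqN, (hg' q hqN).1]
    rw [Scheme.mem_basicOpen _ _ _ hqN] at hq
    exact (Ideal.span_singleton_mul_left_unit hq _).symm

lemma germ_appLE (f : X ⟶ Y) {V : Y.Opens} {U : X.Opens} (e : U ≤ f ⁻¹ᵁ V) (q : X) (hq : q ∈ U)
    (a : Γ(Y, V)) : X.presheaf.germ U q hq (f.appLE V U e a) =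
      f.stalkMap q (Y.presheaf.germ V (f q) (e hq) a) := by
  refine Eq.trans ?_ (Scheme.Hom.germ_stalkMap_apply f V q (e hq) a).symm
  exact X.presheaf.germ_res_apply (homOfLE e) q hq (f.app V a)

lemma mem_nonZeroDivisors_of_bijective {R S : Type*} [CommRing R] [CommRing S] (φ : R →+* S)
    (h : Function.Bijective φ) {x : R} (hx : x ∈ nonZeroDivisors R) :
    φ x ∈ nonZeroDivisors S := by
  rw [mem_nonZeroDivisors_iff_right] at hx ⊢
  intro s hs
  obtain ⟨r, rfl⟩ := h.2 s
  rw [← map_mul] at hs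
  rw [hx r (h.1 (hs.trans (map_zero φ).symm)), map_zero]

lemma bijective_stalkMap (f : X ⟶ Y) [IsOpenImmersion f] (q : X) :
    Function.Bijective (f.stalkMap q).hom :=
  ConcreteCategory.bijective_of_isIso (f.stalkMap q)

lemma IsGenerator.comap {J : Y.IdealSheafData} {V : Y.Opens} {a : Γ(Y, V)} (h : IsGenerator J a)
    (f : X ⟶ Y) (hf : IsInvertible (J.comap f)) {U : X.Opens} (e : U ≤ f ⁻¹ᵁ V) :
    IsGenerator (J.comap f) (f.appLE V U e a) := by
  apply hf.isGenerator
  intro q hq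
  rw [stalkIdeal_comap, (h (f q) (e hq)).1, Ideal.map_span, Set.image_singleton]
  rw [germ_appLE]

lemma IsInvertible.comap {J : Y.IdealSheafData} (hJ : IsInvertible J) (f : X ⟶ Y)
    [IsOpenImmersion f] : IsInvertible (J.comap f) := by
  rw [isInvertible_iff] at hJ ⊢
  intro p
  obtain ⟨V, hV, a, ha⟩ := hJ (f p)
  refine ⟨f ⁻¹ᵁ V, hV, f.appLE V _ le_rfl a, fun q hq => ?_⟩
  obtain ⟨h1, h2⟩ := ha (f q) hq
  rw [germ_appLE]
  exact ⟨by rw [stalkIdeal_comap, h1, Ideal.map_span, Set.image_singleton],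
    mem_nonZeroDivisors_of_bijective _ (bijective_stalkMap f q) h2⟩

end Invertible

end MonomialResolution

end

noncomputable section

namespace MonomialResolution

/-! ### Charts of a blowup -/

section Charts

variable {X : Scheme.{u}}

open Scheme.IdealSheafData Limits

/-- A chart of the blowup along `I`: an affine open subset with a section of `I` over it. -/
structure BlowupChart (I : X.IdealSheafData) where
  U : X.affineOpens
  a : Γ(X, U.1)
  mem : a ∈ I.ideal U

namespace BlowupChart

variable {I : X.IdealSheafData} (c : BlowupChart I)

/-- The coordinate ring of a chart of a blowup. -/
abbrev ring : CommRingCat.{u} := .of (blowupAlgebra (I.ideal c.U) c.a)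

/-- The structure map of the coordinate ring of a chart. -/
abbrev ringMap : Γ(X, c.U.1) ⟶ c.ring :=
  CommRingCat.ofHom (algebraMap Γ(X, c.U.1) (blowupAlgebra (I.ideal c.U) c.a))

/-- The scheme of a chart of a blowup. -/
abbrev V : Scheme.{u} := Spec c.ring

lemma isAffineOpen : IsAffineOpen c.U.1 := c.U.2

/-- The projection of a chart of a blowup. -/
def π : c.V ⟶ X := Spec.map c.ringMap ≫ c.isAffineOpen.fromSpec

lemma π_def : c.π = Spec.map c.ringMap ≫ c.isAffineOpen.fromSpec := rfl

lemma le_preimage : ⊤ ≤ c.π ⁻¹ᵁ c.U.1 := by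
  intro x _
  have : c.isAffineOpen.fromSpec (Spec.map c.ringMap x) ∈ Set.range c.isAffineOpen.fromSpec :=
    ⟨_, rfl⟩
  rw [c.isAffineOpen.range_fromSpec] at this
  exact this

lemma appLE_π (e : ⊤ ≤ c.π ⁻¹ᵁ c.U.1) :
    c.π.appLE c.U.1 ⊤ e = c.ringMap ≫ (Scheme.ΓSpecIso c.ring).inv := by
  have h := IsAffineOpen.SpecMap_appLE_fromSpec c.π c.isAffineOpen (isAffineOpen_top c.V) e
  rw [IsAffineOpen.fromSpec_top, Scheme.isoSpec_Spec_inv] at h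
  have h' : Spec.map (c.π.appLE c.U.1 ⊤ e) ≫ c.isAffineOpen.fromSpec =
      Spec.map (c.ringMap ≫ (Scheme.ΓSpecIso c.ring).inv) ≫ c.isAffineOpen.fromSpec := by
    rw [h, Spec.map_comp, Category.assoc]; rfl
  exact Spec.map_injective ((cancel_mono _).mp h')

lemma isGenerator : IsGenerator (I.comap c.π) (c.π.appLE c.U.1 ⊤ c.le_preimage c.a) := by
  refine isGenerator_of_ideal_eq (U := ⟨⊤, isAffineOpen_top c.V⟩) ?_ ?_
  · rw [appLE_π]
    exact mem_nonZeroDivisors_of_bijective (Scheme.ΓSpecIso c.ring).inv.hom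
      (ConcreteCategory.bijective_of_isIso (Scheme.ΓSpecIso c.ring).inv)
      (blowupAlgebra.algebraMap_mem_nonZeroDivisors (I.ideal c.U) c.a)
  · rw [ideal_comap I c.π c.U ⟨⊤, isAffineOpen_top c.V⟩ c.le_preimage, appLE_π,
      CommRingCat.hom_comp, ← Ideal.map_map]
    refine (congrArg _ (blowupAlgebra.map_eq_span _ _ c.mem)).trans ?_
    rw [Ideal.map_span, Set.image_singleton]
    rfl

lemma isInvertible : IsInvertible (I.comap c.π) :=
  isInvertible_iff.mpr fun _ => ⟨⊤, trivial, _, c.isGenerator⟩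

variable {c} {T T' : Scheme.{u}}

lemma lift_ext {g₁ g₂ : T ⟶ c.V} (h : g₁ ≫ c.π = g₂ ≫ c.π)
    (hT : IsInvertible (I.comap (g₁ ≫ c.π))) : g₁ = g₂ := by
  have h1 : g₁ ≫ Spec.map c.ringMap = g₂ ≫ Spec.map c.ringMap := by
    rw [π_def, ← Category.assoc, ← Category.assoc, cancel_mono] at h
    exact h
  rw [comap_comp] at hT
  have h2 := (c.isGenerator.comap g₁ hT (U := ⊤) le_top).mem_nonZeroDivisors
  have e : (Scheme.ΓSpecIso c.ring).inv ≫ g₁.appTop = (Scheme.ΓSpecIso c.ring).inv ≫ g₂.appTop := by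
    apply CommRingCat.hom_ext
    refine blowupAlgebra.hom_ext ?_ ?_
    · have h3 := congrArg (fun φ => (Scheme.ΓSpecIso _).inv ≫ Scheme.Hom.appTop φ) h1
      simp only [Scheme.Hom.comp_appTop, ← Scheme.ΓSpecIso_inv_naturality_assoc] at h3
      exact congrArg CommRingCat.Hom.hom h3
    · rw [appLE_π] at h2
      have h4 : g₁.appTop = g₁.appLE ⊤ ⊤ le_top := by
        simp [Scheme.Hom.appLE]
        exact (Category.comp_id (g₁.app ⊤)).symm
      rw [h4]
      exact h2
  apply AlgebraicGeometry.ext_of_isAffine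
  exact (cancel_epi _).mp e

lemma exists_lift_of_isAffine [IsAffine T] (f : T ⟶ X) (e : ⊤ ≤ f ⁻¹ᵁ c.U.1)
    (h : IsGenerator (I.comap f) (f.appLE c.U.1 ⊤ e c.a)) : ∃ g : T ⟶ c.V, g ≫ c.π = f := by
  obtain ⟨ψ, hψ⟩ := blowupAlgebra.exists_lift (I := I.ideal c.U) (f.appLE c.U.1 ⊤ e).hom
    h.mem_nonZeroDivisors (by
      intro s hs
      have h1 := IsGenerator.ideal_eq (U := ⟨⊤, isAffineOpen_top T⟩) h
      rw [ideal_comap I f c.U ⟨⊤, isAffineOpen_top T⟩ e] at h1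
      exact h1 ▸ Ideal.mem_map_of_mem _ hs)
  refine ⟨T.isoSpec.hom ≫ Spec.map (CommRingCat.ofHom ψ), ?_⟩
  have h2 : c.ringMap ≫ CommRingCat.ofHom ψ = f.appLE c.U.1 ⊤ e := CommRingCat.hom_ext hψ
  rw [π_def, Category.assoc, ← Spec.map_comp_assoc, h2,
    IsAffineOpen.SpecMap_appLE_fromSpec f c.isAffineOpen (isAffineOpen_top T), IsAffineOpen.fromSpec_top,
    Iso.hom_inv_id_assoc]

end BlowupChart

/-- If lifts along `π` are unique, then they can be constructed locally. -/
lemma exists_lift_of_local {I : X.IdealSheafData} {V T : Scheme.{u}} (π : V ⟶ X)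
    (hπ : ∀ {T : Scheme.{u}} (g₁ g₂ : T ⟶ V), g₁ ≫ π = g₂ ≫ π → IsInvertible (I.comap (g₁ ≫ π)) →
      g₁ = g₂)
    (f : T ⟶ X) (hf : IsInvertible (I.comap f))
    (h : ∀ t : T, ∃ N : T.Opens, t ∈ N ∧ ∃ g : N.toScheme ⟶ V, g ≫ π = N.ι ≫ f) :
    ∃ g : T ⟶ V, g ≫ π = f := by
  choose N hN g hg using h
  let 𝒰 := T.openCoverOfIsOpenCover N (.mk (by ext t; simpa using ⟨t, hN t⟩))
  have hfst : ∀ x y : T, IsInvertible (I.comap ((pullback.fst (N x).ι (N y).ι ≫ g x) ≫ π)) := by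
    intro x y
    rw [Category.assoc, hg, ← Category.assoc, comap_comp]
    exact hf.comap _
  have hcond : ∀ x y : T, (pullback.fst (N x).ι (N y).ι ≫ g x) ≫ π =
      (pullback.snd (N x).ι (N y).ι ≫ g y) ≫ π := by
    intro x y
    rw [Category.assoc, Category.assoc, hg, hg, pullback.condition_assoc]
  refine ⟨𝒰.glueMorphisms g fun x y => hπ _ _ (hcond x y) (hfst x y), ?_⟩
  · refine 𝒰.hom_ext _ _ fun t => ?_
    exact (Category.assoc _ _ _).symm.trans
      ((congrArg (· ≫ π) (𝒰.ι_glueMorphisms g _ t)).trans (hg t))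

namespace BlowupChart

variable {I : X.IdealSheafData} {c : BlowupChart I} {T T' : Scheme.{u}}

/-- The section of a chart generates the pull back of the ideal sheaf at a point. -/
def GeneratesAt (c : BlowupChart I) (f : T ⟶ X) (t : T) : Prop :=
  ∃ h : f t ∈ c.U.1, stalkIdeal (I.comap f) t =
    Ideal.span {f.stalkMap t (X.presheaf.germ c.U.1 (f t) h c.a)}

lemma GeneratesAt.comp {f : T ⟶ X} (g : T' ⟶ T) {t : T'} (h : c.GeneratesAt f (g t)) :
    c.GeneratesAt (g ≫ f) t := by
  obtain ⟨h1, h2⟩ := h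
  refine ⟨h1, ?_⟩
  rw [comap_comp, stalkIdeal_comap, h2, Ideal.map_span, Set.image_singleton,
    Scheme.Hom.stalkMap_comp]
  rfl

lemma generatesAt_π (t : c.V) : c.GeneratesAt c.π t := by
  refine ⟨c.le_preimage trivial, ?_⟩
  rw [← germ_appLE c.π c.le_preimage t (show t ∈ (⊤ : Opens _) from trivial)]
  exact (c.isGenerator t trivial).1

lemma GeneratesAt.exists_isGenerator {f : T ⟶ X} (hf : IsInvertible (I.comap f)) {t : T}
    (h : c.GeneratesAt f t) : ∃ (N : T.Opens) (e : N ≤ f ⁻¹ᵁ c.U.1), t ∈ N ∧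
      IsGenerator (I.comap f) (f.appLE c.U.1 N e c.a) := by
  obtain ⟨h1, h2⟩ := h
  obtain ⟨N, i, htN, hN⟩ := hf.exists_isGenerator (U := f ⁻¹ᵁ c.U.1)
    (f := f.appLE c.U.1 _ le_rfl c.a) (fun q hq => by
      rw [germ_appLE, stalkIdeal_comap, stalkIdeal_eq_map I c.U hq]
      exact Ideal.mem_map_of_mem _ (Ideal.mem_map_of_mem _ c.mem)) h1
    (h2.trans (by rw [← germ_appLE f le_rfl t (show t ∈ f ⁻¹ᵁ c.U.1 from h1)]))
  refine ⟨N, i, htN, ?_⟩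
  rw [← CommRingCat.comp_apply, Scheme.Hom.appLE_map] at hN
  exact hN

/-- The open subset over which the lift to a chart exists. -/
def dom (c : BlowupChart I) (f : T ⟶ X) (hf : IsInvertible (I.comap f)) : T.Opens where
  carrier := {t | c.GeneratesAt f t}
  is_open' := by
    rw [isOpen_iff_forall_mem_open]
    intro t ht
    obtain ⟨N, e, htN, hN⟩ := GeneratesAt.exists_isGenerator hf ht
    refine ⟨N, fun s hs => ⟨e hs, ?_⟩, N.2, htN⟩
    rw [(hN s hs).1, germ_appLE]

lemma exists_lift (f : T ⟶ X) (hf : IsInvertible (I.comap f)) (h : ∀ t, c.GeneratesAt f t) :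
    ∃ g : T ⟶ c.V, g ≫ c.π = f := by
  refine exists_lift_of_local c.π (fun _ _ => lift_ext) f hf fun t => ?_
  obtain ⟨N', e, htN, hN⟩ := GeneratesAt.exists_isGenerator hf (h t)
  obtain ⟨N, hN', htN, hNN⟩ := exists_isAffineOpen_mem_and_subset htN
  refine ⟨N, htN, ?_⟩
  have : IsAffine N.toScheme := hN'
  have hgen : ∀ t : N.toScheme, c.GeneratesAt (N.ι ≫ f) t := fun t => (h t.1).comp N.ι
  have e : ⊤ ≤ (N.ι ≫ f) ⁻¹ᵁ c.U.1 := fun t _ => (hgen t).1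
  refine exists_lift_of_isAffine (N.ι ≫ f) e ?_
  have hinv : IsInvertible (I.comap (N.ι ≫ f)) := by rw [comap_comp]; exact hf.comap _
  apply hinv.isGenerator
  intro q hq
  obtain ⟨h1, h2⟩ := hgen q
  rw [h2, germ_appLE]

lemma isUnit_of_span_eq {R : Type*} [CommRing R] {u g : R} (hg : g ∈ nonZeroDivisors R)
    (h : Ideal.span {g} = Ideal.span {u * g}) : IsUnit u := by
  obtain ⟨c, hc⟩ := Ideal.mem_span_singleton'.mp (h ▸ Ideal.mem_span_singleton_self g)
  rw [← mul_assoc] at hc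
  have h4 : c * u = 1 := mul_cancel_right_mem_nonZeroDivisors hg |>.mp (hc.trans (one_mul _).symm)
  exact IsUnit.of_mul_eq_one _ ((mul_comm _ _).trans h4)

/-- If `T'` lifts to a chart, then so does a neighbourhood of the image of `T'` in `T`. -/
lemma generatesAt_of_lift {f : T ⟶ X} (hf : IsInvertible (I.comap f)) (g : T' ⟶ T)
    (hT' : IsInvertible (I.comap (g ≫ f))) (l : T' ⟶ c.V) (hl : l ≫ c.π = g ≫ f) (t : T') :
    c.GeneratesAt f (g t) := by
  have h1 : c.GeneratesAt (g ≫ f) t := hl ▸ (generatesAt_π (c := c) (l t)).comp l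
  obtain ⟨h2, h3⟩ := h1
  change f (g t) ∈ c.U.1 at h2
  refine ⟨h2, ?_⟩
  obtain ⟨s, hs, e⟩ := hf.exists_stalk (g t)
  have h4 : f.stalkMap (g t) (X.presheaf.germ c.U.1 (f (g t)) h2 c.a) ∈ stalkIdeal (I.comap f) (g t) := by
    rw [stalkIdeal_comap, stalkIdeal_eq_map I c.U h2]
    exact Ideal.mem_map_of_mem _ (Ideal.mem_map_of_mem _ c.mem)
  rw [e] at h4 ⊢
  obtain ⟨w, hw⟩ := Ideal.mem_span_singleton'.mp h4
  have h5 : stalkIdeal (I.comap (g ≫ f)) t = Ideal.span {(g.stalkMap t).hom s} := by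
    rw [comap_comp, stalkIdeal_comap, e, Ideal.map_span, Set.image_singleton]
  have h6 : (g.stalkMap t).hom s ∈ nonZeroDivisors _ := by
    obtain ⟨s', hs', e'⟩ := hT'.exists_stalk t
    exact mem_nonZeroDivisors_of_span_eq (e'.symm.trans h5) hs'
  have h7 : IsUnit ((g.stalkMap t).hom w) := by
    refine isUnit_of_span_eq h6 ?_
    rw [← map_mul, hw, ← h5, h3, Scheme.Hom.stalkMap_comp]
    rfl
  have h8 : IsUnit w := isUnit_of_map_unit (g.stalkMap t).hom w h7
  rw [← hw]
  exact (Ideal.span_singleton_mul_left_unit h8 _).symm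

/-- The charts cover. -/
lemma exists_generatesAt {f : T ⟶ X} (hf : IsInvertible (I.comap f)) (t : T) (U : X.affineOpens)
    (ht : f t ∈ U.1) (S : Set Γ(X, U.1)) (hS : I.ideal U = Ideal.span S) :
    ∃ (a : Γ(X, U.1)) (ha : a ∈ S), GeneratesAt ⟨U, a, hS ▸ Ideal.subset_span ha⟩ f t := by
  obtain ⟨s, hs, e⟩ := hf.exists_stalk t
  let φ : Γ(X, U.1) →+* T.presheaf.stalk t :=
    (f.stalkMap t).hom.comp (X.presheaf.germ U.1 (f t) ht).hom
  have h1 : stalkIdeal (I.comap f) t = Ideal.span (φ '' S) := by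
    rw [stalkIdeal_comap, stalkIdeal_eq_map I U ht, hS, Ideal.map_map, Ideal.map_span]
  have h2 : ∀ a ∈ S, ∃ w, w * s = φ a := fun a ha => by
    rw [← Ideal.mem_span_singleton', ← e, h1]
    exact Ideal.subset_span ⟨a, ha, rfl⟩
  by_cases h3 : ∃ a ∈ S, ∃ w, IsUnit w ∧ w * s = φ a
  · obtain ⟨a, ha, w, hw, hws⟩ := h3
    refine ⟨a, ha, ht, ?_⟩
    rw [e]
    change _ = Ideal.span {φ a}
    rw [← hws]
    exact (Ideal.span_singleton_mul_left_unit hw _).symm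
  · push Not at h3
    exfalso
    have h4 : stalkIdeal (I.comap f) t ≤
        IsLocalRing.maximalIdeal (T.presheaf.stalk t) * Ideal.span {s} := by
      rw [h1, Ideal.span_le]
      rintro _ ⟨a, ha, rfl⟩
      obtain ⟨w, hw⟩ := h2 a ha
      rw [← hw]
      exact Ideal.mul_mem_mul (fun h5 => h3 a ha w h5 hw) (Ideal.mem_span_singleton_self s)
    obtain ⟨m, hm, hm'⟩ := Ideal.mem_mul_span_singleton.mp
      (h4 (e ▸ Ideal.mem_span_singleton_self s))
    have h6 : m = 1 :=
      mul_cancel_right_mem_nonZeroDivisors hs |>.mp (hm'.trans (one_mul s).symm)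
    exact (Ideal.ne_top_iff_one _).mp (IsLocalRing.maximalIdeal.isMaximal _).ne_top (h6 ▸ hm)

end BlowupChart

end Charts

end MonomialResolution

end

noncomputable section

namespace MonomialResolution

/-! ### Existence of blowups -/

section Blowup

variable {X : Scheme.{u}} (I : X.IdealSheafData)

open Scheme.IdealSheafData Limits

namespace BlowupChart

variable {I}

/-- The part of one chart which maps to another. -/
abbrev overlap (c c' : BlowupChart I) : c.V.Opens := c'.dom c.π c.isInvertible

lemma isInvertible_comp {T T' : Scheme.{u}} (j : T' ⟶ T) [IsOpenImmersion j] {f : T ⟶ X}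
    (hf : IsInvertible (I.comap f)) : IsInvertible (I.comap (j ≫ f)) := by
  rw [comap_comp]; exact hf.comap j

lemma exists_toChart (c c' : BlowupChart I) :
    ∃ g : (c.overlap c').toScheme ⟶ c'.V, g ≫ c'.π = (c.overlap c').ι ≫ c.π :=
  exists_lift _ (isInvertible_comp _ c.isInvertible) fun t => GeneratesAt.comp _ t.2

/-- The map from the overlap of two charts to the second one. -/
def toChart (c c' : BlowupChart I) : (c.overlap c').toScheme ⟶ c'.V := (exists_toChart c c').choose

lemma toChart_π (c c' : BlowupChart I) : c.toChart c' ≫ c'.π = (c.overlap c').ι ≫ c.π :=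
  (exists_toChart c c').choose_spec

lemma range_subset_overlap {c c' : BlowupChart I} {T : Scheme.{u}} (g : T ⟶ c.V)
    (hT : IsInvertible (I.comap (g ≫ c.π))) (l : T ⟶ c'.V) (hl : l ≫ c'.π = g ≫ c.π) :
    Set.range g ⊆ Set.range (c.overlap c').ι := by
  rintro _ ⟨t, rfl⟩
  rw [Scheme.Opens.range_ι]
  exact generatesAt_of_lift c.isInvertible g hT l hl t

/-- A map to a chart which lifts to another chart, as a map to the overlap. -/
def toOverlap {c c' : BlowupChart I} {T : Scheme.{u}} (g : T ⟶ c.V)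
    (hT : IsInvertible (I.comap (g ≫ c.π))) (l : T ⟶ c'.V) (hl : l ≫ c'.π = g ≫ c.π) :
    T ⟶ (c.overlap c').toScheme :=
  IsOpenImmersion.lift (c.overlap c').ι g (range_subset_overlap g hT l hl)

@[simp]
lemma toOverlap_ι {c c' : BlowupChart I} {T : Scheme.{u}} (g : T ⟶ c.V)
    (hT : IsInvertible (I.comap (g ≫ c.π))) (l : T ⟶ c'.V) (hl : l ≫ c'.π = g ≫ c.π) :
    toOverlap g hT l hl ≫ (c.overlap c').ι = g :=
  IsOpenImmersion.lift_fac _ _ _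

lemma toOverlap_ι_assoc {c c' : BlowupChart I} {T Z : Scheme.{u}} (g : T ⟶ c.V)
    (hT : IsInvertible (I.comap (g ≫ c.π))) (l : T ⟶ c'.V) (hl : l ≫ c'.π = g ≫ c.π)
    (f : c.V ⟶ Z) : toOverlap g hT l hl ≫ (c.overlap c').ι ≫ f = g ≫ f := by
  rw [← Category.assoc, toOverlap_ι]

lemma isInvertible_toChart {T : Scheme.{u}} (c c' : BlowupChart I)
    (j : T ⟶ (c.overlap c').toScheme) [IsOpenImmersion j] :
    IsInvertible (I.comap ((j ≫ c.toChart c') ≫ c'.π)) := by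
  rw [Category.assoc, toChart_π, ← Category.assoc]
  exact isInvertible_comp _ c.isInvertible

/-- The transition maps between charts. -/
def transition (c c' : BlowupChart I) : (c.overlap c').toScheme ⟶ (c'.overlap c).toScheme :=
  toOverlap (c.toChart c')
    (by rw [toChart_π]; exact isInvertible_comp _ c.isInvertible) (c.overlap c').ι
    (toChart_π c c').symm

lemma transition_ι (c c' : BlowupChart I) :
    c.transition c' ≫ (c'.overlap c).ι = c.toChart c' := toOverlap_ι _ _ _ _

lemma overlap_self (c : BlowupChart I) : c.overlap c = ⊤ :=
  top_le_iff.mp fun t _ => generatesAt_π t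

lemma transition_self (c : BlowupChart I) : c.transition c = 𝟙 _ := by
  rw [← cancel_mono (c.overlap c).ι, transition_ι, Category.id_comp]
  refine lift_ext (toChart_π c c) ?_
  rw [toChart_π]
  exact isInvertible_comp _ c.isInvertible

/-- The transition maps between triple overlaps of charts. -/
def transition' (c₁ c₂ c₃ : BlowupChart I) :
    pullback (c₁.overlap c₂).ι (c₁.overlap c₃).ι ⟶ pullback (c₂.overlap c₃).ι (c₂.overlap c₁).ι :=
  pullback.lift
    (toOverlap (pullback.fst (c₁.overlap c₂).ι (c₁.overlap c₃).ι ≫ c₁.toChart c₂)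
      (isInvertible_toChart _ _ _) (pullback.snd _ _ ≫ c₁.toChart c₃) (by
        rw [Category.assoc, Category.assoc, toChart_π, toChart_π, pullback.condition_assoc]))
    (pullback.fst _ _ ≫ c₁.transition c₂) (by
      rw [toOverlap_ι, Category.assoc, transition_ι])

lemma transition'_snd (c₁ c₂ c₃ : BlowupChart I) :
    transition' c₁ c₂ c₃ ≫ pullback.snd _ _ = pullback.fst _ _ ≫ c₁.transition c₂ :=
  pullback.lift_snd _ _ _

lemma transition'_π (c₁ c₂ c₃ : BlowupChart I) :
    transition' c₁ c₂ c₃ ≫ pullback.fst _ _ ≫ (c₂.overlap c₃).ι ≫ c₂.π =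
      pullback.fst _ _ ≫ (c₁.overlap c₂).ι ≫ c₁.π := by
  rw [transition', pullback.lift_fst_assoc, toOverlap_ι_assoc, Category.assoc, toChart_π]

lemma transition'_cocycle (c₁ c₂ c₃ : BlowupChart I) :
    transition' c₁ c₂ c₃ ≫ transition' c₂ c₃ c₁ ≫ transition' c₃ c₁ c₂ = 𝟙 _ := by
  have : Mono (pullback.fst (c₁.overlap c₂).ι (c₁.overlap c₃).ι ≫ (c₁.overlap c₂).ι) :=
    inferInstance
  rw [← cancel_mono (pullback.fst (c₁.overlap c₂).ι (c₁.overlap c₃).ι ≫ (c₁.overlap c₂).ι),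
    Category.id_comp]
  have h : ((transition' c₁ c₂ c₃ ≫ transition' c₂ c₃ c₁ ≫ transition' c₃ c₁ c₂) ≫
      pullback.fst _ _ ≫ (c₁.overlap c₂).ι) ≫ c₁.π =
      (pullback.fst (c₁.overlap c₂).ι (c₁.overlap c₃).ι ≫ (c₁.overlap c₂).ι) ≫ c₁.π := by
    simp only [Category.assoc, transition'_π]
  refine lift_ext h ?_
  rw [h]
  exact isInvertible_comp _ c₁.isInvertible

instance (c : BlowupChart I) : IsIso (c.overlap c).ι := by
  have : Function.Surjective (c.overlap c).ι := by
    rw [← Set.range_eq_univ, Scheme.Opens.range_ι, overlap_self]; rfl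
  exact (isIso_iff_isOpenImmersion_and_surjective _).mpr ⟨inferInstance, ⟨this⟩⟩

end BlowupChart

open BlowupChart

/-- The gluing data of the charts of a blowup. -/
def blowupGlueData : Scheme.GlueData.{u} where
  J := BlowupChart I
  U c := c.V
  V c := (c.1.overlap c.2).toScheme
  f c c' := (c.overlap c').ι
  t := transition
  t_id := transition_self
  t' := transition'
  t_fac := transition'_snd
  cocycle := transition'_cocycle
  f_open _ _ := inferInstance

/-- The blowup of a scheme along an ideal sheaf. -/
def blowup : Scheme.{u} := (blowupGlueData I).glued

/-- The inclusion of a chart into the blowup. -/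
def chartι (c : BlowupChart I) : c.V ⟶ blowup I := (blowupGlueData I).ι c

instance (c : BlowupChart I) : IsOpenImmersion (chartι I c) :=
  Scheme.GlueData.ι_isOpenImmersion (blowupGlueData I) c

lemma toChart_chartι (c c' : BlowupChart I) :
    c.toChart c' ≫ chartι I c' = (c.overlap c').ι ≫ chartι I c := by
  have := (blowupGlueData I).glue_condition c c'
  rw [← transition_ι, Category.assoc]
  exact this

lemma exists_chartι_eq (q : blowup I) : ∃ (c : BlowupChart I) (v : c.V), chartι I c v = q :=
  (blowupGlueData I).ι_jointly_surjective q

lemma transition_ι_π (c c' : BlowupChart I) :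
    (c.overlap c').ι ≫ c.π = (c.transition c' ≫ (c'.overlap c).ι) ≫ c'.π := by
  rw [transition_ι, toChart_π]

/-- The projection of the blowup. -/
def blowupπ : blowup I ⟶ X :=
  Multicoequalizer.desc _ _ (fun c : BlowupChart I => c.π) (by
    rintro ⟨c, c'⟩
    exact transition_ι_π I c c')

lemma chartι_π (c : BlowupChart I) : chartι I c ≫ blowupπ I = c.π :=
  Multicoequalizer.π_desc _ _ _ _ _

lemma isInvertible_of_openCover {Y : Scheme.{u}} (J : Y.IdealSheafData)
    (h : ∀ y : Y, ∃ (V : Scheme.{u}) (j : V ⟶ Y) (_ : IsOpenImmersion j),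
      y ∈ Set.range j ∧ IsInvertible (J.comap j)) : IsInvertible J := by
  rw [isInvertible_iff]
  intro y
  obtain ⟨V, j, hj, ⟨v, rfl⟩, hV⟩ := h y
  obtain ⟨U, hv, f, hf⟩ := isInvertible_iff.mp hV v
  refine ⟨j ''ᵁ U, ⟨v, hv, rfl⟩, (j.appIso U).inv f, ?_⟩
  rintro _ ⟨w, hw, rfl⟩
  obtain ⟨h1, h2⟩ := hf w hw
  have h3 : (j.stalkMap w).hom (Y.presheaf.germ (j ''ᵁ U) (j w) ⟨w, hw, rfl⟩ ((j.appIso U).inv f)) =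
      V.presheaf.germ U w hw f := by
    have e : U ≤ j ⁻¹ᵁ j ''ᵁ U := (j.preimage_image_eq U).ge
    refine (germ_appLE j e w hw _).symm.trans ?_
    exact (congrArg (V.presheaf.germ U w hw)
      (ConcreteCategory.congr_hom (Scheme.Hom.appIso_inv_appLE j e) f)).trans
      (V.presheaf.germ_res_apply (homOfLE le_rfl) w hw f)
  rw [stalkIdeal_comap, ← h3, ← Set.image_singleton, ← Ideal.map_span] at h1
  have hb := bijective_stalkMap j w
  let e := RingEquiv.ofBijective (j.stalkMap w).hom hb
  constructor
  · have h4 := congrArg (Ideal.comap (j.stalkMap w).hom) h1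
    rwa [Ideal.comap_map_of_bijective _ hb, Ideal.comap_map_of_bijective _ hb] at h4
  · rw [← h3] at h2
    have := mem_nonZeroDivisors_of_bijective e.symm.toRingHom e.symm.bijective h2
    rwa [show e.symm.toRingHom ((j.stalkMap w).hom _) = _ from e.symm_apply_apply _] at this

lemma isInvertible_blowup : IsInvertible (I.comap (blowupπ I)) := by
  refine isInvertible_of_openCover _ fun y => ?_
  obtain ⟨c, v, rfl⟩ := exists_chartι_eq I y
  refine ⟨c.V, chartι I c, inferInstance, ⟨v, rfl⟩, ?_⟩
  rw [← comap_comp, chartι_π]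
  exact c.isInvertible

lemma exists_lift_chart {T : Scheme.{u}} (g : T ⟶ blowup I) (t : T) :
    ∃ (N : T.Opens) (c : BlowupChart I) (l : N.toScheme ⟶ c.V), t ∈ N ∧
      l ≫ chartι I c = N.ι ≫ g := by
  obtain ⟨c, v, hv⟩ := exists_chartι_eq I (g t)
  refine ⟨g ⁻¹ᵁ (chartι I c).opensRange, c, IsOpenImmersion.lift (chartι I c) (_ ≫ g) ?_, ⟨v, hv⟩,
    IsOpenImmersion.lift_fac _ _ _⟩
  rintro _ ⟨s, rfl⟩
  exact s.2

lemma blowup_lift_ext {T : Scheme.{u}} (g₁ g₂ : T ⟶ blowup I) (h : g₁ ≫ blowupπ I = g₂ ≫ blowupπ I)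
    (hT : IsInvertible (I.comap (g₁ ≫ blowupπ I))) : g₁ = g₂ := by
  choose N₁ c₁ l₁ hN₁ hl₁ using exists_lift_chart I g₁
  choose N₂ c₂ l₂ hN₂ hl₂ using exists_lift_chart I g₂
  let N : T → T.Opens := fun t => N₁ t ⊓ N₂ t
  let 𝒰 := T.openCoverOfIsOpenCover N (.mk (by ext t; simpa using ⟨t, hN₁ t, hN₂ t⟩))
  suffices key : ∀ t : T, (N t).ι ≫ g₁ = (N t).ι ≫ g₂ from 𝒰.hom_ext _ _ key
  intro t
  let m₁ : (N t).toScheme ⟶ (c₁ t).V := T.homOfLE (inf_le_left : N t ≤ N₁ t) ≫ l₁ t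
  let m₂ : (N t).toScheme ⟶ (c₂ t).V := T.homOfLE (inf_le_right : N t ≤ N₂ t) ≫ l₂ t
  have e₁ : m₁ ≫ chartι I (c₁ t) = (N t).ι ≫ g₁ := by
    simp only [m₁, Category.assoc, hl₁, Scheme.homOfLE_ι_assoc]
  have e₂ : m₂ ≫ chartι I (c₂ t) = (N t).ι ≫ g₂ := by
    simp only [m₂, Category.assoc, hl₂, Scheme.homOfLE_ι_assoc]
  have hm : m₂ ≫ (c₂ t).π = m₁ ≫ (c₁ t).π := by
    rw [← chartι_π, ← chartι_π, reassoc_of% e₁, reassoc_of% e₂, h]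
  have hinv : IsInvertible (I.comap (m₁ ≫ (c₁ t).π)) := by
    rw [← chartι_π, reassoc_of% e₁]
    exact isInvertible_comp _ hT
  have h5 := toOverlap_ι m₁ hinv m₂ hm
  have h6 : toOverlap m₁ hinv m₂ hm ≫ (c₁ t).toChart (c₂ t) = m₂ := by
    have h7 : (toOverlap m₁ hinv m₂ hm ≫ (c₁ t).toChart (c₂ t)) ≫ (c₂ t).π = m₂ ≫ (c₂ t).π := by
      rw [Category.assoc, toChart_π, toOverlap_ι_assoc, hm]
    refine lift_ext h7 ?_
    rw [h7, hm]; exact hinv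
  rw [← e₁, ← e₂]
  conv_rhs => rw [← h6, Category.assoc, toChart_chartι, toOverlap_ι_assoc]

/-- Blowups exist. -/
theorem isBlowup_blowup : IsBlowup (blowupπ I) I where
  invertible := isInvertible_blowup I
  existsUnique_lift {T} f hf := by
    obtain ⟨g, hg⟩ : ∃ g, g ≫ blowupπ I = f := by
      refine exists_lift_of_local (blowupπ I) (blowup_lift_ext I) f hf fun t => ?_
      obtain ⟨U, hU⟩ := exists_affineOpens_mem (f t)
      obtain ⟨a, ha, h⟩ := exists_generatesAt hf t U hU (I.ideal U) (Ideal.span_eq _).symm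
      let c : BlowupChart I := ⟨U, a, ha⟩
      refine ⟨c.dom f hf, h, ?_⟩
      obtain ⟨l, hl⟩ := exists_lift (c := c) ((c.dom f hf).ι ≫ f) (isInvertible_comp _ hf)
        fun t => GeneratesAt.comp _ t.2
      exact ⟨l ≫ chartι I c, by rw [Category.assoc, chartι_π, hl]⟩
    exact ⟨g, hg, fun g' hg' => blowup_lift_ext I _ _ (hg'.trans hg.symm) (hg'.symm ▸ hf)⟩

end Blowup

end MonomialResolution

end

noncomputable section

namespace MonomialResolution

/-! ### Properties of blowups -/

namespace IsBlowup

variable {X X' : Scheme.{u}} {π : X' ⟶ X} {I : X.IdealSheafData} (h : IsBlowup π I)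

open Scheme.IdealSheafData Limits BlowupChart

include h in
lemma lift_ext {T : Scheme.{u}} {g₁ g₂ : T ⟶ X'} (hg : g₁ ≫ π = g₂ ≫ π)
    (hT : IsInvertible (I.comap (g₁ ≫ π))) : g₁ = g₂ :=
  (h.existsUnique_lift _ hT).unique rfl hg.symm

/-- A chart as an open subscheme of any blowup. -/
def chart (c : BlowupChart I) : c.V ⟶ X' := (h.existsUnique_lift c.π c.isInvertible).choose

@[simp]
lemma chart_π (c : BlowupChart I) : h.chart c ≫ π = c.π :=
  (h.existsUnique_lift c.π c.isInvertible).choose_spec.1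

include h in
lemma exists_iso : ∃ e : blowup I ≅ X', e.hom ≫ π = blowupπ I := by
  have h' := isBlowup_blowup I
  obtain ⟨f, hf, -⟩ := h.existsUnique_lift (blowupπ I) (isInvertible_blowup I)
  obtain ⟨g, hg, -⟩ := h'.existsUnique_lift π h.invertible
  refine ⟨⟨f, g, ?_, ?_⟩, hf⟩
  · have e : (f ≫ g) ≫ blowupπ I = 𝟙 _ ≫ blowupπ I := by rw [Category.assoc, hg, hf, Category.id_comp]
    refine h'.lift_ext e ?_
    rw [e, Category.id_comp]; exact isInvertible_blowup I
  · have e : (g ≫ f) ≫ π = 𝟙 _ ≫ π := by rw [Category.assoc, hf, hg, Category.id_comp]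
    refine h.lift_ext e ?_
    rw [e, Category.id_comp]; exact h.invertible

instance (c : BlowupChart I) : IsOpenImmersion (h.chart c) := by
  obtain ⟨e, he⟩ := h.exists_iso
  have h1 : (chartι I c ≫ e.hom) ≫ π = h.chart c ≫ π := by
    rw [Category.assoc, he, chartι_π, chart_π]
  have h2 : chartι I c ≫ e.hom = h.chart c := by
    refine h.lift_ext h1 ?_
    rw [h1, chart_π]; exact c.isInvertible
  rw [← h2]; infer_instance

lemma mem_range_chart_iff (c : BlowupChart I) (q : X') :
    q ∈ Set.range (h.chart c) ↔ c.GeneratesAt π q := by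
  constructor
  · rintro ⟨v, rfl⟩
    refine generatesAt_of_lift h.invertible (h.chart c) ?_ (𝟙 _) (by simp) v
    rw [chart_π]; exact c.isInvertible
  · intro hq
    obtain ⟨l, hl⟩ := BlowupChart.exists_lift (c := c) ((c.dom π h.invertible).ι ≫ π)
      (isInvertible_comp _ h.invertible) fun t => GeneratesAt.comp _ t.2
    have h1 : (l ≫ h.chart c) ≫ π = (c.dom π h.invertible).ι ≫ π := by
      rw [Category.assoc, chart_π, hl]
    have h2 : l ≫ h.chart c = (c.dom π h.invertible).ι := by
      refine h.lift_ext h1 ?_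
      rw [h1]; exact isInvertible_comp _ h.invertible
    let t : (c.dom π h.invertible).toScheme := ⟨q, hq⟩
    refine ⟨l t, ?_⟩
    rw [← Scheme.Hom.comp_apply, h2]
    rfl

lemma exists_mem_range_chart (q : X') (U : X.affineOpens) (hq : π q ∈ U.1) (S : Set Γ(X, U.1))
    (hS : I.ideal U = Ideal.span S) : ∃ (a : Γ(X, U.1)) (ha : a ∈ S),
      q ∈ Set.range (h.chart ⟨U, a, hS ▸ Ideal.subset_span ha⟩) := by
  obtain ⟨a, ha, h1⟩ := exists_generatesAt h.invertible q U hq S hS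
  exact ⟨a, ha, (h.mem_range_chart_iff _ q).mpr h1⟩

/-! #### Away from the center -/

lemma exists_affineOpens_ideal_eq_top {p : X} (hp : p ∉ I.support) :
    ∃ U : X.affineOpens, p ∈ U.1 ∧ I.ideal U = ⊤ := by
  obtain ⟨U, hU, hpU, hUI⟩ := exists_isAffineOpen_mem_and_subset (X := X)
    (U := ⟨(I.support : Set X)ᶜ, I.support.isClosed.isOpen_compl⟩) hp
  refine ⟨⟨U, hU⟩, hpU, ?_⟩
  rw [hU.ideal_ext_iff]
  intro x hx
  rw [← stalkIdeal_eq_map I ⟨U, hU⟩, Ideal.map_top, stalkIdeal_eq_top_iff]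
  exact hUI hx

lemma bijective_algebraMap_of_isUnit {A : Type*} [CommRing A] (I : Ideal A) :
    Function.Bijective (algebraMap A (blowupAlgebra I 1)) := by
  obtain ⟨ψ, hψ⟩ := blowupAlgebra.exists_lift (I := I) (a := 1) (RingHom.id A)
    (by rw [map_one]; exact one_mem _) (by simp)
  have h1 : ((algebraMap A (blowupAlgebra I 1)).comp ψ) = RingHom.id _ :=
    blowupAlgebra.hom_ext (by rw [RingHom.comp_assoc, hψ]; rfl) (by simp [one_mem])
  exact ⟨Function.LeftInverse.injective fun a => RingHom.congr_fun hψ a,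
    Function.RightInverse.surjective fun a => RingHom.congr_fun h1 a⟩

/-- The chart over an affine open subset which does not meet the center. -/
def trivialChart (U : X.affineOpens) (hU : I.ideal U = ⊤) : BlowupChart I := ⟨U, 1, hU ▸ trivial⟩

instance (U : X.affineOpens) (hU : I.ideal U = ⊤) : IsOpenImmersion (trivialChart U hU).π := by
  have : IsIso (trivialChart U hU).ringMap := by
    rw [ConcreteCategory.isIso_iff_bijective]
    exact bijective_algebraMap_of_isUnit (I.ideal U)
  rw [π_def]; infer_instance

lemma generatesAt_trivialChart (U : X.affineOpens) (hU : I.ideal U = ⊤) {q : X'}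
    (hq : π q ∈ U.1) : (trivialChart U hU).GeneratesAt π q := by
  refine ⟨hq, ?_⟩
  change _ = Ideal.span {π.stalkMap q (X.presheaf.germ U.1 (π q) hq 1)}
  rw [map_one, map_one, Ideal.span_singleton_one, stalkIdeal_comap, stalkIdeal_eq_map I U hq, hU,
    Ideal.map_top, Ideal.map_top]

include h in
lemma eq_of_π_eq {q₁ q₂ : X'} (h₁ : π q₁ ∉ I.support) (h₂ : π q₁ = π q₂) : q₁ = q₂ := by
  obtain ⟨U, hq, hU⟩ := exists_affineOpens_ideal_eq_top h₁
  obtain ⟨v₁, rfl⟩ := (h.mem_range_chart_iff _ _).mpr (generatesAt_trivialChart U hU hq)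
  obtain ⟨v₂, rfl⟩ := (h.mem_range_chart_iff _ _).mpr (generatesAt_trivialChart U hU (h₂ ▸ hq))
  rw [← Scheme.Hom.comp_apply, ← Scheme.Hom.comp_apply, chart_π] at h₂
  rw [(trivialChart U hU).π.isOpenEmbedding.injective h₂]

include h in
lemma bijective_stalkMap {q : X'} (hq : π q ∉ I.support) :
    Function.Bijective (π.stalkMap q).hom := by
  obtain ⟨U, hqU, hU⟩ := exists_affineOpens_ideal_eq_top hq
  obtain ⟨v, rfl⟩ := (h.mem_range_chart_iff _ _).mpr (generatesAt_trivialChart U hU hqU)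
  have h1 : Function.Bijective ((h.chart (trivialChart U hU) ≫ π).stalkMap v).hom := by
    rw [chart_π]; exact MonomialResolution.bijective_stalkMap _ v
  rw [Scheme.Hom.stalkMap_comp] at h1
  have h2 : Function.Bijective (((h.chart (trivialChart U hU)).stalkMap v).hom ∘
    (π.stalkMap (h.chart (trivialChart U hU) v)).hom) := h1
  exact (Function.Bijective.of_comp_iff'
    (MonomialResolution.bijective_stalkMap (h.chart (trivialChart U hU)) v) _).mp h2

include h in
lemma exists_π_eq {p : X} (hp : p ∉ I.support) : ∃ q : X', π q = p := by
  obtain ⟨U, hpU, hU⟩ := exists_affineOpens_ideal_eq_top hp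
  let c := trivialChart U hU
  have h1 : p ∈ Set.range c.isAffineOpen.fromSpec := by rwa [c.isAffineOpen.range_fromSpec]
  obtain ⟨w, hw⟩ := h1
  have : IsIso c.ringMap := by
    rw [ConcreteCategory.isIso_iff_bijective]
    exact bijective_algebraMap_of_isUnit (I.ideal U)
  obtain ⟨v, hv⟩ := (Spec.map c.ringMap).surjective w
  refine ⟨h.chart c v, ?_⟩
  rw [← Scheme.Hom.comp_apply, chart_π, π_def, Scheme.Hom.comp_apply, hv, hw]

include h in
/-- Away from the center, generizations lift. -/
lemma exists_specializes_π_eq {q : X'} (hq : π q ∉ I.support) {z : X} (hz : z ⤳ π q) :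
    ∃ w, w ⤳ q ∧ π w = z := by
  have hb := h.bijective_stalkMap hq
  let e := RingEquiv.ofBijective (π.stalkMap q).hom hb
  obtain ⟨w, hw, e1⟩ := exists_primeOf_eq q ((primeOf hz).comap e.symm.toRingHom)
  refine ⟨w, hw, primeOf_injective (hw.map π.continuous) hz ?_⟩
  rw [primeOf_map π hw, e1, Ideal.comap_comap]
  convert Ideal.comap_id _
  ext x
  exact e.symm_apply_apply x

/-! #### Integrality -/

lemma nontrivial_ring (c : BlowupChart I) [Nonempty c.V] : Nontrivial c.ring :=
  PrimeSpectrum.nonempty_iff_nontrivial.mp ‹Nonempty c.V›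

lemma a_ne_zero (c : BlowupChart I) [Nonempty c.V] : c.a ≠ 0 := by
  intro ha
  have h1 := blowupAlgebra.algebraMap_mem_nonZeroDivisors (I.ideal c.U) c.a
  have h2 : algebraMap Γ(X, c.U.1) (blowupAlgebra (I.ideal c.U) c.a) c.a = 0 :=
    (congrArg (algebraMap _ (blowupAlgebra (I.ideal c.U) c.a)) ha).trans (map_zero _)
  have := nontrivial_ring c
  exact nonZeroDivisors.ne_zero h1 h2

lemma isDomain_section (c : BlowupChart I) [IsIntegral X] [Nonempty c.V] :
    IsDomain Γ(X, c.U.1) := by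
  have : Nonempty c.U.1 :=
    ⟨⟨c.π (Classical.arbitrary c.V), c.le_preimage (x := Classical.arbitrary c.V) trivial⟩⟩
  infer_instance

lemma isDomain_ring (c : BlowupChart I) [IsIntegral X] [Nonempty c.V] : IsDomain c.ring := by
  have := isDomain_section c
  exact blowupAlgebra.isDomain (a_ne_zero c)

lemma isIntegral_V [IsIntegral X] (c : BlowupChart I) [Nonempty c.V] : IsIntegral c.V := by
  have := isDomain_ring c
  infer_instance

lemma notMem_support_of_isField {T : Scheme.{u}} {J : T.IdealSheafData} (hJ : IsInvertible J) {t : T}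
    (ht : IsField (T.presheaf.stalk t)) : t ∉ J.support := by
  obtain ⟨g, hg, e⟩ := hJ.exists_stalk t
  rw [← stalkIdeal_eq_top_iff, e, Ideal.span_singleton_eq_top]
  obtain ⟨b, hb⟩ := ht.mul_inv_cancel (nonZeroDivisors.ne_zero hg)
  exact IsUnit.of_mul_eq_one _ hb

lemma π_genericPoint [IsIntegral X] (c : BlowupChart I) [Nonempty c.V] [IsIntegral c.V] :
    c.π (genericPoint c.V) = genericPoint X := by
  have h1 := isDomain_section c
  have h2 := isDomain_ring c
  have h3 : Function.Injective c.ringMap.hom := by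
    have ha := a_ne_zero c
    intro x y hxy
    exact IsLocalization.injective (Localization.Away c.a)
      (powers_le_nonZeroDivisors_of_noZeroDivisors ha) (congrArg Subtype.val hxy)
  rw [π_def, Scheme.Hom.comp_apply]
  have h4 : Spec.map c.ringMap (genericPoint c.V) = genericPoint (Spec Γ(X, c.U.1)) := by
    rw [genericPoint_eq_bot_of_affine, genericPoint_eq_bot_of_affine]
    apply PrimeSpectrum.ext
    exact (RingHom.injective_iff_ker_eq_bot c.ringMap.hom).mp h3
  rw [h4]
  exact genericPoint_eq_of_isOpenImmersion _

lemma genericPoint_notMem [IsIntegral X] (c : BlowupChart I) [Nonempty c.V] [IsIntegral c.V] :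
    genericPoint X ∉ I.support := by
  have h1 : IsField (c.V.presheaf.stalk (genericPoint c.V)) :=
    @Field.toIsField c.V.functionField _
  have h2 := notMem_support_of_isField c.isInvertible h1
  rw [support_comap] at h2
  rw [← π_genericPoint c]
  exact h2

include h in
lemma isIntegral [IsIntegral X] (hI : I.support ≠ ⊤) : IsIntegral X' := by
  have hgen : ∀ q : X', ∃ c : BlowupChart I, q ∈ Set.range (h.chart c) := by
    intro q
    obtain ⟨U, hU⟩ := exists_affineOpens_mem (π q)
    obtain ⟨a, ha, hq⟩ := h.exists_mem_range_chart q U hU (I.ideal U) (Ideal.span_eq _).symm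
    exact ⟨_, hq⟩
  obtain ⟨p, hp⟩ : ∃ p, p ∉ I.support := by
    by_contra! hall
    exact hI (top_le_iff.mp fun x _ => hall x)
  obtain ⟨q₀, -⟩ := h.exists_π_eq hp
  have key : ∀ q : X', ∃ w, w ⤳ q ∧ π w = genericPoint X := by
    intro q
    obtain ⟨c, v, rfl⟩ := hgen q
    have : Nonempty c.V := ⟨v⟩
    have := isIntegral_V c
    refine ⟨h.chart c (genericPoint c.V), (genericPoint_specializes v).map (h.chart c).continuous, ?_⟩
    rw [← Scheme.Hom.comp_apply, chart_π, π_genericPoint]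
  have hη : genericPoint X ∉ I.support := by
    obtain ⟨c, v, -⟩ := hgen q₀
    have : Nonempty c.V := ⟨v⟩
    have := isIntegral_V c
    exact genericPoint_notMem c
  have : IsReduced X' := by
    have : ∀ q : X', _root_.IsReduced (X'.presheaf.stalk q) := by
      intro q
      obtain ⟨c, v, rfl⟩ := hgen q
      have : Nonempty c.V := ⟨v⟩
      have := isIntegral_V c
      exact isReduced_of_injective ((h.chart c).stalkMap v).hom
        (MonomialResolution.bijective_stalkMap (h.chart c) v).1
    exact isReduced_of_isReduced_stalk X'
  have : IrreducibleSpace X' := by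
    obtain ⟨η, -, hη'⟩ := key q₀
    have hcl : closure {η} = (Set.univ : Set X') := by
      refine Set.eq_univ_of_forall fun q => ?_
      obtain ⟨w, hw, hw'⟩ := key q
      have : w = η := h.eq_of_π_eq (by rw [hw']; exact hη) (hw'.trans hη'.symm)
      exact specializes_iff_mem_closure.mp (this ▸ hw)
    have : PreirreducibleSpace X' := ⟨hcl ▸ (isIrreducible_singleton (x := η)).closure.2⟩
    exact ⟨⟨q₀⟩⟩
  exact isIntegral_of_irreducibleSpace_of_isReduced X'

include h in
lemma compactSpace [CompactSpace X] [IsLocallyNoetherian X] : CompactSpace X' := by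
  have h1 : ∀ p : X, ∃ U : X.affineOpens, p ∈ U.1 := exists_affineOpens_mem
  choose U hU using h1
  obtain ⟨t, ht⟩ := isCompact_univ.elim_finite_subcover (fun p : X => ((U p).1 : Set X))
    (fun p => (U p).1.2) (fun p _ => Set.mem_iUnion.mpr ⟨p, hU p⟩)
  have h2 : ∀ p : X, ∃ S : Finset Γ(X, (U p).1), Ideal.span (S : Set _) = I.ideal (U p) :=
    fun p => ideal_fg (U p) _
  choose S hS using h2
  let Z : Set X' := ⋃ p ∈ t, ⋃ a : S p, Set.range (h.chart ⟨U p, a.1, hS p ▸ Ideal.subset_span a.2⟩)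
  have hZ : IsCompact Z := by
    refine t.isCompact_biUnion fun p _ => isCompact_iUnion fun a => ?_
    exact isCompact_range (h.chart _).continuous
  refine ⟨?_⟩
  convert hZ
  symm
  refine Set.eq_univ_of_forall fun q => ?_
  obtain ⟨p, hp, hpU⟩ := Set.mem_iUnion₂.mp (ht (Set.mem_univ (π q)))
  obtain ⟨a, ha, hq⟩ := h.exists_mem_range_chart q (U p) hpU (S p) (hS p).symm
  exact Set.mem_iUnion₂.mpr ⟨p, hp, Set.mem_iUnion.mpr ⟨⟨a, ha⟩, hq⟩⟩

end IsBlowup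

end MonomialResolution

end

noncomputable section

namespace MonomialResolution

/-! ### Blowups are separated -/

section Separated

variable {X X' : Scheme.{u}} {π : X' ⟶ X} {I : X.IdealSheafData}

open Scheme.IdealSheafData Limits BlowupChart

/-- The global section `f / a` of a chart. -/
def BlowupChart.quotient (c : BlowupChart I) (f : Γ(X, c.U.1)) (hf : f ∈ I.ideal c.U) :
    Γ(c.V, ⊤) :=
  (Scheme.ΓSpecIso c.ring).inv (blowupAlgebra.exists_mul_eq (I.ideal c.U) c.a hf).choose

lemma BlowupChart.mul_quotient (c : BlowupChart I) (f : Γ(X, c.U.1)) (hf : f ∈ I.ideal c.U) :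
    c.π.appLE c.U.1 ⊤ c.le_preimage c.a * c.quotient f hf =
      c.π.appLE c.U.1 ⊤ c.le_preimage f := by
  rw [appLE_π]
  have := congrArg (Scheme.ΓSpecIso c.ring).inv
    (blowupAlgebra.exists_mul_eq (I.ideal c.U) c.a hf).choose_spec
  rw [map_mul] at this
  exact this

lemma appTop_eq_appLE {S T : Scheme.{u}} (g : S ⟶ T) : g.appTop = g.appLE ⊤ ⊤ le_top := by
  simp [Scheme.Hom.appLE]
  exact (Category.comp_id (g.app ⊤)).symm

lemma appTop_appLE {S T : Scheme.{u}} (g : S ⟶ T) (f : T ⟶ X) (U : X.Opens) (e₁ : ⊤ ≤ f ⁻¹ᵁ U)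
    (e : ⊤ ≤ (g ≫ f) ⁻¹ᵁ U) (a : Γ(X, U)) :
    g.appTop (f.appLE U ⊤ e₁ a) = (g ≫ f).appLE U ⊤ e a := by
  have h1 := Scheme.Hom.appLE_comp_appLE g f U ⊤ ⊤ e₁ le_top
  exact (ConcreteCategory.congr_hom (appTop_eq_appLE g) _).trans (ConcreteCategory.congr_hom h1 a)

lemma BlowupChart.comp_mul_quotient (c : BlowupChart I) {T : Scheme.{u}} (g : T ⟶ c.V)
    (f : Γ(X, c.U.1)) (hf : f ∈ I.ideal c.U) (e : ⊤ ≤ (g ≫ c.π) ⁻¹ᵁ c.U.1) :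
    (g ≫ c.π).appLE c.U.1 ⊤ e c.a * g.appTop (c.quotient f hf) =
      (g ≫ c.π).appLE c.U.1 ⊤ e f := by
  rw [← appTop_appLE g c.π c.U.1 c.le_preimage, ← appTop_appLE g c.π c.U.1 c.le_preimage,
    ← map_mul, c.mul_quotient]

lemma quotient_mul_quotient {T : Scheme.{u}} (U : X.affineOpens) (a b : Γ(X, U.1))
    (ha : a ∈ I.ideal U) (hb : b ∈ I.ideal U) (g : T ⟶ (⟨U, a, ha⟩ : BlowupChart I).V)
    (g' : T ⟶ (⟨U, b, hb⟩ : BlowupChart I).V)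
    (hg : g' ≫ (⟨U, b, hb⟩ : BlowupChart I).π = g ≫ (⟨U, a, ha⟩ : BlowupChart I).π)
    (hT : IsInvertible (I.comap (g ≫ (⟨U, a, ha⟩ : BlowupChart I).π))) :
    g.appTop ((⟨U, a, ha⟩ : BlowupChart I).quotient b hb) *
      g'.appTop ((⟨U, b, hb⟩ : BlowupChart I).quotient a ha) = 1 := by
  have e : ⊤ ≤ (g ≫ (⟨U, a, ha⟩ : BlowupChart I).π) ⁻¹ᵁ U.1 :=
    fun t _ => (⟨U, a, ha⟩ : BlowupChart I).le_preimage (x := g t) trivial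
  have e' : ⊤ ≤ (g' ≫ (⟨U, b, hb⟩ : BlowupChart I).π) ⁻¹ᵁ U.1 :=
    fun t _ => (⟨U, b, hb⟩ : BlowupChart I).le_preimage (x := g' t) trivial
  have h1 := (⟨U, a, ha⟩ : BlowupChart I).comp_mul_quotient g b hb e
  have h2 := (⟨U, b, hb⟩ : BlowupChart I).comp_mul_quotient g' a ha e'
  have h3 : (g' ≫ (⟨U, b, hb⟩ : BlowupChart I).π).appLE U.1 ⊤ e' =
      (g ≫ (⟨U, a, ha⟩ : BlowupChart I).π).appLE U.1 ⊤ e := by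
    simp only [hg]
  have h4 : (g ≫ (⟨U, a, ha⟩ : BlowupChart I).π).appLE U.1 ⊤ e a ∈ nonZeroDivisors Γ(T, ⊤) := by
    have h5 : IsInvertible ((I.comap (⟨U, a, ha⟩ : BlowupChart I).π).comap g) := by
      rwa [← comap_comp]
    have := ((⟨U, a, ha⟩ : BlowupChart I).isGenerator.comap g h5 (U := ⊤)
      le_top).mem_nonZeroDivisors
    rw [← appTop_eq_appLE] at this
    have h6 := appTop_appLE g (⟨U, a, ha⟩ : BlowupChart I).π U.1
      (⟨U, a, ha⟩ : BlowupChart I).le_preimage e a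
    exact h6 ▸ this
  have h6 : (g ≫ (⟨U, a, ha⟩ : BlowupChart I).π).appLE U.1 ⊤ e b *
      g'.appTop ((⟨U, b, hb⟩ : BlowupChart I).quotient a ha) =
      (g ≫ (⟨U, a, ha⟩ : BlowupChart I).π).appLE U.1 ⊤ e a := by rw [← h3]; exact h2
  rw [← h1, mul_assoc] at h6
  exact mul_cancel_left_mem_nonZeroDivisors h4 |>.mp (h6.trans (mul_one _).symm)

/-- A morphism from the spectrum of a local ring lands in every open subset which contains the image
of the closed point. -/
lemma range_subset_of_closedPoint {R : CommRingCat.{u}} [IsLocalRing R] {Y Z : Scheme.{u}}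
    (l : Spec R ⟶ Y) (j : Z ⟶ Y) [IsOpenImmersion j]
    (h : l (IsLocalRing.closedPoint R) ∈ Set.range j) : Set.range l ⊆ Set.range j := by
  rintro _ ⟨t, rfl⟩
  exact ((IsLocalRing.specializes_closedPoint t).map l.continuous).mem_open
    j.isOpenEmbedding.isOpen_range h

theorem IsBlowup.isSeparated (h : IsBlowup π I) [QuasiSeparated π] : IsSeparated π := by
  refine IsSeparated.of_valuativeCriterion π ?_
  rintro ⟨R, K, i₁, i₂, sq⟩
  constructor
  rintro ⟨l₁, hl₁, hl₁'⟩ ⟨l₂, hl₂, hl₂'⟩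
  congr 1
  dsimp only at l₁ l₂ hl₁ hl₂ hl₁' hl₂'
  have hloc : IsLocalRing R := inferInstance
  let s : Spec (CommRingCat.of R) := IsLocalRing.closedPoint R
  let φ : Spec (CommRingCat.of K) ⟶ Spec (CommRingCat.of R) :=
    Spec.map (CommRingCat.ofHom (algebraMap R K))
  have hs : π (l₁ s) = π (l₂ s) := by
    rw [← Scheme.Hom.comp_apply, ← Scheme.Hom.comp_apply, hl₁', hl₂']
  obtain ⟨U, hU⟩ := exists_affineOpens_mem (π (l₁ s))
  obtain ⟨a, ha, h₁⟩ := h.exists_mem_range_chart (l₁ s) U hU (I.ideal U) (Ideal.span_eq _).symm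
  obtain ⟨b, hb, h₂⟩ := h.exists_mem_range_chart (l₂ s) U (hs ▸ hU) (I.ideal U)
    (Ideal.span_eq _).symm
  let c : BlowupChart I := ⟨U, a, ha⟩
  let c' : BlowupChart I := ⟨U, b, hb⟩
  let m₁ := IsOpenImmersion.lift (h.chart c) l₁ (range_subset_of_closedPoint l₁ _ h₁)
  let m₂ := IsOpenImmersion.lift (h.chart c') l₂ (range_subset_of_closedPoint l₂ _ h₂)
  have hm₁ : m₁ ≫ h.chart c = l₁ := IsOpenImmersion.lift_fac _ _ _
  have hm₂ : m₂ ≫ h.chart c' = l₂ := IsOpenImmersion.lift_fac _ _ _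
  have htc : c.toChart c' ≫ h.chart c' = (c.overlap c').ι ≫ h.chart c := by
    have e : (c.toChart c' ≫ h.chart c') ≫ π = ((c.overlap c').ι ≫ h.chart c) ≫ π := by
      rw [Category.assoc, Category.assoc, h.chart_π, h.chart_π, toChart_π]
    refine h.lift_ext e ?_
    rw [e, Category.assoc, h.chart_π]
    exact isInvertible_comp _ c.isInvertible
  have hover : ∀ v : c.V, h.chart c v ∈ Set.range (h.chart c') → v ∈ c.overlap c' := by
    intro v hv
    have := ((h.mem_range_chart_iff c' _).mp hv).comp (h.chart c)
    rwa [h.chart_π] at this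
  -- the morphism from the spectrum of `K` to the overlap
  have hφ : φ ≫ m₁ ≫ h.chart c = φ ≫ m₂ ≫ h.chart c' := by rw [hm₁, hm₂, hl₁, hl₂]
  let k : Spec (CommRingCat.of K) ⟶ (c.overlap c').toScheme :=
    IsOpenImmersion.lift (c.overlap c').ι (φ ≫ m₁) (by
      rintro _ ⟨t, rfl⟩
      rw [Scheme.Opens.range_ι]
      refine hover _ ⟨(φ ≫ m₂) t, ?_⟩
      rw [← Scheme.Hom.comp_apply, ← Scheme.Hom.comp_apply, Category.assoc, Category.assoc, hφ])
  have hk : k ≫ (c.overlap c').ι = φ ≫ m₁ := IsOpenImmersion.lift_fac _ _ _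
  have hk' : k ≫ c.toChart c' = φ ≫ m₂ := by
    rw [← cancel_mono (h.chart c'), Category.assoc, htc, reassoc_of% hk, hφ, Category.assoc]
  have hD := quotient_mul_quotient U a b ha hb (c.overlap c').ι (c.toChart c') (toChart_π c c')
    (isInvertible_comp _ c.isInvertible)
  have hφinj : Function.Injective φ.appTop.hom := by
    have e := Scheme.ΓSpecIso_inv_naturality (CommRingCat.ofHom (algebraMap R K))
    have hinj : Function.Injective (CommRingCat.ofHom (algebraMap R K) ≫
        (Scheme.ΓSpecIso (CommRingCat.of K)).inv).hom :=
      (ConcreteCategory.bijective_of_isIso (Scheme.ΓSpecIso (CommRingCat.of K)).inv).1.comp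
        (IsFractionRing.injective R K)
    rw [e] at hinj
    exact Function.Injective.of_comp_right hinj
      (ConcreteCategory.bijective_of_isIso (Scheme.ΓSpecIso (CommRingCat.of R)).inv).2
  have hR : m₁.appTop (c.quotient b hb) * m₂.appTop (c'.quotient a ha) = 1 := by
    apply hφinj
    have := congrArg k.appTop.hom hD
    rw [map_mul, map_one] at this ⊢
    rw [← this]
    congr 1
    · exact (ConcreteCategory.congr_hom (congrArg Scheme.Hom.appTop hk) (c.quotient b hb)).symm
    · exact (ConcreteCategory.congr_hom (congrArg Scheme.Hom.appTop hk') (c'.quotient a ha)).symm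
  -- hence the whole morphism lands in the overlap
  have hms : m₁ s ∈ c.overlap c' := by
    refine ⟨c.le_preimage (x := m₁ s) trivial, ?_⟩
    have h1 := (c.isGenerator (m₁ s) trivial).1
    have h2 : m₁ s ∈ c.V.basicOpen (c.quotient b hb) := by
      change s ∈ m₁ ⁻¹ᵁ c.V.basicOpen (c.quotient b hb)
      rw [Scheme.preimage_basicOpen, Scheme.basicOpen_of_isUnit]
      · trivial
      · exact IsUnit.of_mul_eq_one _ hR
    rw [Scheme.mem_basicOpen _ _ _ (show m₁ s ∈ (⊤ : Opens _) from trivial)] at h2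
    have h3 := congrArg (c.V.presheaf.germ ⊤ (m₁ s) trivial) (c.mul_quotient b hb)
    rw [map_mul] at h3
    have h4 := germ_appLE c.π c.le_preimage (m₁ s) (show m₁ s ∈ (⊤ : Opens _) from trivial) b
    rw [h1, ← Ideal.span_singleton_mul_right_unit h2]
    exact congrArg (fun x => Ideal.span {x}) (h3.trans h4)
  let m : Spec (CommRingCat.of R) ⟶ (c.overlap c').toScheme :=
    IsOpenImmersion.lift (c.overlap c').ι m₁ (range_subset_of_closedPoint m₁ _ (by
      rw [Scheme.Opens.range_ι]; exact hms))
  have hm : m ≫ (c.overlap c').ι = m₁ := IsOpenImmersion.lift_fac _ _ _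
  have hφm : φ ≫ m = k := by
    rw [← cancel_mono (c.overlap c').ι, Category.assoc, hm, hk]
  have key : m ≫ c.toChart c' = m₂ := by
    apply AlgebraicGeometry.ext_of_isAffine
    ext x
    apply hφinj
    have : φ ≫ m ≫ c.toChart c' = φ ≫ m₂ := by rw [← hk', ← hφm, Category.assoc]
    exact ConcreteCategory.congr_hom (congrArg Scheme.Hom.appTop this) x
  rw [← hm₁, ← hm₂, ← key, ← hm, Category.assoc, Category.assoc, htc]

end Separated

end MonomialResolution

end

noncomputable section

namespace MonomialResolution

/-! ### Étale coordinates on blowup charts and on coordinate subspaces -/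

section EtaleBaseChange

variable {R A B : Type u} [CommRing R] [CommRing A] [CommRing B]

open TensorProduct in
lemma exists_etale_pushout (φ : R →+* B) (ψ : R →+* A) (hψ : ψ.Etale) :
    ∃ (C : Type u) (_ : CommRing C) (α : A →+* C) (β : B →+* C), β.Etale ∧
      α.comp ψ = β.comp φ ∧
      (∀ (D : Type u) [CommRing D] (f : A →+* D) (g : B →+* D), f.comp ψ = g.comp φ →
        ∃ h : C →+* D, h.comp α = f ∧ h.comp β = g) ∧
      ∀ (D : Type u) [CommRing D] (h₁ h₂ : C →+* D), h₁.comp α = h₂.comp α →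
        h₁.comp β = h₂.comp β → h₁ = h₂ := by
  algebraize [φ, ψ]
  have : Algebra.Etale R A := hψ
  refine ⟨B ⊗[R] A, inferInstance, (Algebra.TensorProduct.includeRight : A →ₐ[R] B ⊗[R] A),
    (Algebra.TensorProduct.includeLeft : B →ₐ[R] B ⊗[R] A), ?_, ?_, ?_, ?_⟩
  · exact RingHom.etale_algebraMap.mpr (inferInstance : Algebra.Etale B (B ⊗[R] A))
  · ext r
    simp only [RingHom.comp_apply]
    exact (Algebra.TensorProduct.includeRight.commutes r).trans
      ((Algebra.TensorProduct.includeLeft : B →ₐ[R] B ⊗[R] A).commutes r).symm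
  · intro D _ f g hfg
    algebraize [f.comp ψ]
    let f' : A →ₐ[R] D := { f with commutes' := fun r => rfl }
    let g' : B →ₐ[R] D := { g with commutes' := fun r => (RingHom.congr_fun hfg r).symm }
    refine ⟨(Algebra.TensorProduct.lift g' f' fun _ _ => Commute.all _ _ : B ⊗[R] A →ₐ[R] D),
      ?_, ?_⟩
    · ext a
      simp [f']
    · ext b
      simp [g']
  · intro D _ h₁ h₂ hα hβ
    refine RingHom.ext fun t => ?_
    induction t with
    | zero => simp
    | add x y hx hy => simp [hx, hy]
    | tmul b a =>
      have e : b ⊗ₜ[R] a = (Algebra.TensorProduct.includeLeft : B →ₐ[R] B ⊗[R] A) b *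
        (Algebra.TensorProduct.includeRight : A →ₐ[R] B ⊗[R] A) a := by simp
      rw [e, map_mul, map_mul]
      exact congrArg₂ _ (RingHom.congr_fun hβ b) (RingHom.congr_fun hα a)

lemma etale_equiv_comp {C D : Type u} [CommRing C] [CommRing D] {β : B →+* C} (hβ : β.Etale)
    (f : C →+* D) (g : D →+* C) (h₁ : g.comp f = RingHom.id C) (h₂ : f.comp g = RingHom.id D) :
    (f.comp β).Etale :=
  RingHom.Etale.stableUnderComposition _ _ hβ <| RingHom.Etale.of_bijective
    ⟨Function.LeftInverse.injective fun x => RingHom.congr_fun h₁ x,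
      Function.RightInverse.surjective fun x => RingHom.congr_fun h₂ x⟩

end EtaleBaseChange

section Coordinates

variable {k A : Type u} {ι : Type} [Field k] [CommRing A] {c : k →+* A} {x : ι → A}

/-- Translation by constants preserves coordinates. -/
lemma IsCoordinates.sub_const (h : IsCoordinates c x) (a : ι → k) :
    IsCoordinates c fun i => x i - c (a i) := by
  let T : (ι → k) → MvPolynomial ι k →+* MvPolynomial ι k := fun a =>
    MvPolynomial.eval₂Hom MvPolynomial.C fun i => MvPolynomial.X i - MvPolynomial.C (a i)
  have hT : ∀ a, (T a).comp (T (-a)) = RingHom.id _ := by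
    intro a
    ext i <;> simp [T]
  have hb : Function.Bijective (T a) := by
    refine ⟨Function.LeftInverse.injective (g := T (-a)) fun x => ?_,
      Function.RightInverse.surjective (g := T (-a)) fun x => RingHom.congr_fun (hT a) x⟩
    have := RingHom.congr_fun (hT (-a)) x
    rwa [neg_neg] at this
  have := RingHom.Etale.stableUnderComposition _ _ (RingHom.Etale.of_bijective hb) h
  rw [IsCoordinates]
  convert this
  ext i <;> simp [T]

lemma IsCoordinates.comp {A' : Type u} [CommRing A'] (h : IsCoordinates c x) (f : A →+* A')
    (hf : f.Etale) : IsCoordinates (f.comp c) fun i => f (x i) := by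
  have := RingHom.Etale.stableUnderComposition _ _ h hf
  rw [IsCoordinates]
  convert this
  ext i <;> simp

lemma isStandardSmoothOfRelativeDimension_C (k : Type u) [Field k] (d : ℕ) :
    (MvPolynomial.C : k →+* MvPolynomial (Fin d) k).IsStandardSmoothOfRelativeDimension d := by
  have hb : Set.range (KaehlerDifferential.mvPolynomialBasis k (Fin d)) ⊆
      Set.range (KaehlerDifferential.D k (MvPolynomial (Fin d) k)) := by
    rintro _ ⟨i, rfl⟩
    exact ⟨MvPolynomial.X i, (KaehlerDifferential.mvPolynomialBasis_apply k (Fin d) i).symm⟩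
  have := Algebra.IsStandardSmooth.of_basis_kaehlerDifferential _ hb
  have h : Algebra.IsStandardSmoothOfRelativeDimension d k (MvPolynomial (Fin d) k) := by
    rw [Algebra.IsStandardSmoothOfRelativeDimension.iff_of_isStandardSmooth,
      rank_eq_card_basis (KaehlerDifferential.mvPolynomialBasis k (Fin d)), Fintype.card_fin]
  rw [← MvPolynomial.algebraMap_eq, RingHom.IsStandardSmoothOfRelativeDimension,
    toAlgebra_algebraMap]
  exact h

lemma IsCoordinates.isStandardSmoothOfRelativeDimension {d : ℕ} {x : Fin d → A}
    (h : IsCoordinates c x) : c.IsStandardSmoothOfRelativeDimension d := by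
  have h1 := (RingHom.etale_iff_isStandardSmoothOfRelativeDimension_zero).mp h
  have h2 := h1.comp (isStandardSmoothOfRelativeDimension_C k d)
  rw [zero_add] at h2
  convert h2
  ext a
  simp

open Classical in
/-- The coordinates on the chart of a blowup of a coordinate subspace. -/
theorem IsCoordinates.exists_blowupAlgebra (h : IsCoordinates c x) (M : Set ι) (i : ι) (hi : i ∈ M) :
    ∃ y : ι → blowupAlgebra (Ideal.span (x '' M)) (x i),
      IsCoordinates ((algebraMap A _).comp c) y ∧ y i = algebraMap A _ (x i) ∧
      (∀ j ∈ M, j ≠ i → algebraMap A _ (x j) = algebraMap A _ (x i) * y j) ∧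
      ∀ j ∉ M, y j = algebraMap A _ (x j) := by
  let φ : MvPolynomial ι k →+* MvPolynomial ι k := MvPolynomial.eval₂Hom MvPolynomial.C fun j =>
    if j ∈ M ∧ j ≠ i then MvPolynomial.X i * MvPolynomial.X j else MvPolynomial.X j
  obtain ⟨C', _, α, β, hβ, hαβ, hex, hext⟩ := exists_etale_pushout φ (MvPolynomial.eval₂Hom c x) h
  have hx : ∀ j, α (x j) = β (φ (MvPolynomial.X j)) := fun j => by
    have := RingHom.congr_fun hαβ (MvPolynomial.X j)
    simpa using this
  have hc : ∀ a, α (c a) = β (MvPolynomial.C a) := fun a => by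
    have := RingHom.congr_fun hαβ (MvPolynomial.C a)
    simpa [φ] using this
  have hxi : α (x i) = β (MvPolynomial.X i) := by rw [hx]; simp [φ]
  have hxM : ∀ j ∈ M, j ≠ i → α (x j) = α (x i) * β (MvPolynomial.X j) := fun j hj hji => by
    rw [hx j, hxi]
    simp [φ, hj, hji]
  have hnzd : α (x i) ∈ nonZeroDivisors C' := by
    rw [hxi]
    have hfl : β.Flat := ((RingHom.Etale.iff_flat_and_formallyUnramified).mp hβ).1
    algebraize [β]
    have hX : (MvPolynomial.X i : MvPolynomial ι k) ∈ nonZeroDivisors (MvPolynomial ι k) :=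
      mem_nonZeroDivisors_of_ne_zero (MvPolynomial.X_ne_zero i)
    have : Module.Flat (MvPolynomial ι k) C' := hfl
    have h1 := Module.Flat.isSMulRegular_of_nonZeroDivisors (M := C') hX
    rw [mem_nonZeroDivisors_iff_left]
    intro z hz
    exact h1 (by simpa [Algebra.smul_def, RingHom.algebraMap_toAlgebra] using hz)
  obtain ⟨f, hf⟩ := blowupAlgebra.exists_lift (I := Ideal.span (x '' M)) α hnzd (by
    have : Ideal.span (x '' M) ≤ (Ideal.span {α (x i)}).comap α := by
      rw [Ideal.span_le]
      rintro _ ⟨j, hj, rfl⟩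
      rw [SetLike.mem_coe, Ideal.mem_comap]
      by_cases hji : j = i
      · subst hji; exact Ideal.mem_span_singleton_self _
      · rw [hxM j hj hji]; exact Ideal.mul_mem_right _ _ (Ideal.mem_span_singleton_self _)
    exact fun f hf => this hf)
  have hz : ∀ j, ∃ z : blowupAlgebra (Ideal.span (x '' M)) (x i), j ∈ M → j ≠ i → algebraMap A (blowupAlgebra (Ideal.span (x '' M)) (x i)) (x i) * z = algebraMap A (blowupAlgebra (Ideal.span (x '' M)) (x i)) (x j) := by
    intro j
    by_cases hj : j ∈ M
    · obtain ⟨z, hz⟩ := blowupAlgebra.exists_mul_eq (Ideal.span (x '' M)) (x i)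
        (Ideal.subset_span ⟨j, hj, rfl⟩)
      exact ⟨z, fun _ _ => hz⟩
    · exact ⟨0, fun h => absurd h hj⟩
  choose z hz using hz
  let y : ι → blowupAlgebra (Ideal.span (x '' M)) (x i) := fun j => if j ∈ M ∧ j ≠ i then z j else algebraMap A (blowupAlgebra (Ideal.span (x '' M)) (x i)) (x j)
  let g₀ : MvPolynomial ι k →+* blowupAlgebra (Ideal.span (x '' M)) (x i) := MvPolynomial.eval₂Hom ((algebraMap A (blowupAlgebra (Ideal.span (x '' M)) (x i))).comp c) y
  have hyi : y i = algebraMap A (blowupAlgebra (Ideal.span (x '' M)) (x i)) (x i) := by simp [y]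
  have hyM : ∀ j ∈ M, j ≠ i → algebraMap A (blowupAlgebra (Ideal.span (x '' M)) (x i)) (x j) = algebraMap A (blowupAlgebra (Ideal.span (x '' M)) (x i)) (x i) * y j := by
    intro j hj hji
    simp [y, hj, hji, hz j hj hji]
  have hyN : ∀ j ∉ M, y j = algebraMap A _ (x j) := by
    intro j hj
    simp [y, hj]
  obtain ⟨g, hgα, hgβ⟩ := hex (blowupAlgebra (Ideal.span (x '' M)) (x i)) (algebraMap A (blowupAlgebra (Ideal.span (x '' M)) (x i))) g₀ (by
    ext j
    · simp [g₀, φ]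
    · by_cases hj : j ∈ M ∧ j ≠ i
      · simp [g₀, φ, hj, hyi, hyM j hj.1 hj.2]
      · simp [g₀, φ, hj, y])
  have hgx : g (α (x i)) = algebraMap A (blowupAlgebra (Ideal.span (x '' M)) (x i)) (x i) := RingHom.congr_fun hgα (x i)
  have hfx : ∀ a, f (algebraMap A (blowupAlgebra (Ideal.span (x '' M)) (x i)) a) = α a := fun a => RingHom.congr_fun hf a
  have hgf : g.comp f = RingHom.id (blowupAlgebra (Ideal.span (x '' M)) (x i)) := by
    refine blowupAlgebra.hom_ext ?_ ?_
    · rw [RingHom.comp_assoc, hf, hgα, RingHom.id_comp]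
    · rw [RingHom.comp_apply, hfx, hgx]
      exact blowupAlgebra.algebraMap_mem_nonZeroDivisors _ _
  have hfg : f.comp g = RingHom.id C' := by
    refine hext C' _ _ ?_ ?_
    · rw [RingHom.comp_assoc, hgα, hf, RingHom.id_comp]
    · rw [RingHom.comp_assoc, hgβ, RingHom.id_comp]
      ext j
      · simp [g₀, hfx, hc]
      · simp only [RingHom.comp_apply, g₀, MvPolynomial.eval₂Hom_X']
        by_cases hj : j ∈ M ∧ j ≠ i
        · have h1 := congrArg f (hyM j hj.1 hj.2)
          rw [map_mul, hfx, hfx, hxM j hj.1 hj.2] at h1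
          exact (mul_cancel_left_mem_nonZeroDivisors hnzd |>.mp h1).symm
        · simp [y, hj, hfx, hx, φ]
  refine ⟨y, ?_, hyi, hyM, hyN⟩
  have := etale_equiv_comp hβ g f hfg hgf
  rwa [hgβ] at this

/-- Coordinate subspaces are smooth. -/
theorem IsCoordinates.smooth_quotient [Finite ι] (h : IsCoordinates c x) (M : Set ι) :
    ((Ideal.Quotient.mk (Ideal.span (x '' M))).comp c).Smooth := by
  classical
  let φ : MvPolynomial ι k →+* MvPolynomial {j // j ∉ M} k := MvPolynomial.eval₂Hom MvPolynomial.C fun j =>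
    if hj : j ∈ M then 0 else MvPolynomial.X ⟨j, hj⟩
  obtain ⟨C', _, α, β, hβ, hαβ, hex, hext⟩ := exists_etale_pushout φ (MvPolynomial.eval₂Hom c x) h
  have hx : ∀ j, α (x j) = β (φ (MvPolynomial.X j)) := fun j => by
    have := RingHom.congr_fun hαβ (MvPolynomial.X j)
    simpa using this
  have hc : ∀ a, α (c a) = β (MvPolynomial.C a) := fun a => by
    have := RingHom.congr_fun hαβ (MvPolynomial.C a)
    simpa [φ] using this
  obtain ⟨f, hf⟩ : ∃ f : A ⧸ Ideal.span (x '' M) →+* C', ∀ a, f (Ideal.Quotient.mk _ a) = α a :=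
    ⟨Ideal.Quotient.lift (Ideal.span (x '' M)) α (by
    have : Ideal.span (x '' M) ≤ RingHom.ker α := by
      rw [Ideal.span_le]
      rintro _ ⟨j, hj, rfl⟩
      rw [SetLike.mem_coe, RingHom.mem_ker, hx]
      simp [φ, hj]
    exact fun a ha => this ha), fun a => rfl⟩
  let g₀ : MvPolynomial {j // j ∉ M} k →+* A ⧸ Ideal.span (x '' M) := MvPolynomial.eval₂Hom ((Ideal.Quotient.mk (Ideal.span (x '' M))).comp c) fun j =>
    Ideal.Quotient.mk (Ideal.span (x '' M)) (x j)
  obtain ⟨g, hgα, hgβ⟩ := hex (A ⧸ Ideal.span (x '' M)) (Ideal.Quotient.mk (Ideal.span (x '' M))) g₀ (by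
    ext j
    · simp [g₀, φ]
    · by_cases hj : j ∈ M
      · have : Ideal.Quotient.mk (Ideal.span (x '' M)) (x j) = 0 :=
          Ideal.Quotient.eq_zero_iff_mem.mpr (Ideal.subset_span ⟨j, hj, rfl⟩)
        simp [φ, hj, this]
      · simp [g₀, φ, hj])
  have hgf : g.comp f = RingHom.id (A ⧸ Ideal.span (x '' M)) := by
    apply Ideal.Quotient.ringHom_ext
    rw [RingHom.id_comp]
    ext a
    simp only [RingHom.comp_apply, hf]
    exact RingHom.congr_fun hgα a
  have hfg : f.comp g = RingHom.id C' := by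
    refine hext C' _ _ ?_ ?_
    · rw [RingHom.comp_assoc, hgα, RingHom.id_comp]
      ext a
      simp [hf]
    · rw [RingHom.comp_assoc, hgβ, RingHom.id_comp]
      ext j
      · simp [g₀, hf, hc]
      · obtain ⟨j, hj⟩ := j
        simp [g₀, hf, hx, φ, hj]
  have h1 := etale_equiv_comp hβ g f hfg hgf
  rw [hgβ] at h1
  have h2 : (MvPolynomial.C : k →+* MvPolynomial {j // j ∉ M} k).Smooth := by
    rw [← MvPolynomial.algebraMap_eq, RingHom.smooth_algebraMap]
    exact ⟨inferInstance, inferInstance⟩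
  have h3 := RingHom.Smooth.stableUnderComposition _ _ h2 
    ((RingHom.etale_iff_formallyUnramified_and_smooth _).mp h1).2
  convert h3
  ext a
  simp [g₀]

end Coordinates

end MonomialResolution

end

noncomputable section

namespace MonomialResolution

/-! ### Schemes over a field -/

section OverField

variable {k : Type u} [Field k] {X Y : Scheme.{u}} (s : X ⟶ Spec (CommRingCat.of k))

lemma le_preimage_top (f : X ⟶ Y) (U : X.Opens) : U ≤ f ⁻¹ᵁ ⊤ := le_top

/-- The constant functions on an open subset of a scheme over a field. -/
def constants (U : X.Opens) : k →+* Γ(X, U) :=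
  ((Scheme.ΓSpecIso (CommRingCat.of k)).inv ≫ s.appLE ⊤ U (le_preimage_top s U)).hom

variable {s}

lemma constants_res {U V : X.Opens} (h : V ≤ U) :
    (X.presheaf.map (homOfLE h).op).hom.comp (constants s U) = constants s V := by
  rw [constants, constants, ← CommRingCat.hom_comp, Category.assoc, Scheme.Hom.appLE_map]

lemma constants_comp (π : Y ⟶ X) {U : X.Opens} {V : Y.Opens} (e : V ≤ π ⁻¹ᵁ U) :
    (π.appLE U V e).hom.comp (constants s U) = constants (π ≫ s) V := by
  rw [constants, constants, ← CommRingCat.hom_comp, Category.assoc,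
    Scheme.Hom.appLE_comp_appLE]

lemma SpecMap_constants_germ (U : X.affineOpens) {p : X} (hp : p ∈ U.1) :
    Spec.map (CommRingCat.ofHom (constants s U.1) ≫ X.presheaf.germ U.1 p hp) =
      X.fromSpecStalk p ≫ s := by
  have h1 := IsAffineOpen.SpecMap_appLE_fromSpec s
    (isAffineOpen_top (Spec (CommRingCat.of k))) U.2 (le_preimage_top s U.1)
  rw [IsAffineOpen.fromSpec_top, Scheme.isoSpec_Spec_inv] at h1
  have h2 : X.fromSpecStalk p = Spec.map (X.presheaf.germ U.1 p hp) ≫ U.2.fromSpec :=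
    (U.2.fromSpecStalk_eq_fromSpecStalk hp).symm
  rw [h2, Category.assoc, ← h1, ← Spec.map_comp, ← Spec.map_comp]
  rfl

lemma exists_sub_constants_mem [IsAlgClosed k] [LocallyOfFiniteType s] (U : X.affineOpens) {p : X}
    (hp : p ∈ U.1) (hc : IsClosed ({p} : Set X)) (f : X.presheaf.stalk p) :
    ∃ a : k, f - X.presheaf.germ U.1 p hp (constants s U.1 a) ∈
      IsLocalRing.maximalIdeal (X.presheaf.stalk p) := by
  have h1 : (residueFieldIsoBase s p hc).inv =
      CommRingCat.ofHom (constants s U.1) ≫ X.presheaf.germ U.1 p hp ≫ X.residue p := by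
    apply Spec.map_injective
    rw [SpecMap_residueFieldIsoBase_inv, Scheme.fromSpecResidueField, Category.assoc,
      ← SpecMap_constants_germ U hp, ← Spec.map_comp, Category.assoc]
  obtain ⟨a, ha⟩ := (ConcreteCategory.bijective_of_isIso (residueFieldIsoBase s p hc).inv).2
    (X.residue p f)
  refine ⟨a, ?_⟩
  rw [← IsLocalRing.residue_eq_zero_iff, map_sub, sub_eq_zero]
  rw [h1] at ha
  exact ha.symm

lemma germ_mem_maximalIdeal_iff (U : X.affineOpens) {p : X} (hp : p ∈ U.1) (f : Γ(X, U.1)) :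
    X.presheaf.germ U.1 p hp f ∈ IsLocalRing.maximalIdeal (X.presheaf.stalk p) ↔
      f ∈ (U.2.primeIdealOf ⟨p, hp⟩).asIdeal := by
  let := X.presheaf.algebra_section_stalk ⟨p, hp⟩
  have := U.2.isLocalization_stalk ⟨p, hp⟩
  exact IsLocalization.AtPrime.to_map_mem_maximal_iff (X.presheaf.stalk p)
    (U.2.primeIdealOf ⟨p, hp⟩).asIdeal f

lemma exists_sub_constants_mem_primeIdealOf [IsAlgClosed k] [LocallyOfFiniteType s]
    (U : X.affineOpens) {p : X} (hp : p ∈ U.1) (hc : IsClosed ({p} : Set X)) (f : Γ(X, U.1)) :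
    ∃ a : k, f - constants s U.1 a ∈ (U.2.primeIdealOf ⟨p, hp⟩).asIdeal := by
  obtain ⟨a, ha⟩ := exists_sub_constants_mem (s := s) U hp hc (X.presheaf.germ U.1 p hp f)
  refine ⟨a, ?_⟩
  rwa [← germ_mem_maximalIdeal_iff, map_sub]

theorem IsCoordinates.regularSystem_germ [IsAlgClosed k] [LocallyOfFiniteType s]
    [IsLocallyNoetherian X] {ι : Type} [Fintype ι] {U : X.affineOpens} {ξ : ι → Γ(X, U.1)}
    (h : IsCoordinates (constants s U.1) ξ) {p : X} (hp : p ∈ U.1) (hc : IsClosed ({p} : Set X))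
    (hξ : ∀ i, X.presheaf.germ U.1 p hp (ξ i) ∈ IsLocalRing.maximalIdeal (X.presheaf.stalk p)) :
    RegularSystem fun i => X.presheaf.germ U.1 p hp (ξ i) := by
  let := X.presheaf.algebra_section_stalk ⟨p, hp⟩
  have := U.2.isLocalization_stalk ⟨p, hp⟩
  exact h.regularSystem (U.2.primeIdealOf ⟨p, hp⟩).asIdeal
    (fun i => (germ_mem_maximalIdeal_iff U hp _).mp (hξ i))
    (exists_sub_constants_mem_primeIdealOf U hp hc) (X.presheaf.stalk p)

lemma exists_isStandardSmoothOfRelativeDimension (s : X ⟶ Spec (CommRingCat.of k)) {d : ℕ}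
    [SmoothOfRelativeDimension d s] (p : X) :
    ∃ U : X.affineOpens, p ∈ U.1 ∧ (constants s U.1).IsStandardSmoothOfRelativeDimension d := by
  obtain ⟨U₀, hU₀, V, hV, hp, e, h⟩ :=
    SmoothOfRelativeDimension.exists_isStandardSmoothOfRelativeDimension (n := d) (f := s) p
  obtain rfl : U₀ = ⊤ := by
    rw [eq_top_iff]
    intro t _
    have : t = s p := Subsingleton.elim (α := PrimeSpectrum k) _ _
    rw [this]
    exact e hp
  refine ⟨⟨V, hV⟩, hp, ?_⟩
  have h2 := RingHom.IsStandardSmoothOfRelativeDimension.equiv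
    (Scheme.ΓSpecIso (CommRingCat.of k)).symm.commRingCatIsoToRingEquiv
  have h3 := h.comp h2
  rw [add_zero] at h3
  exact h3

lemma smoothOfRelativeDimension_of_forall (s : X ⟶ Spec (CommRingCat.of k)) {d : ℕ}
    (h : ∀ p, ∃ U : X.affineOpens, p ∈ U.1 ∧ ∃ ξ : Fin d → Γ(X, U.1),
      IsCoordinates (constants s U.1) ξ) : SmoothOfRelativeDimension d s := by
  refine ⟨fun p => ?_⟩
  obtain ⟨U, hp, ξ, hξ⟩ := h p
  refine ⟨⊤, isAffineOpen_top _, U.1, U.2, hp, le_preimage_top s U.1, ?_⟩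
  have h1 := hξ.isStandardSmoothOfRelativeDimension
  have h2 := RingHom.IsStandardSmoothOfRelativeDimension.equiv
    (Scheme.ΓSpecIso (CommRingCat.of k)).commRingCatIsoToRingEquiv
  have h3 := h1.comp h2
  rw [add_zero] at h3
  convert h3
  exact congrArg CommRingCat.Hom.hom (Iso.hom_inv_id_assoc (Scheme.ΓSpecIso (CommRingCat.of k))
    (s.appLE ⊤ U.1 (le_preimage_top s U.1))).symm

lemma IsCoordinates.res {ι : Type} {U V : X.affineOpens} {ξ : ι → Γ(X, U.1)}
    (h : IsCoordinates (constants s U.1) ξ) (f : Γ(X, U.1)) (hV : V.1 = X.basicOpen f)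
    (hVU : V.1 ≤ U.1) :
    IsCoordinates (constants s V.1) fun i => X.presheaf.map (homOfLE hVU).op (ξ i) := by
  rw [← constants_res hVU]
  refine h.comp (X.presheaf.map (homOfLE hVU).op).hom ?_
  obtain ⟨V, hV'⟩ := V
  obtain rfl : V = X.basicOpen f := hV
  let := (X.presheaf.map (homOfLE hVU).op).hom.toAlgebra
  have : IsLocalization.Away f Γ(X, X.basicOpen f) := U.2.isLocalization_basicOpen f
  have h : Algebra.Etale Γ(X, U.1) Γ(X, X.basicOpen f) := Algebra.Etale.of_isLocalizationAway f
  exact RingHom.etale_algebraMap.mpr h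

/-- Generators of the maximal ideal of a closed point extend to coordinates. -/
theorem exists_isCoordinates [IsAlgClosed k] (s : X ⟶ Spec (CommRingCat.of k)) {d : ℕ}
    [SmoothOfRelativeDimension d s] {p : X} (hc : IsClosed ({p} : Set X))
    {x : Fin d → X.presheaf.stalk p}
    (hx : Ideal.span (Set.range x) = IsLocalRing.maximalIdeal (X.presheaf.stalk p)) :
    ∃ (U : X.affineOpens) (hp : p ∈ U.1) (ξ : Fin d → Γ(X, U.1)),
      IsCoordinates (constants s U.1) ξ ∧ ∀ i, X.presheaf.germ U.1 p hp (ξ i) = x i := by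
  have : Smooth s := SmoothOfRelativeDimension.smooth d s
  obtain ⟨U, hp, hU⟩ := exists_isStandardSmoothOfRelativeDimension s (d := d) p
  have hspread : ∃ (f : Γ(X, U.1)) (hf : p ∈ X.basicOpen f) (ξ : Fin d → Γ(X, X.basicOpen f)),
      ∀ i, X.presheaf.germ _ p hf (ξ i) = x i := by
    let := X.presheaf.algebra_section_stalk ⟨p, hp⟩
    have := U.2.isLocalization_stalk ⟨p, hp⟩
    obtain ⟨b, hb⟩ := IsLocalization.exist_integer_multiples_of_finite
      (U.2.primeIdealOf ⟨p, hp⟩).asIdeal.primeCompl x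
    choose a ha using hb
    have hpb : p ∈ X.basicOpen b.1 := by
      rw [Scheme.mem_basicOpen _ _ _ hp]
      exact IsLocalization.map_units (X.presheaf.stalk p) b
    have hu : IsUnit (X.presheaf.map (homOfLE (X.basicOpen_le b.1)).op b.1) :=
      RingedSpace.isUnit_res_basicOpen X.toRingedSpace b.1
    obtain ⟨w, hw⟩ := hu.exists_right_inv
    refine ⟨b.1, hpb, fun i => w * X.presheaf.map (homOfLE (X.basicOpen_le b.1)).op (a i),
      fun i => ?_⟩
    have hres : ∀ z, X.presheaf.germ _ p hpb (X.presheaf.map (homOfLE (X.basicOpen_le b.1)).op z) =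
        X.presheaf.germ U.1 p hp z := fun z => X.presheaf.germ_res_apply _ p hpb z
    have hw' := congrArg (X.presheaf.germ _ p hpb) hw
    rw [map_mul, map_one, hres] at hw'
    have hai : X.presheaf.germ U.1 p hp (a i) = X.presheaf.germ U.1 p hp b.1 * x i :=
      (ha i).trans (Algebra.smul_def _ _)
    rw [map_mul, hres, hai, ← mul_assoc, mul_comm (X.presheaf.germ _ p hpb w), hw', one_mul]
  obtain ⟨f, hf, ξ, hξ⟩ := hspread
  let V : X.affineOpens := ⟨X.basicOpen f, U.2.basicOpen f⟩
  have hVc : (constants s V.1).IsStandardSmoothOfRelativeDimension d := by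
    rw [← constants_res (X.basicOpen_le f)]
    let := (X.presheaf.map (homOfLE (X.basicOpen_le f)).op).hom.toAlgebra
    have : IsLocalization.Away f Γ(X, X.basicOpen f) := U.2.isLocalization_basicOpen f
    have h := RingHom.IsStandardSmoothOfRelativeDimension.algebraMap_isLocalizationAway
      (Rᵣ := Γ(X, X.basicOpen f)) f
    have h2 := h.comp hU
    rw [zero_add] at h2
    exact h2
  have hmem : ∀ i, ξ i ∈ (V.2.primeIdealOf ⟨p, hf⟩).asIdeal := fun i => by
    rw [← germ_mem_maximalIdeal_iff V hf, hξ, ← hx]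
    exact Ideal.subset_span ⟨i, rfl⟩
  obtain ⟨g, hg, hcoord⟩ := exists_isCoordinates_localization hVc
    (V.2.primeIdealOf ⟨p, hf⟩).asIdeal hmem (exists_sub_constants_mem_primeIdealOf V hf hc) (by
      intro F hF
      let := X.presheaf.algebra_section_stalk ⟨p, hf⟩
      have := V.2.isLocalization_stalk ⟨p, hf⟩
      rw [← germ_mem_maximalIdeal_iff V hf, ← hx] at hF
      have h1 : algebraMap Γ(X, V.1) (X.presheaf.stalk p) F ∈
          (Ideal.span (Set.range ξ)).map (algebraMap Γ(X, V.1) (X.presheaf.stalk p)) := by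
        rw [Ideal.map_span, ← Set.range_comp]
        rw [show ⇑(algebraMap Γ(X, V.1) (X.presheaf.stalk p)) ∘ ξ = x from funext hξ]
        exact hF
      obtain ⟨t, ht, ht'⟩ := (IsLocalization.algebraMap_mem_map_algebraMap_iff
        (V.2.primeIdealOf ⟨p, hf⟩).asIdeal.primeCompl _ _ _).mp h1
      exact ⟨t, ht, ht'⟩)
  have hpg : p ∈ X.basicOpen g := by
    rw [Scheme.mem_basicOpen _ _ _ hf]
    by_contra h
    exact hg ((germ_mem_maximalIdeal_iff V hf g).mp ((IsLocalRing.mem_maximalIdeal _).mpr h))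
  refine ⟨⟨X.basicOpen g, V.2.basicOpen g⟩, hpg, fun i =>
    X.presheaf.map (homOfLE (X.basicOpen_le g)).op (ξ i), ?_, fun i => ?_⟩
  · let := (X.presheaf.map (homOfLE (X.basicOpen_le g)).op).hom.toAlgebra
    have : IsLocalization.Away g Γ(X, X.basicOpen g) := V.2.isLocalization_basicOpen g
    let e := IsLocalization.algEquiv (Submonoid.powers g) (Localization.Away g) Γ(X, X.basicOpen g)
    have h1 := hcoord.comp (e : Localization.Away g →+* Γ(X, X.basicOpen g))
      (RingHom.Etale.of_bijective e.bijective)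
    convert h1 using 1
    · rw [← constants_res (X.basicOpen_le g)]
      ext a
      exact (e.commutes _).symm
    · ext i
      exact (e.commutes _).symm
  · exact (X.presheaf.germ_res_apply (homOfLE (X.basicOpen_le g)) p hpg (ξ i)).trans (hξ i)

/-- A closed subset which is locally given by coordinates is smooth. -/
theorem smooth_subscheme (s : X ⟶ Spec (CommRingCat.of k)) (I : X.IdealSheafData) {ι : Type}
    [Finite ι]
    (h : ∀ p ∈ I.support, ∃ (U : X.affineOpens) (_ : p ∈ U.1) (ξ : ι → Γ(X, U.1)) (M : Set ι),
      IsCoordinates (constants s U.1) ξ ∧ I.ideal U = Ideal.span (ξ '' M)) :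
    Smooth (I.subschemeι ≫ s) := by
  rw [HasRingHomProperty.iff_exists_appLE (P := @Smooth) (Q := RingHom.Smooth)
    (RingHom.Smooth.stableUnderComposition.stableUnderCompositionWithLocalizationAway
      RingHom.Smooth.holdsForLocalizationAway).left]
  intro z
  obtain ⟨U, hz, ξ, M, hξ, hI⟩ := h (I.subschemeι z) (by
    rw [← SetLike.mem_coe, ← Scheme.IdealSheafData.range_subschemeι]; exact ⟨z, rfl⟩)
  refine ⟨⟨⊤, isAffineOpen_top _⟩, ⟨I.subschemeι ⁻¹ᵁ U.1, U.2.preimage _⟩, hz, le_preimage_top _ _, ?_⟩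
  have h1 : ((Ideal.Quotient.mk (I.ideal U)).comp (constants s U.1)).Smooth := by
    rw [hI]; exact hξ.smooth_quotient M
  have h2 : (I.subschemeι ≫ s).appLE ⊤ (I.subschemeι ⁻¹ᵁ U.1) (le_preimage_top _ _) =
      (Scheme.ΓSpecIso (CommRingCat.of k)).hom ≫ CommRingCat.ofHom (constants s U.1) ≫
        CommRingCat.ofHom (Ideal.Quotient.mk (I.ideal U)) ≫ (I.subschemeObjIso U).inv := by
    rw [← Scheme.Hom.appLE_comp_appLE I.subschemeι s ⊤ U.1 _ (le_preimage_top s U.1) le_rfl,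
      ← Scheme.IdealSheafData.subschemeι_app, Scheme.Hom.app_eq_appLE, ← Category.assoc]
    congr 1
    exact (Iso.hom_inv_id_assoc (Scheme.ΓSpecIso (CommRingCat.of k))
      (s.appLE ⊤ U.1 (le_preimage_top s U.1))).symm
  rw [h2]
  exact RingHom.Smooth.respectsIso.1 (e := (I.subschemeObjIso U).symm.commRingCatIsoToRingEquiv)
    _ (RingHom.Smooth.respectsIso.2 _ (Scheme.ΓSpecIso
      (CommRingCat.of k)).commRingCatIsoToRingEquiv h1)

end OverField

end MonomialResolution

end

noncomputable section

namespace MonomialResolution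

/-! ### Blowups of coordinate subspaces -/

section CoordinateBlowup

variable {k : Type u} [Field k] {X X' : Scheme.{u}} {s : X ⟶ Spec (CommRingCat.of k)}
  {π : X' ⟶ X} {I : X.IdealSheafData} {d : ℕ}

lemma IsCoordinates.exists_blowupAlgebra' {A : Type u} {ι : Type} [CommRing A] {c : k →+* A}
    {x : ι → A} (h : IsCoordinates c x) (M : Set ι) (i : ι) (hi : i ∈ M) {J : Ideal A}
    (hJ : J = Ideal.span (x '' M)) :
    ∃ y : ι → blowupAlgebra J (x i),
      IsCoordinates ((algebraMap A _).comp c) y ∧ y i = algebraMap A _ (x i) ∧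
      (∀ j ∈ M, j ≠ i → algebraMap A _ (x j) = algebraMap A _ (x i) * y j) ∧
      ∀ j ∉ M, y j = algebraMap A _ (x j) := by
  subst hJ
  exact h.exists_blowupAlgebra M i hi

namespace IsBlowup

variable (h : IsBlowup π I)

include h in
lemma exists_ringEquiv_chart (c : BlowupChart I) :
    ∃ (V : X'.affineOpens) (e : V.1 ≤ π ⁻¹ᵁ c.U.1) (ρ : c.ring ≃+* Γ(X', V.1)),
      (V.1 : Set X') = Set.range (h.chart c) ∧
      (ρ : c.ring →+* Γ(X', V.1)).comp c.ringMap.hom = (π.appLE c.U.1 V.1 e).hom := by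
  let f := h.chart c
  have hV : IsAffineOpen (f ''ᵁ ⊤) := (isAffineOpen_top c.V).image_of_isOpenImmersion f
  have e : f ''ᵁ ⊤ ≤ π ⁻¹ᵁ c.U.1 := by
    rintro _ ⟨v, -, rfl⟩
    change π (h.chart c v) ∈ c.U.1
    rw [← Scheme.Hom.comp_apply, chart_π]
    exact c.le_preimage (x := v) trivial
  let ρ := (Scheme.ΓSpecIso c.ring).symm ≪≫ (f.appIso ⊤).symm
  refine ⟨⟨_, hV⟩, e, ρ.commRingCatIsoToRingEquiv, ?_, ?_⟩
  · ext q
    simp [f]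
  · change (c.ringMap ≫ ρ.hom).hom = _
    congr 1
    have e' : ⊤ ≤ (f ≫ π) ⁻¹ᵁ c.U.1 := fun t _ => e ⟨t, trivial, rfl⟩
    have h1 : π.appLE c.U.1 (f ''ᵁ ⊤) e ≫ (f.appIso ⊤).hom = (f ≫ π).appLE c.U.1 ⊤ e' := by
      rw [Scheme.Hom.appIso_hom', Scheme.Hom.appLE_comp_appLE]
    have h2 : (f ≫ π).appLE c.U.1 ⊤ e' = c.ringMap ≫ (Scheme.ΓSpecIso c.ring).inv := by
      rw [← c.appLE_π c.le_preimage]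
      have : f ≫ π = c.π := h.chart_π c
      simp only [this]
    rw [h2] at h1
    rw [← Iso.eq_comp_inv] at h1
    rw [h1, Category.assoc]
    rfl

include h in
lemma exists_ringEquiv_blowupAlgebra (U : X.affineOpens) (a : Γ(X, U.1)) (ha : a ∈ I.ideal U) :
    ∃ (V : X'.affineOpens) (e : V.1 ≤ π ⁻¹ᵁ U.1) (ρ : blowupAlgebra (I.ideal U) a ≃+* Γ(X', V.1)),
      (V.1 : Set X') = Set.range (h.chart ⟨U, a, ha⟩) ∧
      ∀ f, ρ (algebraMap _ _ f) = π.appLE U.1 V.1 e f := by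
  obtain ⟨V, e, ρ, hV, hρ⟩ := h.exists_ringEquiv_chart ⟨U, a, ha⟩
  exact ⟨V, e, ρ, hV, fun f => RingHom.congr_fun hρ f⟩

lemma isCoordinates_ringEquiv {U : X.affineOpens} {V : X'.affineOpens} (e : V.1 ≤ π ⁻¹ᵁ U.1)
    {C : Type u} [CommRing C] {τ : Γ(X, U.1) →+* C} (ρ : C ≃+* Γ(X', V.1))
    (hρ : ∀ f, ρ (τ f) = π.appLE U.1 V.1 e f) {y : Fin d → C}
    (hy : IsCoordinates (τ.comp (constants s U.1)) y) :
    IsCoordinates (constants (π ≫ s) V.1) fun j => ρ (y j) := by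
  have := hy.comp (ρ : C →+* Γ(X', V.1)) (RingHom.Etale.of_bijective ρ.bijective)
  rw [← RingHom.comp_assoc] at this
  have h4 : ((ρ : C →+* Γ(X', V.1)).comp τ) = (π.appLE U.1 V.1 e).hom := RingHom.ext hρ
  rw [h4, constants_comp] at this
  exact this

include h in
theorem exists_isCoordinates_chart {U : X.affineOpens} {ξ : Fin d → Γ(X, U.1)}
    (hξ : IsCoordinates (constants s U.1) ξ) (M : Set (Fin d))
    (hI : I.ideal U = Ideal.span (ξ '' M)) {q : X'} (hq : π q ∈ U.1) :
    ∃ i ∈ M, ∃ (V : X'.affineOpens) (_ : q ∈ V.1) (e : V.1 ≤ π ⁻¹ᵁ U.1)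
      (η : Fin d → Γ(X', V.1)), IsCoordinates (constants (π ≫ s) V.1) η ∧
        η i = π.appLE U.1 V.1 e (ξ i) ∧
        (∀ j ∈ M, j ≠ i → π.appLE U.1 V.1 e (ξ j) = π.appLE U.1 V.1 e (ξ i) * η j) ∧
        ∀ j ∉ M, η j = π.appLE U.1 V.1 e (ξ j) := by
  obtain ⟨a, ⟨i, hi, rfl⟩, hqa⟩ := h.exists_mem_range_chart q U hq _ hI
  obtain ⟨y, hy, h1, h2, h3⟩ := hξ.exists_blowupAlgebra' M i hi hI
  obtain ⟨V, e, ρ, hV, hρ⟩ := h.exists_ringEquiv_blowupAlgebra U (ξ i)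
    (hI ▸ Ideal.subset_span ⟨i, hi, rfl⟩)
  refine ⟨i, hi, V, ?_, e, fun j => ρ (y j), isCoordinates_ringEquiv e ρ hρ hy, ?_, ?_, ?_⟩
  · rw [← SetLike.mem_coe, hV]; exact hqa
  · exact (congrArg ρ h1).trans (hρ _)
  · intro j hj hji
    exact (hρ _).symm.trans ((congrArg ρ (h2 j hj hji)).trans
      ((map_mul ρ _ _).trans (congrArg (· * ρ (y j)) (hρ _))))
  · intro j hj
    exact (congrArg ρ (h3 j hj)).trans (hρ _)

include h in
lemma exists_isCoordinates_of_notMem [IsLocallyNoetherian X] {U : X.affineOpens}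
    {ξ : Fin d → Γ(X, U.1)} (hξ : IsCoordinates (constants s U.1) ξ) {q : X'} (hq : π q ∈ U.1)
    (hqI : π q ∉ I.support) :
    ∃ (V : X'.affineOpens) (_ : q ∈ V.1) (η : Fin d → Γ(X', V.1)),
      IsCoordinates (constants (π ≫ s) V.1) η := by
  obtain ⟨f, hf, hfI⟩ := exists_basicOpen_ideal_eq I U hq ⊤ (by
    rw [(stalkIdeal_eq_top_iff I _).mpr hqI, Ideal.map_top])
  let U' : X.affineOpens := ⟨X.basicOpen f, U.2.basicOpen f⟩
  have hUU : U'.1 ≤ U.1 := X.basicOpen_le f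
  have hξ := hξ.res f (V := U') rfl hUU
  have hU' : I.ideal U' = ⊤ := (hfI U' hUU le_rfl).trans (Ideal.map_top _)
  obtain ⟨V, e, ρ, hV, hρ⟩ := h.exists_ringEquiv_blowupAlgebra U' 1 (hU' ▸ trivial)
  refine ⟨V, ?_, _, isCoordinates_ringEquiv e ρ hρ (hξ.comp (algebraMap _ _)
    (RingHom.Etale.of_bijective (bijective_algebraMap_of_isUnit _)))⟩
  rw [← SetLike.mem_coe, hV]
  exact (h.mem_range_chart_iff _ q).mpr (generatesAt_trivialChart U' hU' hf)

end IsBlowup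

/-- The description of a blowup of a coordinate subspace in terms of regular systems of parameters
`x` at a closed point and `y` at a closed point above it. The element `e` generates the exceptional
ideal. -/
structure BlowupLocalForm {O O' : Type*} [CommRing O] [CommRing O'] [IsLocalRing O']
    (φ : O →+* O') (x : Fin d → O) (M : Set (Fin d)) (i : Fin d) (y t : Fin d → O') : Prop where
  regular : RegularSystem y
  mem : i ∈ M
  map_mem : ∀ j ∈ M, φ (x j) = y i * t j
  map_notMem : ∀ j ∉ M, φ (x j) = t j
  eq_one : t i = 1
  eq_or : ∀ j, t j = y j ∨ IsUnit (t j)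

variable [IsAlgClosed k]

/-- At a closed point of a smooth scheme of dimension `d` every system of `d` generators of the maximal
ideal is regular. -/
lemma regularSystem_of_span_eq (s : X ⟶ Spec (CommRingCat.of k)) [IsLocallyNoetherian X]
    [SmoothOfRelativeDimension d s] {p : X} (hp : IsClosed ({p} : Set X))
    {x : Fin d → X.presheaf.stalk p}
    (hx : Ideal.span (Set.range x) = IsLocalRing.maximalIdeal (X.presheaf.stalk p)) :
    RegularSystem x := by
  have := SmoothOfRelativeDimension.smooth d s
  obtain ⟨U, hU, ξ, hξ, e⟩ := exists_isCoordinates s hp hx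
  have := hξ.regularSystem_germ hU hp (fun i => by
    rw [e, ← hx]; exact Ideal.subset_span ⟨i, rfl⟩)
  convert this
  exact (e _).symm

lemma exists_isCoordinates_ideal_eq [IsLocallyNoetherian X] [SmoothOfRelativeDimension d s] {p : X}
    (hp : IsClosed ({p} : Set X)) {x : Fin d → X.presheaf.stalk p}
    (hx : Ideal.span (Set.range x) = IsLocalRing.maximalIdeal (X.presheaf.stalk p))
    {M : Set (Fin d)} (hM : stalkIdeal I p = Ideal.span (x '' M)) :
    ∃ (U : X.affineOpens) (hU : p ∈ U.1) (ξ : Fin d → Γ(X, U.1)),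
      IsCoordinates (constants s U.1) ξ ∧ (∀ i, X.presheaf.germ U.1 p hU (ξ i) = x i) ∧
      I.ideal U = Ideal.span (ξ '' M) := by
  obtain ⟨U₀, hU₀, ξ₀, hξ₀, hx₀⟩ := exists_isCoordinates s hp hx
  obtain ⟨f, hf, hfI⟩ := exists_basicOpen_ideal_eq I U₀ hU₀ (Ideal.span (ξ₀ '' M)) (by
    rw [hM, Ideal.map_span, ← Set.image_comp]
    congr 1
    exact Set.image_congr fun j _ => (hx₀ j).symm)
  have hUU : X.basicOpen f ≤ U₀.1 := X.basicOpen_le f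
  refine ⟨⟨X.basicOpen f, U₀.2.basicOpen f⟩, hf, _,
    hξ₀.res f (V := ⟨X.basicOpen f, U₀.2.basicOpen f⟩) rfl hUU, fun j =>
    (X.presheaf.germ_res_apply (homOfLE hUU) p hf (ξ₀ j)).trans (hx₀ j), ?_⟩
  rw [hfI _ hUU le_rfl, Ideal.map_span, ← Set.image_comp]
  rfl

theorem IsBlowup.smoothOfRelativeDimension [IsLocallyNoetherian X] [JacobsonSpace X]
    [SmoothOfRelativeDimension d s] (h : IsBlowup π I)
    (hI : ∀ p : X, IsClosed ({p} : Set X) → ∃ x : Fin d → X.presheaf.stalk p,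
      Ideal.span (Set.range x) = IsLocalRing.maximalIdeal (X.presheaf.stalk p) ∧
      (p ∈ I.support → ∃ M : Set (Fin d), stalkIdeal I p = Ideal.span (x '' M))) :
    SmoothOfRelativeDimension d (π ≫ s) := by
  refine smoothOfRelativeDimension_of_forall _ fun q => ?_
  obtain ⟨p, hp, hqp, -⟩ := exists_isClosed_mem_of_specializes (π q) ⊤ trivial
  obtain ⟨x, hx, hM⟩ := hI p hp
  by_cases hpI : p ∈ I.support
  · obtain ⟨M, hM⟩ := hM hpI
    obtain ⟨U, hU, ξ, hξ, -, hIU⟩ := exists_isCoordinates_ideal_eq (s := s) hp hx hM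
    obtain ⟨i, -, V, hV, -, η, hη, -⟩ := h.exists_isCoordinates_chart hξ M hIU
      (hqp.mem_open U.1.2 hU)
    exact ⟨V, hV, η, hη⟩
  · obtain ⟨U, hU, ξ, hξ, -⟩ := exists_isCoordinates s hp hx
    have hq : π q ∉ I.support := fun hq => hpI (hqp.mem_closed I.support.isClosed hq)
    obtain ⟨V, hV, η, hη⟩ := h.exists_isCoordinates_of_notMem hξ (hqp.mem_open U.1.2 hU) hq
    exact ⟨V, hV, η, hη⟩

/-- Closed subsets given by coordinates at their closed points are smooth. -/
theorem smooth_subscheme_of_stalkIdeal (s : X ⟶ Spec (CommRingCat.of k)) [IsLocallyNoetherian X]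
    [JacobsonSpace X] [SmoothOfRelativeDimension d s] (I : X.IdealSheafData)
    (hI : ∀ p : X, IsClosed ({p} : Set X) → p ∈ I.support → ∃ x : Fin d → X.presheaf.stalk p,
      Ideal.span (Set.range x) = IsLocalRing.maximalIdeal (X.presheaf.stalk p) ∧
      ∃ M : Set (Fin d), stalkIdeal I p = Ideal.span (x '' M)) :
    Smooth (I.subschemeι ≫ s) := by
  refine smooth_subscheme s I (ι := Fin d) fun z hz => ?_
  obtain ⟨p, ⟨hpz, hpI⟩, hp⟩ := nonempty_inter_closedPoints (Z := closure {z} ∩ I.support)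
    ⟨z, subset_closure rfl, hz⟩ (isClosed_closure.inter I.support.isClosed).isLocallyClosed
  obtain ⟨x, hx, M, hM⟩ := hI p hp hpI
  obtain ⟨U, hU, ξ, hξ, -, hIU⟩ := exists_isCoordinates_ideal_eq (s := s) hp hx hM
  exact ⟨U, (specializes_iff_mem_closure.mpr hpz).mem_open U.1.2 hU, ξ, M, hξ, hIU⟩

theorem IsBlowup.exists_localForm [IsLocallyNoetherian X] [IsLocallyNoetherian X']
    [LocallyOfFiniteType (π ≫ s)]
    [SmoothOfRelativeDimension d s] (h : IsBlowup π I) {q : X'}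
    (hq : IsClosed ({q} : Set X')) (hp : IsClosed ({π q} : Set X))
    {x : Fin d → X.presheaf.stalk (π q)}
    (hx : Ideal.span (Set.range x) = IsLocalRing.maximalIdeal (X.presheaf.stalk (π q)))
    {M : Set (Fin d)} (hM : stalkIdeal I (π q) = Ideal.span (x '' M)) :
    ∃ (i : Fin d) (y t : Fin d → X'.presheaf.stalk q),
      BlowupLocalForm (π.stalkMap q).hom x M i y t := by
  obtain ⟨U, hf, ξ, hξ, hξx, hIU⟩ := exists_isCoordinates_ideal_eq (s := s) hp hx hM
  obtain ⟨i, hi, V, hqV, e, η, hη, h1, h2, h3⟩ := h.exists_isCoordinates_chart hξ M hIU hf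
  have hφ : ∀ a, X'.presheaf.germ V.1 q hqV (π.appLE U.1 V.1 e a) =
      π.stalkMap q (X.presheaf.germ U.1 (π q) hf a) := fun a => germ_appLE π e q hqV a
  have hxm : ∀ j, π.stalkMap q (x j) ∈ IsLocalRing.maximalIdeal (X'.presheaf.stalk q) := by
    intro j
    have : x j ∈ IsLocalRing.maximalIdeal (X.presheaf.stalk (π q)) := hx ▸ Ideal.subset_span ⟨j, rfl⟩
    exact (IsLocalRing.mem_maximalIdeal _).mpr fun hu => (IsLocalRing.mem_maximalIdeal _).mp this
      (isUnit_of_map_unit (π.stalkMap q).hom _ hu)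
  choose a ha using fun j => exists_sub_constants_mem (s := π ≫ s) V hqV hq
    (X'.presheaf.germ V.1 q hqV (η j))
  have hmem : ∀ c : k, X'.presheaf.germ V.1 q hqV (constants (π ≫ s) V.1 c) ∈
      IsLocalRing.maximalIdeal (X'.presheaf.stalk q) → c = 0 := by
    intro c hc
    by_contra h0
    exact (IsLocalRing.mem_maximalIdeal _).mp hc (((isUnit_iff_ne_zero.mpr h0).map (constants (π ≫ s) V.1)).map
      (X'.presheaf.germ V.1 q hqV).hom)
  have ha0 : ∀ j, X'.presheaf.germ V.1 q hqV (η j) ∈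
      IsLocalRing.maximalIdeal (X'.presheaf.stalk q) → a j = 0 := by
    intro j hj
    refine hmem _ ?_
    simpa using sub_mem hj (ha j)
  have hη' := (hη.sub_const a).regularSystem_germ hqV hq (fun j => by rw [map_sub]; exact ha j)
  have hai : a i = 0 := ha0 i (by rw [h1, hφ, hξx]; exact hxm i)
  refine ⟨i, _, fun j => if j = i then 1 else X'.presheaf.germ V.1 q hqV (η j), hη', hi, ?_, ?_, ?_,
    ?_⟩
  · intro j hj
    rw [hai, map_zero, sub_zero, h1]
    by_cases hji : j = i
    · subst hji
      simp [hφ, hξx]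
    · rw [if_neg hji, ← map_mul, ← h2 j hj hji, hφ, hξx]
  · intro j hj
    rw [if_neg (by rintro rfl; exact hj hi), h3 j hj, hφ, hξx]
  · simp
  · intro j
    by_cases hji : j = i
    · subst hji; right; simp
    · rw [if_neg hji]
      by_cases h0 : a j = 0
      · left; rw [h0, map_zero, sub_zero]
      · right
        by_contra hu
        exact h0 (ha0 j ((IsLocalRing.mem_maximalIdeal _).mpr hu))

end CoordinateBlowup

end MonomialResolution

end

noncomputable section

namespace MonomialResolution

/-! ### Monomial ideals in regular systems of parameters -/

section Order

variable {X : Scheme.{u}}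

lemma le_order_iff (J : X.IdealSheafData) (p : X) (n : ℕ) :
    (n : ℕ∞) ≤ order J p ↔ stalkIdeal J p ≤ IsLocalRing.maximalIdeal (X.presheaf.stalk p) ^ n := by
  constructor
  · intro h
    by_contra hn
    have h1 : order J p ≤ ((n - 1 : ℕ) : ℕ∞) := by
      refine iSup₂_le fun m hm => ?_
      rw [Nat.cast_le]
      by_contra hmn
      exact hn (le_trans hm (Ideal.pow_le_pow_right (by omega)))
    have h2 := Nat.cast_le.mp (h.trans h1)
    have : n = 0 := by omega
    subst this
    exact hn (by simp)
  · intro h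
    exact le_iSup₂ (f := fun (n : ℕ) (_ : n ∈ {n : ℕ | stalkIdeal J p ≤
      IsLocalRing.maximalIdeal (X.presheaf.stalk p) ^ n}) => (n : ℕ∞)) n h

lemma order_eq_of_forall {J : X.IdealSheafData} {p : X} {a : ℕ}
    (h : ∀ n, stalkIdeal J p ≤ IsLocalRing.maximalIdeal (X.presheaf.stalk p) ^ n ↔ n ≤ a) :
    order J p = a :=
  ENat.eq_of_forall_natCast_le_iff fun n => by rw [le_order_iff, h, Nat.cast_le]

variable {ι : Type*} [Fintype ι] {p : X} {x : ι → X.presheaf.stalk p} {J : X.IdealSheafData}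
  {a : ι → ℕ}

lemma RegularSystem.order_eq (hx : RegularSystem x)
    (hJ : stalkIdeal J p = Ideal.span {∏ i, x i ^ a i}) : order J p = (∑ i, a i : ℕ) := by
  refine order_eq_of_forall fun n => ?_
  rw [hJ, Ideal.span_singleton_le_iff_mem]
  refine ⟨fun h => ?_, fun h => ?_⟩
  · by_contra hn
    exact hx.prod_notMem a (Ideal.pow_le_pow_right (by omega) h)
  · refine Ideal.pow_le_pow_right h ?_
    rw [← Finset.prod_pow_eq_pow_sum]
    refine Ideal.prod_mem_prod fun i _ => Ideal.pow_mem_pow ?_ _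
    rw [← hx.span_eq]
    exact Ideal.subset_span ⟨i, rfl⟩

lemma RegularSystem.isDomain {O : Type*} [CommRing O] [IsLocalRing O] {x : ι → O}
    (hx : RegularSystem x) : IsDomain O := by
  have := hx.isPrime ∅
  rw [Set.image_empty, Ideal.span_empty] at this
  exact IsDomain.of_bot_isPrime O

lemma RegularSystem.ne_zero {O : Type*} [CommRing O] [IsLocalRing O] {x : ι → O}
    (hx : RegularSystem x) (i : ι) : x i ≠ 0 := by
  have := hx.notMem ∅ i (by simp)
  rwa [Set.image_empty, Ideal.span_empty, Ideal.mem_bot] at this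

lemma RegularSystem.isPrime_singleton {O : Type*} [CommRing O] [IsLocalRing O] {x : ι → O}
    (hx : RegularSystem x) (i : ι) : (Ideal.span {x i}).IsPrime := by
  have := hx.isPrime {i}
  rwa [Set.image_singleton] at this

lemma RegularSystem.notMem_singleton {O : Type*} [CommRing O] [IsLocalRing O] {x : ι → O}
    (hx : RegularSystem x) {i j : ι} (h : j ≠ i) : x j ∉ Ideal.span {x i} := by
  have := hx.notMem {i} j (by simpa using h)
  rwa [Set.image_singleton] at this

lemma RegularSystem.order_eq_of_specializes (hx : RegularSystem x)
    (hJ : stalkIdeal J p = Ideal.span {∏ i, x i ^ a i}) {z : X} (h : z ⤳ p) (i : ι)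
    (hz : primeOf h = Ideal.span {x i}) : order J z = a i := by
  classical
  let := (X.presheaf.stalkSpecializes h).hom.toAlgebra
  have hloc := isLocalization_stalkSpecializes h
  have hdom := hx.isDomain
  let φ := (X.presheaf.stalkSpecializes h).hom
  have hinj : Function.Injective φ :=
    IsLocalization.injective (X.presheaf.stalk z) (primeOf h).primeCompl_le_nonZeroDivisors
  have hdom' : IsDomain (X.presheaf.stalk z) :=
    IsLocalization.isDomain_of_atPrime (X.presheaf.stalk z) (primeOf h)
  have hm : IsLocalRing.maximalIdeal (X.presheaf.stalk z) = Ideal.span {φ (x i)} := by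
    rw [← IsLocalization.AtPrime.map_eq_maximalIdeal (primeOf h) (X.presheaf.stalk z), hz,
      Ideal.map_span, Set.image_singleton]
    rfl
  have hu : IsUnit (φ (∏ j ∈ Finset.univ.erase i, x j ^ a j)) := by
    have : ∏ j ∈ Finset.univ.erase i, x j ^ a j ∈ (primeOf h).primeCompl := by
      refine Submonoid.prod_mem _ fun j hj => Submonoid.pow_mem _ ?_ _
      change x j ∉ primeOf h
      rw [hz]
      exact hx.notMem_singleton (Finset.ne_of_mem_erase hj)
    exact IsLocalization.map_units (X.presheaf.stalk z) (⟨_, this⟩ : (primeOf h).primeCompl)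
  have hJz : stalkIdeal J z = Ideal.span {φ (x i) ^ a i} := by
    rw [stalkIdeal_specializes J h, hJ, Ideal.map_span, Set.image_singleton,
      ← Finset.mul_prod_erase _ _ (Finset.mem_univ i), map_mul, map_pow,
      Ideal.span_singleton_mul_right_unit hu]
  refine order_eq_of_forall fun n => ?_
  rw [hJz, hm, Ideal.span_singleton_pow, Ideal.span_singleton_le_span_singleton]
  refine pow_dvd_pow_iff ?_ ?_
  · exact (map_ne_zero_iff φ hinj).mpr (hx.ne_zero i)
  · rw [← mem_nonunits_iff, ← IsLocalRing.mem_maximalIdeal, hm]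
    exact Ideal.mem_span_singleton_self _

end Order

namespace BasicObject

variable {k : Type u} [Field k] {d : ℕ} (B : BasicObject k d)

instance : IsIntegral B.W := B.isIntegral
instance : IsSeparated B.toSpec := B.isSeparated
instance : QuasiCompact B.toSpec := B.quasiCompact
instance : SmoothOfRelativeDimension d B.toSpec := B.smooth
instance : Smooth B.toSpec := SmoothOfRelativeDimension.smooth d B.toSpec
instance : IsLocallyNoetherian B.W := LocallyOfFiniteType.isLocallyNoetherian B.toSpec
instance : JacobsonSpace B.W := LocallyOfFiniteType.jacobsonSpace B.toSpec
instance : CompactSpace B.W := QuasiCompact.compactSpace_of_compactSpace B.toSpec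
instance : IsNoetherian B.W where

lemma regularSystem [IsAlgClosed k] {p : B.W} (hp : IsClosed ({p} : Set B.W))
    {x : Fin d → B.W.presheaf.stalk p}
    (hx : Ideal.span (Set.range x) = IsLocalRing.maximalIdeal (B.W.presheaf.stalk p)) :
    RegularSystem x :=
  regularSystem_of_span_eq B.toSpec hp hx

lemma components_finite : B.components.Finite := by
  have : B.components = ⋃ H ∈ {H | H ∈ B.E}, H := by
    ext C; simp [components]
  rw [this]
  exact B.E.finite_toSet.biUnion B.finite

@[to_additive]
lemma list_prod_eq_finprod {α M : Type*} [CommMonoid M] (g : α → M) (E : List (Set α))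
    (hE : ∀ H ∈ E, H.Finite) (hd : E.Pairwise Disjoint) :
    (E.map fun H => ∏ᶠ (C : α) (_ : C ∈ H), g C).prod = ∏ᶠ (C : α) (_ : ∃ H ∈ E, C ∈ H), g C := by
  induction E with
  | nil => simp
  | cons H E ih =>
    rw [List.map_cons, List.prod_cons, ih (fun H hH => hE H (List.mem_cons_of_mem _ hH))
      (List.pairwise_cons.mp hd).2]
    have h1 : {C | ∃ H ∈ E, C ∈ H}.Finite := by
      have : {C | ∃ H ∈ E, C ∈ H} = ⋃ H ∈ {H | H ∈ E}, H := by ext C; simp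
      rw [this]
      exact E.finite_toSet.biUnion fun H hH => hE H (List.mem_cons_of_mem _ hH)
    have h2 : Disjoint H {C | ∃ H ∈ E, C ∈ H} := by
      rw [Set.disjoint_left]
      rintro C hC ⟨H', hH', hC'⟩
      exact Set.disjoint_left.mp ((List.pairwise_cons.mp hd).1 H' hH') hC hC'
    have := finprod_mem_union (f := g) h2 (hE H List.mem_cons_self) h1
    refine Eq.trans this.symm ?_
    congr 1
    ext C
    simp

lemma prod_eq_finprod {M : Type*} [CommMonoid M] (g : IrreducibleCloseds B.W → M) :
    (B.E.map fun H => ∏ᶠ (C : IrreducibleCloseds B.W) (_ : C ∈ H), g C).prod =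
      ∏ᶠ (C : IrreducibleCloseds B.W) (_ : C ∈ B.components), g C :=
  list_prod_eq_finprod g B.E B.finite B.no_common_component

/-- The boundary components through a point. -/
abbrev Comp (p : B.W) := {C : IrreducibleCloseds B.W // C ∈ B.components ∧ p ∈ C}

instance (p : B.W) : Finite (B.Comp p) := (B.components_finite.subset fun _ h => h.1).to_subtype

instance (p : B.W) : Fintype (B.Comp p) := Fintype.ofFinite _

lemma stalkIdeal_idealOf_eq_top {X : Scheme.{u}} {C : IrreducibleCloseds X} {p : X} (h : p ∉ C) :
    stalkIdeal (idealOf (toCloseds C)) p = ⊤ := by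
  rw [stalkIdeal_eq_top_iff, mem_support_idealOf]
  exact h

lemma stalkIdeal_finprod {X : Scheme.{u}} {α : Type*} {T : Set α} (hT : T.Finite)
    (g : α → X.IdealSheafData) (p : X) :
    stalkIdeal (∏ᶠ (C : α) (_ : C ∈ T), g C) p = ∏ᶠ (C : α) (_ : C ∈ T), stalkIdeal (g C) p :=
  (stalkIdealHom p).map_finprod_mem g hT

lemma finprod_components_eq {M : Type*} [CommMonoid M] (p : B.W)
    (g : IrreducibleCloseds B.W → M) (hg : ∀ C, p ∉ C → g C = 1) :
    ∏ᶠ (C : IrreducibleCloseds B.W) (_ : C ∈ B.components), g C = ∏ C : B.Comp p, g C := by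
  rw [← finprod_eq_prod_of_fintype]
  have h1 := finprod_subtype_eq_finprod_cond (f := g) fun C => C ∈ B.components ∧ p ∈ C
  refine Eq.trans ?_ h1.symm
  refine finprod_congr fun C => ?_
  by_cases hC : p ∈ C
  · simp [hC]
  · simp [hC, hg C hC]

/-- At a closed point there is a regular system of parameters adapted to the boundary. -/
lemma exists_adapted [IsAlgClosed k] {p : B.W} (hp : IsClosed ({p} : Set B.W)) :
    ∃ x : Fin d → B.W.presheaf.stalk p, RegularSystem x ∧ ∃ σ : B.Comp p → Fin d,
      Function.Injective σ ∧
      ∀ C : B.Comp p, stalkIdeal (idealOf (toCloseds C.1)) p = Ideal.span {x (σ C)} := by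
  obtain ⟨x, hx, σ, hσ, h⟩ := B.snc p hp
  exact ⟨x, B.regularSystem hp hx, σ, hσ, h⟩

variable {B}

lemma stalkIdeal_monomial {p : B.W} {x : B.Comp p → B.W.presheaf.stalk p}
    (hx : ∀ C : B.Comp p, stalkIdeal (idealOf (toCloseds C.1)) p = Ideal.span {x C})
    {a : IrreducibleCloseds B.W → ℕ}
    (hJ : B.J = ∏ᶠ (C : IrreducibleCloseds B.W) (_ : C ∈ B.components),
      idealOf (toCloseds C) ^ a C) :
    stalkIdeal B.J p = Ideal.span {∏ C : B.Comp p, x C ^ a C.1} := by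
  rw [hJ, stalkIdeal_finprod B.components_finite]
  simp only [stalkIdeal_pow]
  rw [B.finprod_components_eq p (fun C => stalkIdeal (idealOf (toCloseds C)) p ^ a C)
    (fun C hC => by rw [stalkIdeal_idealOf_eq_top hC, ← Ideal.one_eq_top, one_pow])]
  simp only [hx, Ideal.span_singleton_pow]
  exact Ideal.prod_span_singleton _ _

lemma prod_comp_eq {R : Type*} [CommMonoid R] {p : B.W} (x : Fin d → R) (σ : B.Comp p → Fin d)
    (a : IrreducibleCloseds B.W → ℕ) :
    ∏ C : B.Comp p, x (σ C) ^ a C.1 = ∏ i, x i ^ (∑ C with σ C = i, a C.1) := by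
  rw [← Finset.prod_fiberwise Finset.univ σ]
  refine Finset.prod_congr rfl fun i _ => ?_
  rw [← Finset.prod_pow_eq_pow_sum]
  refine Finset.prod_congr rfl fun C hC => ?_
  rw [(Finset.mem_filter.mp hC).2]

lemma genericPoint_specializes {X : Scheme.{u}} {C : IrreducibleCloseds X} {p : X} (h : p ∈ C) :
    C.isIrreducible.genericPoint ⤳ p := by
  rw [specializes_iff_mem_closure]
  rw [C.isIrreducible.closure_genericPoint C.isClosed]
  exact h

/-- The exponents of a monomial ideal are determined by the ideal. -/
theorem exponent_eq [IsAlgClosed k] {a : IrreducibleCloseds B.W → ℕ}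
    (hJ : B.J = ∏ᶠ (C : IrreducibleCloseds B.W) (_ : C ∈ B.components),
      idealOf (toCloseds C) ^ a C) {C : IrreducibleCloseds B.W} (hC : C ∈ B.components) :
    B.exponent C = a C := by
  obtain ⟨p, hpC, hp⟩ := nonempty_inter_closedPoints C.isIrreducible.nonempty
    C.isClosed.isLocallyClosed
  obtain ⟨x, hx, σ, hσ, hxσ⟩ := B.exists_adapted hp
  have h1 := stalkIdeal_monomial hxσ hJ
  rw [prod_comp_eq] at h1
  have h2 := hx.order_eq_of_specializes h1 (genericPoint_specializes hpC) (σ ⟨C, hC, hpC⟩) (by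
    rw [← hxσ, ← stalkIdeal_idealOf_eq_primeOf C]
    exact C.isIrreducible.closure_genericPoint C.isClosed)
  rw [exponent, orderAlong, h2, ENat.toNat_natCast]
  rw [Finset.sum_eq_single ⟨C, hC, hpC⟩]
  · intro C' hC' hne
    exact absurd (hσ (Finset.mem_filter.mp hC').2) hne
  · simp

theorem isMonomial_iff : B.IsMonomial ↔
    B.J = ∏ᶠ (C : IrreducibleCloseds B.W) (_ : C ∈ B.components),
      idealOf (toCloseds C) ^ B.exponent C := by
  rw [IsMonomial, B.prod_eq_finprod]

theorem isMonomial_of_eq [IsAlgClosed k] {a : IrreducibleCloseds B.W → ℕ}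
    (hJ : B.J = ∏ᶠ (C : IrreducibleCloseds B.W) (_ : C ∈ B.components),
      idealOf (toCloseds C) ^ a C) : B.IsMonomial := by
  rw [isMonomial_iff]
  refine hJ.trans (finprod_mem_congr rfl fun C hC => ?_)
  rw [exponent_eq hJ hC]

/-! #### The singular locus -/

lemma IsMonomial.order_eq [IsAlgClosed k] (hB : B.IsMonomial) {p : B.W} (hp : IsClosed ({p} : Set B.W)) :
    order B.J p = (∑ C : B.Comp p, B.exponent C.1 : ℕ) := by
  obtain ⟨x, hx, σ, hσ, hxσ⟩ := B.exists_adapted hp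
  have h1 := stalkIdeal_monomial hxσ (isMonomial_iff.mp hB)
  rw [prod_comp_eq] at h1
  rw [hx.order_eq h1, Finset.sum_fiberwise]

lemma IsMonomial.mem_sing_of_le (hB : B.IsMonomial) {p : B.W}
    (h : B.b ≤ ∑ C : B.Comp p, B.exponent C.1) : p ∈ B.Sing := by
  change (B.b : ℕ∞) ≤ order B.J p
  rw [le_order_iff]
  refine le_trans ?_ (Ideal.pow_le_pow_right h)
  rw [isMonomial_iff.mp hB, stalkIdeal_finprod B.components_finite]
  simp only [stalkIdeal_pow]
  rw [B.finprod_components_eq p (fun C => stalkIdeal (idealOf (toCloseds C)) p ^ B.exponent C)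
    (fun C hC => by rw [stalkIdeal_idealOf_eq_top hC, ← Ideal.one_eq_top, one_pow]),
    ← Finset.prod_pow_eq_pow_sum]
  refine Finset.prod_le_prod' fun C _ => Ideal.pow_right_mono ?_ _
  rw [← mem_support_iff_stalkIdeal_le, mem_support_idealOf]
  exact C.2.2

lemma exists_isClosed_mem_sing {p : B.W} (hp : p ∈ B.Sing) :
    ∃ q, IsClosed ({q} : Set B.W) ∧ q ∈ B.Sing ∧ p ⤳ q ∧ ∀ C ∈ B.components, q ∈ C ↔ p ∈ C := by
  let Z : Closeds B.W := ⟨closure {p}, isClosed_closure⟩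
  have h1 : stalkIdeal B.J p ≤ stalkIdeal (idealOf Z ^ B.b) p := by
    have h2 : stalkIdeal (idealOf Z) p = IsLocalRing.maximalIdeal (B.W.presheaf.stalk p) := by
      have := stalkIdeal_idealOf_eq_primeOf (X := B.W)
        ⟨closure {p}, isIrreducible_singleton.closure, isClosed_closure⟩ (specializes_refl p) rfl
      rwa [primeOf_refl] at this
    rw [stalkIdeal_pow, h2, ← le_order_iff]
    exact hp
  obtain ⟨N, hpN, hN⟩ := exists_open_stalkIdeal_le h1
  let F : Set B.W := ⋃ C ∈ {C ∈ B.components | p ∉ C}, (C : Set B.W)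
  have hF : IsClosed F := (B.components_finite.subset fun _ h => h.1).isClosed_biUnion
    fun C _ => C.isClosed
  obtain ⟨q, hq, hpq, hqN⟩ := exists_isClosed_mem_of_specializes p (N ⊓ ⟨Fᶜ, hF.isOpen_compl⟩)
    ⟨hpN, by simp [F]⟩
  refine ⟨q, hq, ?_, hpq, fun C hC => ⟨fun h => ?_, fun h => hpq.mem_closed C.isClosed h⟩⟩
  · change (B.b : ℕ∞) ≤ order B.J q
    rw [le_order_iff]
    refine (hN q hqN.1).trans ?_
    rw [stalkIdeal_pow]
    refine Ideal.pow_right_mono ?_ _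
    rw [← mem_support_iff_stalkIdeal_le, mem_support_idealOf]
    exact specializes_iff_mem_closure.mp hpq
  · by_contra hpC
    exact hqN.2 (Set.mem_biUnion (show C ∈ {C ∈ B.components | p ∉ C} from ⟨hC, hpC⟩) h)

lemma IsMonomial.mem_sing_iff [IsAlgClosed k] (hB : B.IsMonomial) {p : B.W} :
    p ∈ B.Sing ↔ B.b ≤ ∑ C : B.Comp p, B.exponent C.1 := by
  refine ⟨fun h => ?_, hB.mem_sing_of_le⟩
  obtain ⟨q, hq, hqS, -, hC⟩ := exists_isClosed_mem_sing h
  have h1 : (B.b : ℕ∞) ≤ order B.J q := hqS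
  rw [hB.order_eq hq, Nat.cast_le] at h1
  refine h1.trans_eq ?_
  refine Fintype.sum_equiv (Equiv.subtypeEquivRight fun C => ?_) _ _ fun C => rfl
  exact and_congr_right fun h => hC C h

end BasicObject

end MonomialResolution

end

noncomputable section

namespace MonomialResolution

namespace BasicObject

variable {k : Type u} [Field k] {d : ℕ} {B : BasicObject k d}

/-! ### The invariant -/

lemma get_mem_components {j : Fin B.E.length} {C : IrreducibleCloseds B.W} (h : C ∈ B.E.get j) :
    C ∈ B.components := ⟨_, B.E.get_mem j, h⟩

lemma index_unique {i j : Fin B.E.length} {C : IrreducibleCloseds B.W} (hi : C ∈ B.E.get i)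
    (hj : C ∈ B.E.get j) : i = j := by
  have h := List.pairwise_iff_get.mp B.no_common_component
  rcases lt_trichotomy i j with hij | hij | hij
  · exact (Set.disjoint_left.mp (h i j hij) hi hj).elim
  · exact hij
  · exact (Set.disjoint_left.mp (h j i hij) hj hi).elim

lemma component_unique {j : Fin B.E.length} {C C' : IrreducibleCloseds B.W} (hC : C ∈ B.E.get j)
    (hC' : C' ∈ B.E.get j) {p : B.W} (h : p ∈ C) (h' : p ∈ C') : C = C' := by
  by_contra hne
  exact Set.disjoint_left.mp (B.disjoint_components _ (B.E.get_mem j) hC hC' hne) h h'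

lemma exponentAt_eq {j : Fin B.E.length} {C : IrreducibleCloseds B.W} (hC : C ∈ B.E.get j)
    {p : B.W} (h : p ∈ C) : B.exponentAt j p = B.exponent C := by
  have h1 : {C' | C' ∈ B.E.get j ∧ p ∈ C'} = {C} := by
    ext C'
    exact ⟨fun h' => component_unique h'.1 hC h'.2 h, fun h' => by
      rw [Set.mem_singleton_iff.mp h']; exact ⟨hC, h⟩⟩
  have h2 := finsum_mem_singleton (f := B.exponent) (a := C)
  rw [← h1] at h2
  exact h2

lemma exponentAt_eq_zero {j : Fin B.E.length} {p : B.W} (h : ¬ B.Through j p) :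
    B.exponentAt j p = 0 := by
  have h1 : ∀ C, ¬ (C ∈ B.E.get j ∧ p ∈ C) := fun C hC => h ⟨C, hC⟩
  simp only [exponentAt, h1, finsum_false, finsum_zero]

lemma sum_exponentAt (p : B.W) :
    B.exponentSum p Finset.univ = ∑ C : B.Comp p, B.exponent C.1 := by
  classical
  let g : IrreducibleCloseds B.W → ℕ := fun C => if p ∈ C then B.exponent C else 0
  have h1 : ∀ j, B.exponentAt j p = ∑ᶠ (C : IrreducibleCloseds B.W) (_ : C ∈ B.E.get j), g C := by
    intro j
    refine finsum_congr fun C => ?_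
    by_cases hC : p ∈ C <;> simp [hC, g]
  have h2 := list_sum_eq_finsum g B.E B.finite B.no_common_component
  have h3 : B.exponentSum p Finset.univ = (B.E.map fun H =>
      ∑ᶠ (C : IrreducibleCloseds B.W) (_ : C ∈ H), g C).sum := by
    rw [exponentSum, Finset.sum_congr rfl fun j _ => h1 j, ← List.sum_ofFn]
    congr 1
    conv_rhs => rw [← List.ofFn_get B.E, List.map_ofFn]
    rfl
  have h4 := finsum_subtype_eq_finsum_cond (f := B.exponent) fun C => C ∈ B.components ∧ p ∈ C
  rw [h3, h2, ← finsum_eq_sum_of_fintype]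
  refine Eq.trans ?_ h4.symm
  refine finsum_congr fun C => ?_
  change (∑ᶠ (_ : C ∈ B.components), g C) = _
  by_cases hC : p ∈ C <;> simp [hC, g]

lemma mem_admissible {p : B.W} {S : Finset (Fin B.E.length)} :
    S ∈ B.admissible p ↔ (∀ j ∈ S, B.Through j p) ∧ B.b ≤ B.exponentSum p S := by
  simp [admissible]

lemma IsMonomial.mem_sing_of_mem_admissible [IsAlgClosed k] (hB : B.IsMonomial) {p : B.W}
    {S : Finset (Fin B.E.length)} (hS : S ∈ B.admissible p) : p ∈ B.Sing := by
  rw [hB.mem_sing_iff, ← sum_exponentAt]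
  exact (mem_admissible.mp hS).2.trans (Finset.sum_le_sum_of_subset (Finset.subset_univ S))

lemma IsMonomial.admissible_nonempty [IsAlgClosed k] (hB : B.IsMonomial) {p : B.W}
    (hp : p ∈ B.Sing) : (B.admissible p).Nonempty := by
  classical
  refine ⟨Finset.univ.filter fun j => B.Through j p, mem_admissible.mpr ⟨by simp, ?_⟩⟩
  rw [hB.mem_sing_iff, ← sum_exponentAt] at hp
  refine hp.trans_eq ?_
  rw [exponentSum, exponentSum, Finset.sum_filter]
  refine Finset.sum_congr rfl fun j _ => ?_
  split_ifs with h
  · rfl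
  · exact exponentAt_eq_zero h

variable (B) in
/-- The value which a set of indices contributes to `Γ`. -/
def value (p : B.W) (S : Finset (Fin B.E.length)) : ℤ ×ₗ ℚ ×ₗ Lex (Fin d → ℕ) :=
  toLex (-(S.card : ℤ), toLex ((B.exponentSum p S : ℚ) / B.b, indexTuple d S))

theorem isGreatest_Γ {p : B.W} (h : (B.admissible p).Nonempty) :
    IsGreatest (B.value p '' B.admissible p) (B.Γ p) := by
  have hn : {n | ∃ S ∈ B.admissible p, S.card = n}.Nonempty := by
    obtain ⟨S, hS⟩ := h
    exact ⟨_, S, hS, rfl⟩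
  have hb : (0 : ℚ) < B.b := Nat.cast_pos.mpr B.b_pos
  constructor
  · obtain ⟨S₁, hS₁, hc₁⟩ := Nat.sInf_mem hn
    have h1 : (B.minimalSets p).Nonempty := ⟨S₁, Finset.mem_filter.mpr ⟨hS₁, hc₁⟩⟩
    obtain ⟨S₂, hS₂, hc₂⟩ := Finset.exists_mem_eq_sup _ h1 (B.exponentSum p)
    have h2 : ((B.minimalSets p).filter fun S => B.exponentSum p S = B.bΓ₂ p).Nonempty :=
      ⟨S₂, Finset.mem_filter.mpr ⟨hS₂, hc₂.symm⟩⟩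
    obtain ⟨S, hS, hc⟩ := Finset.exists_mem_eq_sup _ h2 (indexTuple d)
    obtain ⟨hS, hc'⟩ := Finset.mem_filter.mp hS
    obtain ⟨hS, hc''⟩ := Finset.mem_filter.mp hS
    refine ⟨S, hS, ?_⟩
    rw [value, Γ, hc'', hc', Γ₃, hc]
  · rintro _ ⟨S, hS, rfl⟩
    have h1 : B.negΓ₁ p ≤ S.card := Nat.sInf_le ⟨S, hS, rfl⟩
    rw [value, Γ, Prod.Lex.toLex_le_toLex]
    rcases h1.lt_or_eq with h1 | h1
    · left; simpa using h1
    · right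
      have hS1 : S ∈ B.minimalSets p := Finset.mem_filter.mpr ⟨hS, h1.symm⟩
      refine ⟨by simp [h1], ?_⟩
      rw [Prod.Lex.toLex_le_toLex]
      have h2 : B.exponentSum p S ≤ B.bΓ₂ p := Finset.le_sup (f := B.exponentSum p) hS1
      rcases h2.lt_or_eq with h2 | h2
      · left
        exact (div_lt_div_iff_of_pos_right hb).mpr (Nat.cast_lt.mpr h2)
      · right
        refine ⟨by simp [h2], ?_⟩
        exact Finset.le_sup (f := indexTuple d) (Finset.mem_filter.mpr ⟨hS1, h2⟩)

lemma value_lt_iff {B' : BasicObject k d} (hb : B'.b = B.b) {p : B'.W} {q : B.W}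
    {S : Finset (Fin B'.E.length)} {T : Finset (Fin B.E.length)} :
    B'.value p S < B.value q T ↔ T.card < S.card ∨ S.card = T.card ∧
      (B'.exponentSum p S < B.exponentSum q T ∨ B'.exponentSum p S = B.exponentSum q T ∧
        indexTuple d S < indexTuple d T) := by
  have hb' : (0 : ℚ) < B.b := Nat.cast_pos.mpr B.b_pos
  rw [value, value, Prod.Lex.toLex_lt_toLex, Prod.Lex.toLex_lt_toLex, hb]
  simp only [neg_lt_neg_iff, Nat.cast_lt, neg_inj, Nat.cast_inj,
    div_lt_div_iff_of_pos_right hb', div_left_inj' hb'.ne']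

lemma value_eq_iff {p q : B.W} {S T : Finset (Fin B.E.length)} :
    B.value p S = B.value q T ↔ S.card = T.card ∧ B.exponentSum p S = B.exponentSum q T ∧
        indexTuple d S = indexTuple d T := by
  have hb : (0 : ℚ) < B.b := Nat.cast_pos.mpr B.b_pos
  rw [value, value, EmbeddingLike.apply_eq_iff_eq, Prod.mk.injEq, EmbeddingLike.apply_eq_iff_eq,
    Prod.mk.injEq]
  simp only [neg_inj, Nat.cast_inj, div_left_inj' hb.ne']

lemma through_congr {p q : B.W} (h : ∀ C ∈ B.components, p ∈ C ↔ q ∈ C) (j : Fin B.E.length) :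
    B.Through j p ↔ B.Through j q :=
  exists_congr fun C => and_congr_right fun hC => h C (get_mem_components hC)

lemma exponentAt_congr {p q : B.W} (h : ∀ C ∈ B.components, p ∈ C ↔ q ∈ C)
    (j : Fin B.E.length) : B.exponentAt j p = B.exponentAt j q := by
  have : ∀ C, (C ∈ B.E.get j ∧ p ∈ C) = (C ∈ B.E.get j ∧ q ∈ C) := fun C =>
    propext (and_congr_right fun hC => h C (get_mem_components hC))
  simp only [exponentAt, this]

lemma Γ_congr {p q : B.W} (h : ∀ C ∈ B.components, p ∈ C ↔ q ∈ C) : B.Γ p = B.Γ q := by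
  have h1 : B.exponentSum p = B.exponentSum q := by
    ext S
    simp only [exponentSum, exponentAt_congr h]
  have h2 : B.admissible p = B.admissible q := by
    ext S
    simp only [mem_admissible, h1, through_congr h]
  have h3 : B.negΓ₁ p = B.negΓ₁ q := by rw [negΓ₁, negΓ₁, h2]
  have h4 : B.minimalSets p = B.minimalSets q := by rw [minimalSets, minimalSets, h2, h3]
  have h5 : B.bΓ₂ p = B.bΓ₂ q := by rw [bΓ₂, bΓ₂, h1, h4]
  rw [Γ, Γ, h3, h5, Γ₃, Γ₃, h1, h4, h5]

lemma finite_Γ_image : (B.Γ '' B.Sing).Finite := by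
  let t : B.W → Set (IrreducibleCloseds B.W) := fun p => {C | C ∈ B.components ∧ p ∈ C}
  have ht : (Set.range t).Finite := by
    refine B.components_finite.finite_subsets.subset ?_
    rintro _ ⟨p, rfl⟩
    exact fun C hC => hC.1
  have hf : B.Γ.FactorsThrough t := by
    intro p q hpq
    refine Γ_congr fun C hC => ?_
    have : C ∈ t p ↔ C ∈ t q := by rw [hpq]
    simpa [t, hC] using this
  refine (ht.image (Function.extend t B.Γ fun _ => B.Γ (Classical.arbitrary B.W))).subset ?_
  rintro _ ⟨p, -, rfl⟩
  exact ⟨t p, ⟨p, rfl⟩, hf.extend_apply _ p⟩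

lemma mem_getD_iff {r : ℕ} (S : Finset (Fin r)) (hS : S.card ≤ d) (j : Fin r) :
    j ∈ S ↔ ∃ i : Fin d, indexTuple d S i = (j : ℕ) + 1 := by
  have hl : (S.sort (· ≥ ·)).length = S.card := Finset.length_sort _
  have hv : ∀ i : Fin d, indexTuple d S i =
      ((S.sort (· ≥ ·)).map fun j : Fin r => (j : ℕ) + 1).getD i 0 := fun _ => rfl
  rw [← Finset.mem_sort (· ≥ ·), List.mem_iff_getElem]
  constructor
  · rintro ⟨i, hi, rfl⟩
    refine ⟨⟨i, by omega⟩, ?_⟩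
    rw [hv]
    simp only [List.getD_eq_getElem?_getD, List.getElem?_map, List.getElem?_eq_getElem hi,
      Option.map_some, Option.getD_some]
  · rintro ⟨i, hi⟩
    rw [hv] at hi
    by_cases h : (i : ℕ) < (S.sort (· ≥ ·)).length
    · refine ⟨i, h, ?_⟩
      simp only [List.getD_eq_getElem?_getD, List.getElem?_map, List.getElem?_eq_getElem h,
        Option.map_some, Option.getD_some] at hi
      exact Fin.ext (by omega)
    · simp [List.getD_eq_getElem?_getD, List.getElem?_eq_none (not_lt.mp h)] at hi

lemma indexTuple_injOn {r : ℕ} {S T : Finset (Fin r)} (hS : S.card ≤ d) (hT : T.card ≤ d)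
    (h : indexTuple d S = indexTuple d T) : S = T := by
  ext j
  rw [mem_getD_iff S hS, mem_getD_iff T hT, h]

lemma card_le [IsAlgClosed k] {p : B.W} (hp : IsClosed ({p} : Set B.W))
    {S : Finset (Fin B.E.length)} (hS : ∀ j ∈ S, B.Through j p) : S.card ≤ d := by
  obtain ⟨x, -, σ, hσ, -⟩ := B.exists_adapted hp
  choose C hC hpC using hS
  let f : S → Fin d := fun j => σ ⟨C j.1 j.2, get_mem_components (hC j.1 j.2), hpC j.1 j.2⟩
  have hf : Function.Injective f := by
    intro i j hij
    have : C i.1 i.2 = C j.1 j.2 := congrArg Subtype.val (hσ hij)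
    exact Subtype.ext (index_unique (hC i.1 i.2) (by rw [this]; exact hC j.1 j.2))
  simpa using Fintype.card_le_of_injective f hf

/-! ### The center -/

variable (B) in
/-- `Y` is locally the intersection of the boundary components with index in `S`, and the sum of
their exponents is `c` everywhere on `Y`. -/
structure IsCenter (Y : Closeds B.W) (S : Finset (Fin B.E.length)) (c : ℕ) : Prop where
  through : ∀ z ∈ Y, ∀ j ∈ S, B.Through j z
  sum_eq : ∀ z ∈ Y, B.exponentSum z S = c
  mem_of : ∀ z ∈ Y, ∀ w, (∀ j ∈ S, ∀ C ∈ B.E.get j, z ∈ C → w ∈ C) → w ∈ Y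
  le : B.b ≤ c

lemma isClosed_MaxΓ [IsAlgClosed k] (hB : B.IsMonomial) :
    IsClosed B.MaxΓ ∧ ∀ z ∈ B.MaxΓ, ∀ S ∈ B.admissible z, B.value z S = B.Γ z →
      ∀ w, (∀ j ∈ S, ∀ C ∈ B.E.get j, z ∈ C → w ∈ C) → w ∈ B.MaxΓ := by
  have key : ∀ z ∈ B.MaxΓ, ∀ S ∈ B.admissible z, B.value z S = B.Γ z →
      ∀ w, (∀ j ∈ S, ∀ C ∈ B.E.get j, z ∈ C → w ∈ C) → w ∈ B.MaxΓ := by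
    intro z hz S hS hv w hw
    rw [mem_admissible] at hS
    have h1 : ∀ j ∈ S, B.Through j w ∧ B.exponentAt j w = B.exponentAt j z := by
      intro j hj
      obtain ⟨C, hC, hzC⟩ := hS.1 j hj
      have hwC := hw j hj C hC hzC
      exact ⟨⟨C, hC, hwC⟩, (exponentAt_eq hC hwC).trans (exponentAt_eq hC hzC).symm⟩
    have h2 : B.exponentSum w S = B.exponentSum z S := Finset.sum_congr rfl fun j hj => (h1 j hj).2
    have h3 : S ∈ B.admissible w := mem_admissible.mpr ⟨fun j hj => (h1 j hj).1, h2 ▸ hS.2⟩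
    have h4 : B.value w S = B.value z S := by rw [value, value, h2]
    have hwS := hB.mem_sing_of_mem_admissible h3
    refine ⟨hwS, fun q hq => (hz.2 q hq).trans ?_⟩
    rw [← hv, ← h4]
    exact (isGreatest_Γ ⟨S, h3⟩).2 ⟨S, h3, rfl⟩
  refine ⟨?_, key⟩
  let 𝒯 : Set (Set (IrreducibleCloseds B.W)) := {T | T ⊆ B.components ∧ ⋂ C ∈ T, (C : Set B.W) ⊆
    B.MaxΓ}
  have h𝒯 : 𝒯.Finite := B.components_finite.finite_subsets.subset fun T hT => hT.1
  have : B.MaxΓ = ⋃ T ∈ 𝒯, ⋂ C ∈ T, (C : Set B.W) := by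
    apply subset_antisymm
    · intro z hz
      obtain ⟨S, hS, hv⟩ := (isGreatest_Γ (hB.admissible_nonempty hz.1)).1
      refine Set.mem_biUnion (x := {C | ∃ j ∈ S, C ∈ B.E.get j ∧ z ∈ C}) ⟨?_, ?_⟩ ?_
      · rintro C ⟨j, -, hC, -⟩
        exact get_mem_components hC
      · intro w hw
        refine key z hz S hS hv w fun j hj C hC hzC => ?_
        exact Set.mem_iInter₂.mp hw C ⟨j, hj, hC, hzC⟩
      · exact Set.mem_iInter₂.mpr fun C ⟨j, _, _, hzC⟩ => hzC
    · exact Set.iUnion₂_subset fun T hT => hT.2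
  rw [this]
  exact h𝒯.isClosed_biUnion fun T _ => isClosed_biInter fun C _ => C.isClosed

lemma card_le_of_mem_admissible [IsAlgClosed k] (hB : B.IsMonomial) {z : B.W}
    {T : Finset (Fin B.E.length)} (hT : T ∈ B.admissible z) : T.card ≤ d := by
  obtain ⟨q, hq, -, -, hC⟩ := exists_isClosed_mem_sing (hB.mem_sing_of_mem_admissible hT)
  exact card_le hq fun j hj => (through_congr hC j).mpr ((mem_admissible.mp hT).1 j hj)

theorem exists_isCenter [IsAlgClosed k] (hB : B.IsMonomial) (hS : B.Sing.Nonempty) :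
    ∃ (Y : Closeds B.W) (γ : ℤ ×ₗ ℚ ×ₗ Lex (Fin d → ℕ)) (S : Finset (Fin B.E.length)) (c : ℕ),
      (Y : Set B.W) = B.MaxΓ ∧ IsGreatest (B.Γ '' B.Sing) γ ∧ B.IsCenter Y S c ∧
      (∀ z ∈ Y, S ∈ B.admissible z ∧ B.value z S = γ) ∧
      ∀ z, ∀ T ∈ B.admissible z, B.value z T = γ → T = S := by
  obtain ⟨hcl, hmem⟩ := isClosed_MaxΓ hB
  obtain ⟨γ, hγm, hγu⟩ := Set.exists_max_image _ id (finite_Γ_image (B := B)) (hS.image B.Γ)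
  have hγ : IsGreatest (B.Γ '' B.Sing) γ := ⟨hγm, fun _ h => hγu _ h⟩
  obtain ⟨z₀, hz₀, rfl⟩ := hγ.1
  have hmax : ∀ z, z ∈ B.MaxΓ ↔ z ∈ B.Sing ∧ B.Γ z = B.Γ z₀ := fun z =>
    ⟨fun h => ⟨h.1, le_antisymm (hγ.2 ⟨z, h.1, rfl⟩) (h.2 z₀ hz₀)⟩,
      fun h => ⟨h.1, fun q hq => h.2 ▸ hγ.2 ⟨q, hq, rfl⟩⟩⟩
  obtain ⟨S, hSadm, hSv⟩ := (isGreatest_Γ (hB.admissible_nonempty hz₀)).1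
  have huniq : ∀ z, ∀ T ∈ B.admissible z, B.value z T = B.Γ z₀ → T = S := by
    intro z T hT hv
    rw [← hSv, value_eq_iff] at hv
    exact indexTuple_injOn (card_le_of_mem_admissible hB hT)
      (card_le_of_mem_admissible hB hSadm) hv.2.2
  have hadm : ∀ z ∈ B.MaxΓ, S ∈ B.admissible z ∧ B.value z S = B.Γ z₀ := by
    intro z hz
    rw [hmax] at hz
    obtain ⟨T, hT, hv⟩ := (isGreatest_Γ (hB.admissible_nonempty hz.1)).1
    rw [hz.2] at hv
    obtain rfl := huniq z T hT hv
    exact ⟨hT, hv⟩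
  refine ⟨⟨B.MaxΓ, hcl⟩, B.Γ z₀, S, B.exponentSum z₀ S, rfl, hγ, ?_, hadm, huniq⟩
  refine ⟨fun z hz => (mem_admissible.mp (hadm z hz).1).1, fun z hz => ?_, fun z hz => ?_,
    (mem_admissible.mp hSadm).2⟩
  · have := (hadm z hz).2
    rw [← hSv, value_eq_iff] at this
    exact this.2.1
  · exact hmem z hz S (hadm z hz).1 ((hadm z hz).2.trans ((hmax z).mp hz).2.symm)

/-- The indices of the parameters which define the boundary components with index in `S`. -/
def centerIndices {p : B.W} (σ : B.Comp p → Fin d) (S : Finset (Fin B.E.length)) : Set (Fin d) :=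
  {i | ∃ C : B.Comp p, (∃ j ∈ S, C.1 ∈ B.E.get j) ∧ σ C = i}

lemma IsCenter.stalkIdeal_eq {Y : Closeds B.W} {S : Finset (Fin B.E.length)} {c : ℕ}
    (h : B.IsCenter Y S c) {p : B.W} {x : Fin d → B.W.presheaf.stalk p} (hx : RegularSystem x)
    {σ : B.Comp p → Fin d}
    (hxσ : ∀ C : B.Comp p, stalkIdeal (idealOf (toCloseds C.1)) p = Ideal.span {x (σ C)})
    (hp : p ∈ Y) : stalkIdeal (idealOf Y) p = Ideal.span (x '' centerIndices σ S) := by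
  have hmem : ∀ (z : B.W) (hz : z ⤳ p) (C : B.Comp p), z ∈ C.1 ↔ x (σ C) ∈ primeOf hz := by
    intro z hz C
    rw [← Ideal.span_singleton_le_iff_mem, ← hxσ, stalkIdeal_idealOf_le_primeOf_iff]
    rfl
  apply le_antisymm
  · have := hx.isPrime (centerIndices σ S)
    obtain ⟨z, hz, e⟩ := exists_primeOf_eq p (Ideal.span (x '' centerIndices σ S))
    rw [← e, stalkIdeal_idealOf_le_primeOf_iff]
    refine h.mem_of p hp z fun j hj C hC hpC => ?_
    refine (hmem z hz ⟨C, get_mem_components hC, hpC⟩).mpr ?_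
    rw [e]
    exact Ideal.subset_span ⟨_, ⟨_, ⟨j, hj, hC⟩, rfl⟩, rfl⟩
  · rw [Ideal.span_le]
    rintro _ ⟨_, ⟨C, ⟨j, hj, hC⟩, rfl⟩, rfl⟩
    rw [SetLike.mem_coe, mem_stalkIdeal_idealOf_iff]
    intro z hz hzY
    rw [← hmem]
    obtain ⟨C', hC', hzC'⟩ := h.through z hzY j hj
    have : C' = C.1 := component_unique hC' hC (hz.mem_closed C'.isClosed hzC') C.2.2
    exact this ▸ hzC'

lemma IsCenter.sum_exponent {Y : Closeds B.W} {S : Finset (Fin B.E.length)} {c : ℕ}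
    (h : B.IsCenter Y S c) {p : B.W} (hp : p ∈ Y) {σ : B.Comp p → Fin d}
    (hσ : Function.Injective σ) [DecidablePred (· ∈ centerIndices σ S)] :
    ∑ C : B.Comp p with σ C ∈ centerIndices σ S, B.exponent C.1 = c := by
  rw [← h.sum_eq p hp, exponentSum]
  choose C hC hpC using h.through p hp
  symm
  refine Finset.sum_bij (fun j hj => ⟨C j hj, get_mem_components (hC j hj), hpC j hj⟩)
    (fun j hj => ?_) (fun i hi j hj e => ?_) (fun C' hC' => ?_) (fun j hj => ?_)
  · exact Finset.mem_filter.mpr ⟨Finset.mem_univ _, _, ⟨j, hj, hC j hj⟩, rfl⟩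
  · have : C i hi = C j hj := congrArg Subtype.val e
    exact index_unique (hC i hi) (by rw [this]; exact hC j hj)
  · obtain ⟨C'', ⟨j, hj, hC''⟩, e⟩ := (Finset.mem_filter.mp hC').2
    obtain rfl := hσ e
    exact ⟨j, hj, Subtype.ext (component_unique (hC j hj) hC'' (hpC j hj) C''.2.2)⟩
  · exact exponentAt_eq (hC j hj) (hpC j hj)

theorem IsCenter.isPermissible [IsAlgClosed k] {Y : Closeds B.W} {S : Finset (Fin B.E.length)}
    {c : ℕ} (h : B.IsCenter Y S c) : B.IsPermissible Y := by
  constructor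
  · refine smooth_subscheme_of_stalkIdeal (d := d) B.toSpec _ fun p hp hpY => ?_
    rw [mem_support_idealOf] at hpY
    obtain ⟨x, hx, σ, hσ, hxσ⟩ := B.exists_adapted hp
    exact ⟨x, hx.span_eq, _, h.stalkIdeal_eq hx hxσ hpY⟩
  · intro p hp
    obtain ⟨x, hx, σ, hσ, hxσ⟩ := B.exists_adapted hp
    exact ⟨x, ⟨hx.span_eq, σ, hσ, hxσ⟩, fun hpY => ⟨_, h.stalkIdeal_eq hx hxσ hpY⟩⟩

end BasicObject

end MonomialResolution

end

noncomputable section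

namespace MonomialResolution

lemma map_maximalIdeal_of_bijective {O O' : Type*} [CommRing O] [CommRing O']
    [IsLocalRing O] [IsLocalRing O'] {φ : O →+* O'} (h : Function.Bijective φ) :
    (IsLocalRing.maximalIdeal O).map φ = IsLocalRing.maximalIdeal O' := by
  exact IsLocalRing.eq_maximalIdeal
    (Ideal.IsMaximal.map_bijective φ h (IsLocalRing.maximalIdeal.isMaximal O))

/-- The strict transform of a closed subset. -/
def strictClosed {X X' : Scheme.{u}} (π : X' ⟶ X) (Y : Closeds X) (C : IrreducibleCloseds X) :
    Closeds X' :=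
  ⟨closure (π ⁻¹' ((C : Set X) \ Y)), isClosed_closure⟩

section StrictClosed

variable {X X' : Scheme.{u}} {π : X' ⟶ X} {Y : Closeds X} {C : IrreducibleCloseds X}

lemma map_mem_of_mem_strictClosed {q : X'} (hq : q ∈ strictClosed π Y C) : π q ∈ C :=
  closure_minimal (fun _ hw => hw.1) (C.isClosed.preimage π.continuous) hq

lemma genericPoint_mem (C : IrreducibleCloseds X) : C.isIrreducible.genericPoint ∈ C := by
  have := subset_closure (Set.mem_singleton C.isIrreducible.genericPoint)
  rwa [C.isIrreducible.closure_genericPoint C.isClosed] at this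

lemma genericPoint_notMem_of_not_subset (hC : ¬ (C : Set X) ⊆ Y) : C.isIrreducible.genericPoint ∉ Y := by
  intro hY
  refine hC fun z hz => ?_
  exact (BasicObject.genericPoint_specializes hz).mem_closed Y.isClosed hY

lemma IsBlowup.exists_closure_eq_strictClosed (hπ : IsBlowup π (idealOf Y))
    (hC : ¬ (C : Set X) ⊆ Y) : ∃ z : X', closure {z} = (strictClosed π Y C : Set X') ∧
      π z = C.isIrreducible.genericPoint := by
  have hY := genericPoint_notMem_of_not_subset hC
  have hs : ∀ w : X, w ∉ Y → w ∉ (idealOf Y).support := fun w hw => by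
    rwa [mem_support_idealOf]
  obtain ⟨z, hz⟩ := hπ.exists_π_eq (hs _ hY)
  refine ⟨z, subset_antisymm ?_ (closure_minimal ?_ isClosed_closure), hz⟩
  · refine closure_mono (Set.singleton_subset_iff.mpr ⟨?_, ?_⟩)
    · rw [hz]; exact genericPoint_mem C
    · rw [hz]; exact hY
  · rintro w ⟨hwC, hwY⟩
    obtain ⟨v, hv, e⟩ := hπ.exists_specializes_π_eq (hs _ hwY)
      (BasicObject.genericPoint_specializes hwC)
    obtain rfl := hπ.eq_of_π_eq (hs _ (e ▸ hY)) (e.trans hz.symm)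
    exact specializes_iff_mem_closure.mp hv

end StrictClosed

namespace BasicObject

/-! ### The blowup of a basic object along a center -/

variable {k : Type u} [Field k] {d : ℕ} {B : BasicObject k d} {Y : Closeds B.W}
  {S : Finset (Fin B.E.length)} {c : ℕ} {X' : Scheme.{u}} {π : X' ⟶ B.W}

/-- The description of a blowup along a center `Y` at a closed point `q`: `y` is a regular system of
parameters at `q`, the element `e` generates the exceptional ideal, the boundary component `C` is
defined at `π q` by an element with image `e * t C` if its index belongs to the center, and `t C`
otherwise. -/
structure PointForm (π : X' ⟶ B.W) (Y : Closeds B.W) (S : Finset (Fin B.E.length)) (q : X')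
    (y : Fin d → X'.presheaf.stalk q) (e : X'.presheaf.stalk q)
    (σ : B.Comp (π q) → Fin d) (x : B.Comp (π q) → B.W.presheaf.stalk (π q))
    (t : B.Comp (π q) → X'.presheaf.stalk q) : Prop where
  regular : RegularSystem y
  stalkIdeal_comap : stalkIdeal ((idealOf Y).comap π) q = Ideal.span {e}
  stalkIdeal_eq : ∀ C, stalkIdeal (idealOf (toCloseds C.1)) (π q) = Ideal.span {x C}
  map_of_mem : π q ∈ Y → ∀ C : B.Comp (π q), (∃ j ∈ S, C.1 ∈ B.E.get j) →
    (π.stalkMap q).hom (x C) = e * t C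
  map_of_notMem : π q ∈ Y → ∀ C : B.Comp (π q), (¬ ∃ j ∈ S, C.1 ∈ B.E.get j) →
    (π.stalkMap q).hom (x C) = t C
  eq_one : π q ∉ Y → e = 1
  map_of_eq_one : π q ∉ Y → ∀ C, (π.stalkMap q).hom (x C) = t C
  eq_or : ∀ C, t C = y (σ C) ∨ IsUnit (t C)
  exists_eq : π q ∈ Y → ∃ i, e = y i ∧ ∃ C : B.Comp (π q), (∃ j ∈ S, C.1 ∈ B.E.get j) ∧
    σ C = i ∧ t C = 1
  injective : Function.Injective σ

variable [IsAlgClosed k] [IsLocallyNoetherian X']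
  [SmoothOfRelativeDimension d (π ≫ B.toSpec)]

omit [IsAlgClosed k] [IsLocallyNoetherian X'] in
lemma isClosed_map {q : X'} (hq : IsClosed ({q} : Set X')) : IsClosed ({π q} : Set B.W) := by
  have := SmoothOfRelativeDimension.smooth d (π ≫ B.toSpec)
  have : LocallyOfFiniteType π := locallyOfFiniteType_of_comp π B.toSpec
  exact π.closePoints_subset_preimage_closedPoints hq

theorem IsCenter.exists_pointForm (h : B.IsCenter Y S c) (hπ : IsBlowup π (idealOf Y)) {q : X'}
    (hq : IsClosed ({q} : Set X')) : ∃ y e σ x t, PointForm π Y S q y e σ x t := by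
  have := SmoothOfRelativeDimension.smooth d (π ≫ B.toSpec)
  have hp : IsClosed ({π q} : Set B.W) := isClosed_map hq
  obtain ⟨x, hx, σ, hσ, hxσ⟩ := B.exists_adapted hp
  by_cases hY : π q ∈ Y
  · have hM := h.stalkIdeal_eq hx hxσ hY
    obtain ⟨i, y, t, H⟩ := hπ.exists_localForm (s := B.toSpec) hq hp hx.span_eq hM
    have hi := H.mem
    obtain ⟨C₀, hC₀, rfl⟩ := hi
    refine ⟨y, y (σ C₀), σ, x ∘ σ, t ∘ σ, ⟨H.regular, ?_, hxσ, fun _ C hC => ?_, fun _ C hC => ?_,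
      fun h => absurd hY h, fun h => absurd hY h, fun C => H.eq_or _,
      fun _ => ⟨_, rfl, C₀, hC₀, rfl, H.eq_one⟩, hσ⟩⟩
    · rw [MonomialResolution.stalkIdeal_comap, hM, Ideal.map_span]
      apply le_antisymm
      · rw [Ideal.span_le]
        rintro _ ⟨_, ⟨j, hj, rfl⟩, rfl⟩
        rw [H.map_mem j hj]
        exact Ideal.mul_mem_right _ _ (Ideal.mem_span_singleton_self _)
      · rw [Ideal.span_singleton_le_iff_mem]
        have := H.map_mem _ H.mem
        rw [H.eq_one, mul_one] at this
        rw [← this]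
        exact Ideal.subset_span ⟨_, ⟨_, H.mem, rfl⟩, rfl⟩
    · exact H.map_mem _ ⟨C, hC, rfl⟩
    · refine H.map_notMem _ ?_
      rintro ⟨C', hC', e⟩
      obtain rfl := hσ e
      exact hC hC'
  · have hY' : π q ∉ (idealOf Y).support := by rwa [mem_support_idealOf]
    have hb := hπ.bijective_stalkMap hY'
    refine ⟨fun j => (π.stalkMap q).hom (x j), 1, σ, x ∘ σ, fun C => (π.stalkMap q).hom (x (σ C)),
      ⟨?_, ?_, hxσ, fun h => absurd h hY, fun h => absurd h hY, fun _ => rfl, fun _ _ => rfl,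
      fun C => .inl rfl, fun h => absurd h hY, hσ⟩⟩
    · refine regularSystem_of_span_eq (π ≫ B.toSpec) hq ?_
      rw [← map_maximalIdeal_of_bijective hb, ← hx.span_eq, Ideal.map_span, ← Set.range_comp]
      rfl
    · rw [Ideal.span_singleton_one, stalkIdeal_eq_top_iff, Scheme.IdealSheafData.support_comap]
      exact hY'

namespace PointForm

omit [IsAlgClosed k] [IsLocallyNoetherian X']
  [SmoothOfRelativeDimension d (π ≫ B.toSpec)]

variable {q : X'} {y : Fin d → X'.presheaf.stalk q} {e : X'.presheaf.stalk q}
    {σ : B.Comp (π q) → Fin d} {x : B.Comp (π q) → B.W.presheaf.stalk (π q)}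
    {t : B.Comp (π q) → X'.presheaf.stalk q} (H : PointForm π Y S q y e σ x t)

include H

lemma exists_map_eq (C : B.Comp (π q)) :
    ∃ u, (u = e ∨ u = 1) ∧ (π.stalkMap q).hom (x C) = u * t C := by
  by_cases hY : π q ∈ Y
  · by_cases hC : ∃ j ∈ S, C.1 ∈ B.E.get j
    · exact ⟨e, .inl rfl, H.map_of_mem hY C hC⟩
    · exact ⟨1, .inr rfl, by rw [one_mul, H.map_of_notMem hY C hC]⟩
  · exact ⟨1, .inr rfl, by rw [one_mul, H.map_of_eq_one hY C]⟩

lemma mem_primeOf_iff {w : X'} (hw : w ⤳ q) : e ∈ primeOf hw ↔ π w ∈ Y := by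
  rw [← Ideal.span_singleton_le_iff_mem, ← H.stalkIdeal_comap, stalkIdeal_le_primeOf_iff,
    Scheme.IdealSheafData.support_comap]
  exact mem_support_idealOf Y (π w)

lemma map_mem_primeOf_iff {w : X'} (hw : w ⤳ q) (C : B.Comp (π q)) :
    (π.stalkMap q).hom (x C) ∈ primeOf hw ↔ π w ∈ C.1 := by
  rw [← Ideal.mem_comap, ← primeOf_map, ← Ideal.span_singleton_le_iff_mem, ← H.stalkIdeal_eq,
    stalkIdeal_idealOf_le_primeOf_iff]
  rfl

lemma mem_primeOf_of_mem {w : X'} (hw : w ⤳ q) (C : B.Comp (π q)) (hC : π w ∈ C.1) (hY : π w ∉ Y) :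
    t C ∈ primeOf hw := by
  obtain ⟨u, hu, hx⟩ := H.exists_map_eq C
  rw [← H.map_mem_primeOf_iff hw C, hx] at hC
  refine (Ideal.IsPrime.mem_or_mem inferInstance hC).resolve_left fun h => ?_
  rcases hu with rfl | rfl
  · exact hY ((H.mem_primeOf_iff hw).mp h)
  · exact (Ideal.ne_top_iff_one _).mp (Ideal.IsPrime.ne_top inferInstance) h

theorem stalkIdeal_strictClosed (hπ : IsBlowup π (idealOf Y)) (C : B.Comp (π q)) :
    stalkIdeal (idealOf (strictClosed π Y C.1)) q = Ideal.span {t C} := by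
  apply le_antisymm
  · rcases H.eq_or C with ht | ht
    · have hprime := H.regular.isPrime_singleton (σ C)
      obtain ⟨w, hw, hwy⟩ := exists_primeOf_eq q (Ideal.span {y (σ C)})
      rw [ht, ← hwy, stalkIdeal_idealOf_le_primeOf_iff]
      refine subset_closure ⟨?_, fun hY => ?_⟩
      · rw [SetLike.mem_coe, ← H.map_mem_primeOf_iff hw C, hwy]
        obtain ⟨u, -, hx⟩ := H.exists_map_eq C
        rw [hx, ht]
        exact Ideal.mul_mem_left _ _ (Ideal.mem_span_singleton_self _)
      · have hqY : π q ∈ Y := (hw.map π.continuous).mem_closed Y.isClosed hY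
        have he := (H.mem_primeOf_iff hw).mpr hY
        obtain ⟨i, rfl, C', -, rfl, h1⟩ := H.exists_eq hqY
        rw [hwy] at he
        by_cases hC : σ C' = σ C
        · obtain rfl := H.injective hC
          rw [h1] at ht
          exact (Ideal.ne_top_iff_one _).mp hprime.ne_top
            (ht ▸ Ideal.mem_span_singleton_self (y (σ C')))
        · exact H.regular.notMem_singleton hC he
    · rw [Ideal.span_singleton_eq_top.mpr ht]
      exact le_top
  · rw [Ideal.span_singleton_le_iff_mem, mem_stalkIdeal_idealOf_iff]
    intro z hz hzC
    by_cases hC : (C.1 : Set B.W) ⊆ Y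
    · have : (C.1 : Set B.W) \ Y = ∅ := Set.sdiff_eq_empty.mpr hC
      change z ∈ closure (π ⁻¹' ((C.1 : Set B.W) \ Y)) at hzC
      simp [this] at hzC
    · obtain ⟨ζ, hζ, hζC⟩ := hπ.exists_closure_eq_strictClosed hC
      have hzζ : ζ ⤳ z := specializes_iff_mem_closure.mpr (hζ ▸ hzC)
      refine (primeOf_le_primeOf_iff (hzζ.trans hz) hz).mpr hzζ ?_
      refine H.mem_primeOf_of_mem _ C ?_ ?_
      · rw [hζC]; exact genericPoint_mem C.1
      · rw [hζC]; exact genericPoint_notMem_of_not_subset hC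

end PointForm

end BasicObject

end MonomialResolution

end

noncomputable section

namespace MonomialResolution

/-! ### The boundary of a blowup -/

section Boundary

variable {X X' : Scheme.{u}} (π : X' ⟶ X) (Y : Closeds X)

/-- The strict transforms of those members of `H` which are not contained in `Y`. -/
def strictSet (H : Set (IrreducibleCloseds X)) : Set (IrreducibleCloseds X') :=
  {C' | ∃ C ∈ H, ¬ (C : Set X) ⊆ Y ∧ (C' : Set X') = closure (π ⁻¹' ((C : Set X) \ Y))}

/-- The irreducible components of the inverse image of `Y`. -/
def exceptionalSet : Set (IrreducibleCloseds X') :=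
  {C' | Maximal (fun D : IrreducibleCloseds X' => (D : Set X') ⊆ π ⁻¹' (Y : Set X)) C'}

/-- The closure of the image of an irreducible closed subset. -/
def imageClosure (D : IrreducibleCloseds X') : IrreducibleCloseds X :=
  ⟨closure {π D.isIrreducible.genericPoint}, isIrreducible_singleton.closure, isClosed_closure⟩

variable {π Y}

lemma subset_of_mem_exceptionalSet {D : IrreducibleCloseds X'} (hD : D ∈ exceptionalSet π Y) :
    (D : Set X') ⊆ π ⁻¹' (Y : Set X) :=
  Maximal.prop (P := fun D : IrreducibleCloseds X' => (D : Set X') ⊆ π ⁻¹' (Y : Set X)) hD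

lemma eq_of_mem_exceptionalSet {D D' : IrreducibleCloseds X'} (hD : D ∈ exceptionalSet π Y)
    (hD' : (D' : Set X') ⊆ π ⁻¹' (Y : Set X)) (h : D ≤ D') : D = D' :=
  Maximal.eq_of_le (P := fun D : IrreducibleCloseds X' => (D : Set X') ⊆ π ⁻¹' (Y : Set X)) hD hD' h

lemma eq_genericPoint {D : IrreducibleCloseds X} {z : X} (h : closure {z} = (D : Set X)) :
    D.isIrreducible.genericPoint = z := by
  have h1 := (D.isIrreducible.closure_genericPoint D.isClosed).trans h.symm
  exact ((specializes_iff_closure_subset.mpr h1.ge).antisymm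
    (specializes_iff_closure_subset.mpr h1.le)).eq

lemma imageClosure_eq (hπ : IsBlowup π (idealOf Y)) {C : IrreducibleCloseds X}
    (hC : ¬ (C : Set X) ⊆ Y) {D : IrreducibleCloseds X'}
    (hD : (D : Set X') = closure (π ⁻¹' ((C : Set X) \ Y))) :
    imageClosure π D = C := by
  obtain ⟨z, hz, e⟩ := hπ.exists_closure_eq_strictClosed hC
  apply IrreducibleCloseds.ext
  change closure {π D.isIrreducible.genericPoint} = (C : Set X)
  rw [eq_genericPoint (z := z) (hz.trans hD.symm), e,
    C.isIrreducible.closure_genericPoint C.isClosed]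

lemma not_subset_preimage (hπ : IsBlowup π (idealOf Y)) {C : IrreducibleCloseds X}
    (hC : ¬ (C : Set X) ⊆ Y) {D : IrreducibleCloseds X'}
    (hD : (D : Set X') = closure (π ⁻¹' ((C : Set X) \ Y))) :
    ¬ (D : Set X') ⊆ π ⁻¹' (Y : Set X) := by
  intro h
  have h1 := h (genericPoint_mem D)
  have h2 := imageClosure_eq hπ hC hD
  refine hC (h2 ▸ ?_)
  exact closure_minimal (Set.singleton_subset_iff.mpr h1) Y.isClosed

lemma mem_strictSet_iff (hπ : IsBlowup π (idealOf Y)) {H : Set (IrreducibleCloseds X)}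
    {D : IrreducibleCloseds X'} : D ∈ strictSet π Y H ↔ imageClosure π D ∈ H ∧
      ¬ (imageClosure π D : Set X) ⊆ Y ∧ toCloseds D = strictClosed π Y (imageClosure π D) := by
  constructor
  · rintro ⟨C, hC, hCY, hD⟩
    have := imageClosure_eq hπ hCY hD
    rw [this]
    exact ⟨hC, hCY, Closeds.ext hD⟩
  · rintro ⟨hC, hCY, hD⟩
    exact ⟨_, hC, hCY, congrArg ((↑) : Closeds X' → Set X') hD⟩

lemma bijOn_imageClosure (hπ : IsBlowup π (idealOf Y)) (H : Set (IrreducibleCloseds X)) :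
    Set.BijOn (imageClosure π) (strictSet π Y H) {C | C ∈ H ∧ ¬ (C : Set X) ⊆ Y} := by
  refine ⟨fun D hD => ?_, fun D hD D' hD' e => ?_, fun C hC => ?_⟩
  · rw [mem_strictSet_iff hπ] at hD
    exact ⟨hD.1, hD.2.1⟩
  · rw [mem_strictSet_iff hπ] at hD hD'
    have h1 : toCloseds D = toCloseds D' := by rw [hD.2.2, hD'.2.2, e]
    exact IrreducibleCloseds.ext (congrArg ((↑) : Closeds X' → Set X') h1)
  · obtain ⟨z, hz, -⟩ := hπ.exists_closure_eq_strictClosed hC.2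
    let D : IrreducibleCloseds X' := ⟨closure {z}, isIrreducible_singleton.closure, isClosed_closure⟩
    exact ⟨D, ⟨C, hC.1, hC.2, hz⟩, imageClosure_eq hπ hC.2 hz⟩

lemma disjoint_strictSet_exceptionalSet (hπ : IsBlowup π (idealOf Y))
    (H : Set (IrreducibleCloseds X)) : Disjoint (strictSet π Y H) (exceptionalSet π Y) := by
  rw [Set.disjoint_left]
  rintro D ⟨C, -, hC, hD⟩ hD'
  exact not_subset_preimage hπ hC hD (subset_of_mem_exceptionalSet hD')

lemma finite_strictSet (hπ : IsBlowup π (idealOf Y)) {H : Set (IrreducibleCloseds X)}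
    (hH : H.Finite) : (strictSet π Y H).Finite :=
  (hH.subset fun _ h => h.1).of_injOn (bijOn_imageClosure hπ H).mapsTo
    (bijOn_imageClosure hπ H).injOn

variable (π Y) in
lemma finite_exceptionalSet [NoetherianSpace X'] : (exceptionalSet π Y).Finite := by
  obtain ⟨T, hT, hTc, hTi, e⟩ := NoetherianSpace.exists_finite_set_isClosed_irreducible
    (Y.isClosed.preimage π.continuous)
  refine hT.of_injOn (f := fun D : IrreducibleCloseds X' => (D : Set X')) (fun D hD => ?_)
    fun D _ D' _ h => IrreducibleCloseds.ext h
  obtain ⟨W, hW, hDW⟩ := isIrreducible_iff_sUnion_isClosed.mp D.isIrreducible hT.toFinset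
    (fun W hW => hTc W (hT.mem_toFinset.mp hW)) (by
      rw [hT.coe_toFinset, ← e]; exact subset_of_mem_exceptionalSet hD)
  rw [hT.mem_toFinset] at hW
  let D' : IrreducibleCloseds X' := ⟨W, hTi W hW, hTc W hW⟩
  have hD' : (D' : Set X') ⊆ π ⁻¹' (Y : Set X) := e ▸ Set.subset_sUnion_of_mem hW
  have : D = D' := eq_of_mem_exceptionalSet hD hD' hDW
  rw [this]
  exact hW

lemma pairwiseDisjoint_strictSet {H : Set (IrreducibleCloseds X)}
    (hH : H.PairwiseDisjoint fun C => (C : Set X)) :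
    (strictSet π Y H).PairwiseDisjoint fun C => (C : Set X') := by
  rintro D ⟨C, hC, -, hD⟩ D' ⟨C', hC', -, hD'⟩ hne
  refine Set.disjoint_left.mpr fun q hq hq' => ?_
  have hCC : C ≠ C' := by
    rintro rfl
    exact hne (IrreducibleCloseds.ext (hD.trans hD'.symm))
  have h1 : π q ∈ C := map_mem_of_mem_strictClosed (Y := Y) (show q ∈ closure _ from hD ▸ hq)
  have h2 : π q ∈ C' := map_mem_of_mem_strictClosed (Y := Y) (show q ∈ closure _ from hD' ▸ hq')
  exact Set.disjoint_left.mp (hH hC hC' hCC) h1 h2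

lemma disjoint_strictSet (hπ : IsBlowup π (idealOf Y)) {H H' : Set (IrreducibleCloseds X)}
    (hH : Disjoint H H') : Disjoint (strictSet π Y H) (strictSet π Y H') := by
  rw [Set.disjoint_left] at hH ⊢
  intro D hD hD'
  exact hH ((mem_strictSet_iff hπ).mp hD).1 ((mem_strictSet_iff hπ).mp hD').1

end Boundary

namespace BasicObject

variable {k : Type u} [Field k] {d : ℕ} {B : BasicObject k d} {Y : Closeds B.W}
  {S : Finset (Fin B.E.length)} {c : ℕ} {X' : Scheme.{u}} {π : X' ⟶ B.W}

namespace PointForm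

variable {q : X'} {y : Fin d → X'.presheaf.stalk q} {e : X'.presheaf.stalk q}
    {σ : B.Comp (π q) → Fin d} {x : B.Comp (π q) → B.W.presheaf.stalk (π q)}
    {t : B.Comp (π q) → X'.presheaf.stalk q} (H : PointForm π Y S q y e σ x t)

include H

lemma exists_exceptional (hY : π q ∈ Y) : ∃ D ∈ exceptionalSet π Y, q ∈ D ∧
    stalkIdeal (idealOf (toCloseds D)) q = Ideal.span {e} ∧
    ∀ D' ∈ exceptionalSet π Y, q ∈ D' → D' = D := by
  obtain ⟨i, he, -⟩ := H.exists_eq hY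
  have hprime := H.regular.isPrime_singleton i
  rw [← he] at hprime
  obtain ⟨w, hw, hwe⟩ := exists_primeOf_eq q (Ideal.span {e})
  let D : IrreducibleCloseds X' := ⟨closure {w}, isIrreducible_singleton.closure, isClosed_closure⟩
  have hD : (D : Set X') ⊆ π ⁻¹' (Y : Set B.W) := by
    refine closure_minimal (Set.singleton_subset_iff.mpr ?_) (Y.isClosed.preimage π.continuous)
    exact (H.mem_primeOf_iff hw).mp (hwe ▸ Ideal.mem_span_singleton_self e)
  have hmax : ∀ D' : IrreducibleCloseds X', (D' : Set X') ⊆ π ⁻¹' (Y : Set B.W) → q ∈ D' →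
      D' ≤ D := by
    intro D' hD' hq
    have h1 := genericPoint_specializes hq
    have h2 := (H.mem_primeOf_iff h1).mpr (hD' (genericPoint_mem D'))
    rw [← Ideal.span_singleton_le_iff_mem, ← hwe, primeOf_le_primeOf_iff] at h2
    change (D' : Set X') ⊆ closure {w}
    rw [← D'.isIrreducible.closure_genericPoint D'.isClosed]
    exact specializes_iff_closure_subset.mp h2
  have hqD : q ∈ D := specializes_iff_mem_closure.mp hw
  refine ⟨D, ⟨hD, fun D' hD' hDD' => hmax D' hD' (hDD' hqD)⟩, hqD, ?_, fun D' hD' hq => ?_⟩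
  · rw [stalkIdeal_idealOf_eq_primeOf D hw rfl, hwe]
  · exact eq_of_mem_exceptionalSet hD' hD (hmax D' (subset_of_mem_exceptionalSet hD') hq)

lemma exists_stalkIdeal_eq (hπ : IsBlowup π (idealOf Y)) {D : IrreducibleCloseds X'}
    (hD : D ∈ strictSet π Y B.components ∪ exceptionalSet π Y) (hq : q ∈ D) :
    ∃ i, stalkIdeal (idealOf (toCloseds D)) q = Ideal.span {y i} := by
  rcases hD with ⟨C, hC, -, hD⟩ | hD
  · have hD' : toCloseds D = strictClosed π Y C := Closeds.ext hD
    have hq' : q ∈ strictClosed π Y C := hD' ▸ hq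
    have hst := H.stalkIdeal_strictClosed hπ ⟨C, hC, map_mem_of_mem_strictClosed hq'⟩
    rcases H.eq_or ⟨C, hC, map_mem_of_mem_strictClosed hq'⟩ with h | h
    · rw [hD']
      exact ⟨_, h ▸ hst⟩
    · rw [Ideal.span_singleton_eq_top.mpr h, stalkIdeal_eq_top_iff, mem_support_idealOf] at hst
      exact (hst hq').elim
  · have hY : π q ∈ Y := subset_of_mem_exceptionalSet hD hq
    obtain ⟨D', -, -, h, huniq⟩ := H.exists_exceptional hY
    obtain rfl := huniq D hD hq
    obtain ⟨i, he, -⟩ := H.exists_eq hY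
    exact ⟨i, he ▸ h⟩

lemma isAdapted (hπ : IsBlowup π (idealOf Y)) :
    IsAdapted (strictSet π Y B.components ∪ exceptionalSet π Y) q y := by
  refine ⟨H.regular.span_eq, ?_⟩
  choose τ hτ using fun D : {D : IrreducibleCloseds X' //
    D ∈ strictSet π Y B.components ∪ exceptionalSet π Y ∧ q ∈ D} =>
      H.exists_stalkIdeal_eq hπ D.2.1 D.2.2
  refine ⟨τ, fun D D' h => ?_, hτ⟩
  have h1 : stalkIdeal (idealOf (toCloseds D.1)) q = stalkIdeal (idealOf (toCloseds D'.1)) q := by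
    rw [hτ, hτ, h]
  rw [stalkIdeal_idealOf_eq_primeOf D.1 (genericPoint_specializes D.2.2)
      (D.1.isIrreducible.closure_genericPoint D.1.isClosed),
    stalkIdeal_idealOf_eq_primeOf D'.1 (genericPoint_specializes D'.2.2)
      (D'.1.isIrreducible.closure_genericPoint D'.1.isClosed)] at h1
  have h2 := primeOf_injective _ _ h1
  refine Subtype.ext (IrreducibleCloseds.ext ?_)
  rw [← D.1.isIrreducible.closure_genericPoint D.1.isClosed, h2,
    D'.1.isIrreducible.closure_genericPoint D'.1.isClosed]

end PointForm

variable [IsAlgClosed k]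

lemma IsCenter.smoothOfRelativeDimension (h : B.IsCenter Y S c) (hπ : IsBlowup π (idealOf Y)) :
    SmoothOfRelativeDimension d (π ≫ B.toSpec) := by
  refine hπ.smoothOfRelativeDimension fun p hp => ?_
  obtain ⟨x, hx, σ, hσ, hxσ⟩ := B.exists_adapted hp
  refine ⟨x, hx.span_eq, fun hpY => ⟨_, h.stalkIdeal_eq hx hxσ ?_⟩⟩
  rwa [mem_support_idealOf] at hpY

variable [IsLocallyNoetherian X'] [JacobsonSpace X'] [SmoothOfRelativeDimension d (π ≫ B.toSpec)]

lemma IsCenter.smooth_component (h : B.IsCenter Y S c) (hπ : IsBlowup π (idealOf Y))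
    {D : IrreducibleCloseds X'} (hD : D ∈ strictSet π Y B.components ∪ exceptionalSet π Y) :
    Smooth ((idealOf (toCloseds D)).subschemeι ≫ π ≫ B.toSpec) := by
  refine smooth_subscheme_of_stalkIdeal (d := d) (π ≫ B.toSpec) _ fun q hq hqD => ?_
  rw [mem_support_idealOf] at hqD
  obtain ⟨y, e, σ, x, t, H⟩ := h.exists_pointForm hπ hq
  obtain ⟨i, hi⟩ := H.exists_stalkIdeal_eq hπ hD hqD
  exact ⟨y, H.regular.span_eq, {i}, by rw [hi, Set.image_singleton]⟩

lemma IsCenter.pairwiseDisjoint_exceptionalSet (h : B.IsCenter Y S c)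
    (hπ : IsBlowup π (idealOf Y)) :
    (exceptionalSet π Y).PairwiseDisjoint fun C => (C : Set X') := by
  intro D hD D' hD' hne
  refine Set.disjoint_left.mpr fun z hz hz' => hne ?_
  obtain ⟨q, hq, hzq, -⟩ := exists_isClosed_mem_of_specializes z ⊤ trivial
  obtain ⟨y, e, σ, x, t, H⟩ := h.exists_pointForm hπ hq
  have h1 : q ∈ D := hzq.mem_closed D.isClosed hz
  obtain ⟨D₀, -, -, -, huniq⟩ := H.exists_exceptional (subset_of_mem_exceptionalSet hD h1)
  exact (huniq D hD h1).trans (huniq D' hD' (hzq.mem_closed D'.isClosed hz')).symm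

end BasicObject

end MonomialResolution

end

noncomputable section

namespace MonomialResolution

namespace BasicObject

/-! ### The ideal of the transformation -/

variable {k : Type u} [Field k] {d : ℕ} {B : BasicObject k d} {Y : Closeds B.W}
  {S : Finset (Fin B.E.length)} {c : ℕ} {X' : Scheme.{u}} {π : X' ⟶ B.W}

/-- The ideal of the transformation of a monomial basic object. -/
def transformIdeal (π : X' ⟶ B.W) (Y : Closeds B.W) (c : ℕ) : X'.IdealSheafData :=
  (∏ᶠ (C : IrreducibleCloseds B.W) (_ : C ∈ B.components),
    idealOf (strictClosed π Y C) ^ B.exponent C) * (idealOf Y).comap π ^ (c - B.b)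

open Classical in
/-- The exponents of the transformation of a monomial basic object. -/
def transformExponent (π : X' ⟶ B.W) (Y : Closeds B.W) (c : ℕ) (D : IrreducibleCloseds X') : ℕ :=
  if (D : Set X') ⊆ π ⁻¹' (Y : Set B.W) then c - B.b else B.exponent (imageClosure π D)

lemma stalkIdeal_strictClosed_eq_top {q : X'} {C : IrreducibleCloseds B.W} (h : π q ∉ C) :
    stalkIdeal (idealOf (strictClosed π Y C)) q = ⊤ := by
  rw [stalkIdeal_eq_top_iff, mem_support_idealOf]
  exact fun hq => h (map_mem_of_mem_strictClosed hq)

namespace PointForm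

variable {q : X'} {y : Fin d → X'.presheaf.stalk q} {e : X'.presheaf.stalk q}
    {σ : B.Comp (π q) → Fin d} {x : B.Comp (π q) → B.W.presheaf.stalk (π q)}
    {t : B.Comp (π q) → X'.presheaf.stalk q} (H : PointForm π Y S q y e σ x t)

include H

lemma stalkIdeal_transformIdeal (hπ : IsBlowup π (idealOf Y)) :
    stalkIdeal (transformIdeal π Y c) q =
      Ideal.span {(∏ C : B.Comp (π q), t C ^ B.exponent C.1) * e ^ (c - B.b)} := by
  rw [transformIdeal, stalkIdeal_mul, stalkIdeal_pow, H.stalkIdeal_comap,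
    stalkIdeal_finprod B.components_finite]
  simp only [stalkIdeal_pow]
  rw [B.finprod_components_eq (π q)
    (fun C => stalkIdeal (idealOf (strictClosed π Y C)) q ^ B.exponent C)
    (fun C hC => by rw [stalkIdeal_strictClosed_eq_top hC, ← Ideal.one_eq_top, one_pow])]
  simp only [H.stalkIdeal_strictClosed hπ, Ideal.span_singleton_pow]
  rw [Ideal.prod_span_singleton, Ideal.span_singleton_mul_span_singleton]

lemma prod_map_eq (h : B.IsCenter Y S c) :
    ∏ C : B.Comp (π q), (π.stalkMap q).hom (x C) ^ B.exponent C.1 =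
      e ^ c * ∏ C : B.Comp (π q), t C ^ B.exponent C.1 := by
  classical
  by_cases hY : π q ∈ Y
  · have h1 : ∀ C : B.Comp (π q), (π.stalkMap q).hom (x C) ^ B.exponent C.1 =
        (if σ C ∈ centerIndices σ S then e ^ B.exponent C.1 else 1) * t C ^ B.exponent C.1 := by
      intro C
      split_ifs with hC
      · obtain ⟨C', hC', e'⟩ := hC
        obtain rfl := H.injective e'
        rw [H.map_of_mem hY _ hC', mul_pow]
      · rw [H.map_of_notMem hY _ fun h => hC ⟨C, h, rfl⟩, one_mul]
    simp only [h1]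
    rw [Finset.prod_mul_distrib, ← Finset.prod_filter, Finset.prod_pow_eq_pow_sum,
      h.sum_exponent hY H.injective]
  · rw [H.eq_one hY, one_pow, one_mul]
    exact Finset.prod_congr rfl fun C _ => by rw [H.map_of_eq_one hY]

end PointForm

variable [IsAlgClosed k] [IsLocallyNoetherian X'] [JacobsonSpace X']
  [SmoothOfRelativeDimension d (π ≫ B.toSpec)]

theorem IsCenter.comap_eq (hB : B.IsMonomial) (h : B.IsCenter Y S c)
    (hπ : IsBlowup π (idealOf Y)) :
    B.J.comap π = (idealOf Y).comap π ^ B.b * transformIdeal π Y c := by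
  refine ext_of_stalkIdeal_of_isClosed fun q hq => ?_
  obtain ⟨y, e, σ, x, t, H⟩ := h.exists_pointForm hπ hq
  rw [MonomialResolution.stalkIdeal_comap, stalkIdeal_mul, stalkIdeal_pow, H.stalkIdeal_comap,
    H.stalkIdeal_transformIdeal hπ, Ideal.span_singleton_pow,
    Ideal.span_singleton_mul_span_singleton]
  have h1 := stalkIdeal_monomial H.stalkIdeal_eq (isMonomial_iff.mp hB)
  rw [h1, Ideal.map_span, Set.image_singleton, map_prod]
  simp only [map_pow]
  rw [H.prod_map_eq h]
  congr 2
  rw [mul_comm (∏ C : B.Comp (π q), t C ^ B.exponent C.1), ← mul_assoc, ← pow_add,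
    Nat.add_sub_cancel' h.le]

theorem IsCenter.eq_transformIdeal (hB : B.IsMonomial) (h : B.IsCenter Y S c)
    (hπ : IsBlowup π (idealOf Y)) {J : X'.IdealSheafData}
    (hJ : B.J.comap π = (idealOf Y).comap π ^ B.b * J) : J = transformIdeal π Y c := by
  refine ext_of_stalkIdeal_of_isClosed fun q hq => ?_
  obtain ⟨y, e, σ, x, t, H⟩ := h.exists_pointForm hπ hq
  have h1 := congrArg (fun I => stalkIdeal I q) (hJ.symm.trans (h.comap_eq hB hπ))
  simp only [stalkIdeal_mul, stalkIdeal_pow, H.stalkIdeal_comap, Ideal.span_singleton_pow] at h1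
  have := H.regular.isDomain
  refine (Ideal.span_singleton_mul_right_inj (pow_ne_zero _ ?_)).mp h1
  by_cases hY : π q ∈ Y
  · obtain ⟨i, he, -⟩ := H.exists_eq hY
    rw [he]
    exact H.regular.ne_zero i
  · rw [H.eq_one hY]
    exact one_ne_zero

lemma IsCenter.finprod_exceptionalSet [NoetherianSpace X'] (h : B.IsCenter Y S c)
    (hπ : IsBlowup π (idealOf Y)) :
    ∏ᶠ (D : IrreducibleCloseds X') (_ : D ∈ exceptionalSet π Y), idealOf (toCloseds D) =
      (idealOf Y).comap π := by
  refine ext_of_stalkIdeal_of_isClosed fun q hq => ?_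
  obtain ⟨y, e, σ, x, t, H⟩ := h.exists_pointForm hπ hq
  rw [stalkIdeal_finprod (finite_exceptionalSet π Y), H.stalkIdeal_comap]
  by_cases hY : π q ∈ Y
  · obtain ⟨D₀, hD₀, -, hst, huniq⟩ := H.exists_exceptional hY
    rw [finprod_eq_single _ D₀ fun D hD => ?_]
    · simp [hD₀, hst]
    · by_cases hDE : D ∈ exceptionalSet π Y
      · simp only [hDE, finprod_true]
        rw [Ideal.one_eq_top]
        exact stalkIdeal_idealOf_eq_top fun hqD => hD (huniq D hDE hqD)
      · simp [hDE]
  · rw [H.eq_one hY, Ideal.span_singleton_one, ← Ideal.one_eq_top]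
    refine finprod_mem_eq_one_of_forall_eq_one fun D hD => ?_
    rw [Ideal.one_eq_top]
    exact stalkIdeal_idealOf_eq_top fun hqD => hY (subset_of_mem_exceptionalSet hD hqD)

theorem IsCenter.transformIdeal_eq [NoetherianSpace X'] (h : B.IsCenter Y S c)
    (hπ : IsBlowup π (idealOf Y)) :
    transformIdeal π Y c = ∏ᶠ (D : IrreducibleCloseds X')
      (_ : D ∈ strictSet π Y B.components ∪ exceptionalSet π Y),
        idealOf (toCloseds D) ^ transformExponent π Y c D := by
  rw [finprod_mem_union (disjoint_strictSet_exceptionalSet hπ _)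
    (finite_strictSet hπ B.components_finite) (finite_exceptionalSet π Y), transformIdeal]
  congr 1
  · rw [finprod_mem_eq_of_bijOn (imageClosure π) (bijOn_imageClosure hπ B.components)
      (g := fun C => idealOf (strictClosed π Y C) ^ B.exponent C)]
    · refine finprod_congr fun C => ?_
      by_cases hC : (C : Set B.W) ⊆ Y
      · have h1 : strictClosed π Y C = ⊥ := by
          apply Closeds.ext
          change closure (π ⁻¹' ((C : Set B.W) \ Y)) = _
          rw [Set.sdiff_eq_empty.mpr hC]
          simp
        have h2 : idealOf (⊥ : Closeds X') = 1 := by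
          rw [Scheme.IdealSheafData.one_eq_top]
          exact Scheme.IdealSheafData.vanishingIdeal_bot
        simp only [hC, h1, h2, one_pow, finprod_one, not_true, and_false,
          Set.mem_ofPred_eq]
      · simp [hC]
    · intro D hD
      rw [transformExponent, if_neg, ((mem_strictSet_iff hπ).mp hD).2.2]
      obtain ⟨C, -, hC, hDC⟩ := hD
      exact not_subset_preimage hπ hC hDC
  · rw [← h.finprod_exceptionalSet hπ]
    refine ((powMonoidHom (c - B.b)).map_finprod_mem _ (finite_exceptionalSet π Y)).trans ?_
    refine finprod_mem_congr rfl fun D hD => ?_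
    rw [transformExponent, if_pos (subset_of_mem_exceptionalSet hD), powMonoidHom_apply]

end BasicObject

end MonomialResolution

end

noncomputable section

namespace MonomialResolution

namespace BasicObject

/-! ### Existence of the transformation -/

variable {k : Type u} [Field k] [IsAlgClosed k] {d : ℕ} {B : BasicObject k d} {Y : Closeds B.W}
  {S : Finset (Fin B.E.length)} {c : ℕ}

omit [IsAlgClosed k] in
lemma IsCenter.nonempty (h : B.IsCenter Y S c) {z : B.W} (hz : z ∈ Y) : S.Nonempty := by
  rw [Finset.nonempty_iff_ne_empty]
  rintro rfl
  have h1 := h.sum_eq z hz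
  have h2 := h.le
  have h3 := B.b_pos
  simp only [exponentSum, Finset.sum_empty] at h1
  omega

lemma genericPoint_notMem_component {C : IrreducibleCloseds B.W} (hC : C ∈ B.components) :
    genericPoint B.W ∉ C := by
  intro hη
  obtain ⟨p, hp, hηp, -⟩ := exists_isClosed_mem_of_specializes (genericPoint B.W) ⊤ trivial
  obtain ⟨x, hx, σ, hσ, hxσ⟩ := B.exists_adapted hp
  have hpC : p ∈ C := hηp.mem_closed C.isClosed hη
  have := hx.isDomain
  obtain ⟨w, hw, e⟩ := exists_primeOf_eq p (⊥ : Ideal (B.W.presheaf.stalk p))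
  have h1 := (stalkIdeal_idealOf_le_primeOf_iff (toCloseds C) hw).mpr
    ((_root_.genericPoint_specializes w).mem_closed C.isClosed hη)
  rw [hxσ ⟨C, hC, hpC⟩, e, le_bot_iff, Ideal.span_singleton_eq_bot] at h1
  exact hx.ne_zero _ h1

lemma IsCenter.support_ne_top (h : B.IsCenter Y S c) : (idealOf Y).support ≠ ⊤ := by
  intro hY
  have hη : genericPoint B.W ∈ Y := by
    rw [← mem_support_idealOf, hY]
    trivial
  obtain ⟨j, hj⟩ := h.nonempty hη
  obtain ⟨C, hC, hηC⟩ := h.through _ hη j hj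
  exact genericPoint_notMem_component (get_mem_components hC) hηC

theorem IsCenter.exists_isTransformation (hB : B.IsMonomial) (h : B.IsCenter Y S c)
    (hY : (Y : Set B.W) ⊆ B.Sing) :
    ∃ (B₁ : BasicObject k d) (π : B₁.W ⟶ B.W), IsTransformation π Y := by
  let X' := blowup (idealOf Y)
  let π : X' ⟶ B.W := blowupπ (idealOf Y)
  have hπ : IsBlowup π (idealOf Y) := isBlowup_blowup _
  have hsm : SmoothOfRelativeDimension d (π ≫ B.toSpec) := h.smoothOfRelativeDimension hπ
  have := SmoothOfRelativeDimension.smooth d (π ≫ B.toSpec)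
  have : IsLocallyNoetherian X' := LocallyOfFiniteType.isLocallyNoetherian (π ≫ B.toSpec)
  have : JacobsonSpace X' := LocallyOfFiniteType.jacobsonSpace (π ≫ B.toSpec)
  have : CompactSpace X' := hπ.compactSpace
  have : IsNoetherian X' := { }
  have : QuasiSeparated (π ≫ B.toSpec) := inferInstance
  have : QuasiSeparated π := QuasiSeparated.of_comp π B.toSpec
  have : IsSeparated π := hπ.isSeparated
  let E : List (Set (IrreducibleCloseds X')) := B.E.map (strictSet π Y) ++ [exceptionalSet π Y]
  have hE : {D | ∃ H ∈ E, D ∈ H} = strictSet π Y B.components ∪ exceptionalSet π Y := by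
    ext D
    simp only [E, List.mem_append, List.mem_map, List.mem_singleton]
    constructor
    · rintro ⟨_, ⟨H, hH, rfl⟩ | rfl, hD⟩
      · obtain ⟨C, hC, hD⟩ := hD
        exact .inl ⟨C, ⟨H, hH, hC⟩, hD⟩
      · exact .inr hD
    · rintro (⟨C, ⟨H, hH, hC⟩, hD⟩ | hD)
      · exact ⟨_, .inl ⟨H, hH, rfl⟩, C, hC, hD⟩
      · exact ⟨_, .inr rfl, hD⟩
  let B₁ : BasicObject k d :=
    { W := X'
      toSpec := π ≫ B.toSpec
      isIntegral := hπ.isIntegral h.support_ne_top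
      isSeparated := inferInstance
      quasiCompact := inferInstance
      smooth := hsm
      J := transformIdeal π Y c
      b := B.b
      b_pos := B.b_pos
      E := E
      finite := by
        simp only [E, List.mem_append, List.mem_map, List.mem_singleton]
        rintro _ (⟨H, hH, rfl⟩ | rfl)
        · exact finite_strictSet hπ (B.finite H hH)
        · exact finite_exceptionalSet π Y
      smooth_component := fun H hH C hC => h.smooth_component hπ (hE ▸ ⟨H, hH, hC⟩)
      disjoint_components := by
        simp only [E, List.mem_append, List.mem_map, List.mem_singleton]
        rintro _ (⟨H, hH, rfl⟩ | rfl)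
        · exact pairwiseDisjoint_strictSet (B.disjoint_components H hH)
        · exact h.pairwiseDisjoint_exceptionalSet hπ
      no_common_component := by
        rw [List.pairwise_append]
        refine ⟨List.pairwise_map.mpr (B.no_common_component.imp fun h => disjoint_strictSet hπ h),
          List.pairwise_singleton _ _, ?_⟩
        simp only [List.mem_map, List.mem_singleton]
        rintro _ ⟨H, hH, rfl⟩ _ rfl
        exact disjoint_strictSet_exceptionalSet hπ H
      snc := fun q hq => by
        obtain ⟨y, e, σ, x, t, H⟩ := h.exists_pointForm hπ hq
        rw [hE]
        exact ⟨y, H.isAdapted hπ⟩ }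
  exact ⟨B₁, π, rfl, h.isPermissible, hY, hπ, rfl, rfl, h.comap_eq hB hπ⟩

/-! ### The boundary of a transformation -/

namespace IsTransformation

variable {B₁ : BasicObject k d} {π : B₁.W ⟶ B.W} (T : IsTransformation π Y)

include T

omit [IsAlgClosed k] in
lemma length_eq : B₁.E.length = B.E.length + 1 := by
  rw [T.E_eq]; simp

omit [IsAlgClosed k] in
lemma get_eq_strictSet {i : Fin B₁.E.length} {j : Fin B.E.length} (hij : (i : ℕ) = j) :
    B₁.E.get i = strictSet π Y (B.E.get j) := by
  rw [List.get_eq_getElem, List.getElem_of_eq T.E_eq, List.getElem_append_left (by simp [hij]),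
    List.getElem_map]
  simp only [hij]
  rfl

omit [IsAlgClosed k] in
lemma get_eq_exceptionalSet {i : Fin B₁.E.length} (hi : (i : ℕ) = B.E.length) :
    B₁.E.get i = exceptionalSet π Y := by
  rw [List.get_eq_getElem, List.getElem_of_eq T.E_eq, List.getElem_append_right (by simp [hi])]
  simp only [List.getElem_singleton]
  rfl

omit [IsAlgClosed k] in
lemma components_eq : B₁.components = strictSet π Y B.components ∪ exceptionalSet π Y := by
  ext D
  simp only [components, T.E_eq, List.mem_append, List.mem_map, List.mem_singleton]
  constructor
  · rintro ⟨_, ⟨H, hH, rfl⟩ | rfl, hD⟩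
    · obtain ⟨C, hC, hD⟩ := hD
      exact .inl ⟨C, ⟨H, hH, hC⟩, hD⟩
    · exact .inr hD
  · rintro (⟨C, ⟨H, hH, hC⟩, hD⟩ | hD)
    · exact ⟨_, .inl ⟨H, hH, rfl⟩, C, hC, hD⟩
    · exact ⟨_, .inr rfl, hD⟩

omit [IsAlgClosed k] in
lemma smoothOfRelativeDimension : SmoothOfRelativeDimension d (π ≫ B.toSpec) := by
  rw [T.comp_toSpec]; infer_instance

lemma J_eq_finprod (hB : B.IsMonomial) (h : B.IsCenter Y S c) :
    B₁.J = ∏ᶠ (D : IrreducibleCloseds B₁.W) (_ : D ∈ B₁.components),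
      idealOf (toCloseds D) ^ transformExponent π Y c D := by
  have := T.smoothOfRelativeDimension
  rw [T.components_eq, ← h.transformIdeal_eq T.isBlowup]
  exact h.eq_transformIdeal hB T.isBlowup T.J_eq

theorem isMonomial (hB : B.IsMonomial) (h : B.IsCenter Y S c) : B₁.IsMonomial :=
  isMonomial_of_eq (T.J_eq_finprod hB h)

lemma exponent_eq (hB : B.IsMonomial) (h : B.IsCenter Y S c) {D : IrreducibleCloseds B₁.W}
    (hD : D ∈ B₁.components) : B₁.exponent D = transformExponent π Y c D :=
  BasicObject.exponent_eq (T.J_eq_finprod hB h) hD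

lemma of_through (hB : B.IsMonomial) (h : B.IsCenter Y S c) {i : Fin B₁.E.length}
    {j : Fin B.E.length} (hij : (i : ℕ) = j) {q : B₁.W} (hq : B₁.Through i q) :
    B.Through j (π q) ∧ B₁.exponentAt i q = B.exponentAt j (π q) ∧
      ∀ C ∈ B.E.get j, π q ∈ C → q ∈ strictClosed π Y C := by
  obtain ⟨D, hD, hqD⟩ := hq
  have hD' := hD
  rw [T.get_eq_strictSet hij] at hD'
  obtain ⟨C, hC, hCY, hDC⟩ := hD'
  have hqC : q ∈ strictClosed π Y C := show q ∈ closure _ from hDC ▸ hqD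
  have hpC := map_mem_of_mem_strictClosed hqC
  refine ⟨⟨C, hC, hpC⟩, ?_, fun C' hC' hp' => component_unique hC hC' hpC hp' ▸ hqC⟩
  rw [exponentAt_eq hD hqD, exponentAt_eq hC hpC, T.exponent_eq hB h (get_mem_components hD),
    transformExponent, if_neg (not_subset_preimage T.isBlowup hCY hDC),
    imageClosure_eq T.isBlowup hCY hDC]

lemma of_through_last (hB : B.IsMonomial) (h : B.IsCenter Y S c) {i : Fin B₁.E.length}
    (hi : (i : ℕ) = B.E.length) {q : B₁.W} (hq : B₁.Through i q) :
    π q ∈ Y ∧ B₁.exponentAt i q = c - B.b := by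
  obtain ⟨D, hD, hqD⟩ := hq
  have hD' := hD
  rw [T.get_eq_exceptionalSet hi] at hD'
  have h1 := subset_of_mem_exceptionalSet hD'
  refine ⟨h1 hqD, ?_⟩
  rw [exponentAt_eq hD hqD, T.exponent_eq hB h (get_mem_components hD), transformExponent, if_pos h1]

/-- The strict transforms of the boundary components which define the center have no common closed
point. -/
lemma exists_notMem_strictClosed (h : B.IsCenter Y S c) {q : B₁.W}
    (hq : IsClosed ({q} : Set B₁.W)) (hY : π q ∈ Y) :
    ∃ j ∈ S, ∃ C ∈ B.E.get j, π q ∈ C ∧ q ∉ strictClosed π Y C := by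
  have := T.smoothOfRelativeDimension
  obtain ⟨y, e, σ, x, t, H⟩ := h.exists_pointForm T.isBlowup hq
  obtain ⟨i, -, C, ⟨j, hj, hC⟩, -, h1⟩ := H.exists_eq hY
  refine ⟨j, hj, C.1, hC, C.2.2, ?_⟩
  rw [← mem_support_idealOf, ← stalkIdeal_eq_top_iff, H.stalkIdeal_strictClosed T.isBlowup C, h1,
    Ideal.span_singleton_one]

end IsTransformation

end BasicObject

end MonomialResolution

end

noncomputable section

namespace MonomialResolution

namespace BasicObject

/-! ### The invariant drops -/

lemma indexTuple_congr {d r r' : ℕ} {S : Finset (Fin r)} {S' : Finset (Fin r')}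
    (h : S.map Fin.valEmbedding = S'.map Fin.valEmbedding) : indexTuple d S = indexTuple d S' := by
  have key : ∀ {r : ℕ} (S : Finset (Fin r)), (S.sort (· ≥ ·)).map (fun j : Fin r => (j : ℕ) + 1) =
      ((S.map Fin.valEmbedding).sort (· ≥ ·)).map (· + 1) := by
    intro r S
    rw [← Finset.map_sort (r := (· ≥ ·)) Fin.valEmbedding S (· ≥ ·) (fun _ _ _ _ => Iff.rfl),
      List.map_map]
    rfl
  rw [indexTuple, indexTuple, key, key, h]

lemma exists_map_castLEEmb_eq {r r' : ℕ} (h : r' = r + 1) (S : Finset (Fin r')) :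
    ∃ T : Finset (Fin r), S = T.map (Fin.castLEEmb (by omega)) ∨
      S = insert (⟨r, by omega⟩ : Fin r') (T.map (Fin.castLEEmb (by omega))) := by
  classical
  subst h
  refine ⟨Finset.univ.filter fun j => j.castSucc ∈ S, ?_⟩
  have hmem : ∀ j : Fin r, j.castSucc ∈ (Finset.univ.filter fun j : Fin r => j.castSucc ∈ S).map
      (Fin.castLEEmb (by omega)) ↔ j.castSucc ∈ S := by
    intro j
    have h1 : Fin.castLEEmb (by omega) j = j.castSucc := rfl
    rw [← h1, Finset.mem_map', Finset.mem_filter, h1]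
    simp
  by_cases hl : Fin.last r ∈ S
  · right
    ext i
    induction i using Fin.lastCases with
    | last => exact ⟨fun _ => Finset.mem_insert_self _ _, fun _ => hl⟩
    | cast j =>
      rw [Finset.mem_insert, hmem]
      exact ⟨.inr, fun h => h.resolve_left fun h => j.2.ne (congrArg Fin.val h)⟩
  · left
    ext i
    induction i using Fin.lastCases with
    | last =>
      refine ⟨fun h => absurd h hl, fun h => ?_⟩
      obtain ⟨j, -, hj⟩ := Finset.mem_map.mp h
      exact (j.2.ne (congrArg Fin.val hj)).elim
    | cast j => rw [hmem]

variable {k : Type u} [Field k] [IsAlgClosed k] {d : ℕ} {B B₁ : BasicObject k d}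
  {Y : Closeds B.W} {S : Finset (Fin B.E.length)} {c : ℕ} {π : B₁.W ⟶ B.W}
  {γ : ℤ ×ₗ ℚ ×ₗ Lex (Fin d → ℕ)}

theorem IsTransformation.value_lt (T : IsTransformation π Y) (hB : B.IsMonomial)
    (h : B.IsCenter Y S c) (hY : (Y : Set B.W) = B.MaxΓ) (hγ : IsGreatest (B.Γ '' B.Sing) γ)
    (hS : ∀ z ∈ Y, S ∈ B.admissible z ∧ B.value z S = γ)
    (huniq : ∀ z, ∀ U ∈ B.admissible z, B.value z U = γ → U = S) {q : B₁.W}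
    (hq : IsClosed ({q} : Set B₁.W)) {S' : Finset (Fin B₁.E.length)}
    (hS' : S' ∈ B₁.admissible q) : B₁.value q S' < γ := by
  have hle : ∀ p, ∀ U ∈ B.admissible p, B.value p U ≤ γ := fun p U hU =>
    ((isGreatest_Γ ⟨U, hU⟩).2 ⟨U, hU, rfl⟩).trans
      (hγ.2 ⟨p, hB.mem_sing_of_mem_admissible hU, rfl⟩)
  rw [mem_admissible] at hS'
  obtain ⟨hthr, hsum⟩ := hS'
  obtain ⟨U, rfl | rfl⟩ := exists_map_castLEEmb_eq T.length_eq S'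
  · have h1 : ∀ j ∈ U, _ := fun j hj => T.of_through hB h (j := j) rfl
      (hthr _ (Finset.mem_map_of_mem _ hj))
    have hs : B₁.exponentSum q (U.map (Fin.castLEEmb (by rw [T.length_eq]; omega))) =
        B.exponentSum (π q) U := by
      rw [exponentSum, Finset.sum_map]
      exact Finset.sum_congr rfl fun j hj => (h1 j hj).2.1
    have hU : U ∈ B.admissible (π q) :=
      mem_admissible.mpr ⟨fun j hj => (h1 j hj).1, by rw [← hs, ← T.b_eq]; exact hsum⟩
    have hv : B₁.value q (U.map (Fin.castLEEmb (by rw [T.length_eq]; omega))) =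
        B.value (π q) U := by
      rw [value, value, hs, T.b_eq, Finset.card_map]
      congr 4
      refine indexTuple_congr ?_
      rw [Finset.map_map]
      rfl
    rw [hv]
    refine lt_of_le_of_ne (hle _ _ hU) fun hne => ?_
    obtain rfl := huniq _ _ hU hne
    have hpY : π q ∈ Y := by
      rw [← SetLike.mem_coe, hY]
      refine ⟨hB.mem_sing_of_mem_admissible hU, fun p hp => (hγ.2 ⟨p, hp, rfl⟩).trans ?_⟩
      rw [← hne]
      exact (isGreatest_Γ ⟨_, hU⟩).2 ⟨_, hU, rfl⟩
    obtain ⟨j, hj, C, hC, hpC, hqC⟩ := T.exists_notMem_strictClosed h hq hpY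
    exact hqC ((h1 j hj).2.2 C hC hpC)
  · have h1 : ∀ j ∈ U, _ := fun j hj => T.of_through hB h (j := j) rfl
      (hthr _ (Finset.mem_insert_of_mem (Finset.mem_map_of_mem _ hj)))
    obtain ⟨hpY, hlast⟩ := T.of_through_last hB h rfl (hthr _ (Finset.mem_insert_self _ _))
    have hnot : (⟨B.E.length, by rw [T.length_eq]; omega⟩ : Fin B₁.E.length) ∉
        U.map (Fin.castLEEmb (by rw [T.length_eq]; omega)) := by
      intro hmem
      obtain ⟨j, -, hj⟩ := Finset.mem_map.mp hmem
      exact (j.2.ne (congrArg Fin.val hj)).elim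
    have hs : B₁.exponentSum q (insert (⟨B.E.length, by rw [T.length_eq]; omega⟩ : Fin B₁.E.length)
        (U.map (Fin.castLEEmb (by rw [T.length_eq]; omega)))) =
          c - B.b + B.exponentSum (π q) U := by
      rw [exponentSum, Finset.sum_insert hnot, hlast, Finset.sum_map]
      congr 1
      exact Finset.sum_congr rfl fun j hj => (h1 j hj).2.1
    obtain ⟨hSadm, hSv⟩ := hS _ hpY
    have hmin : ∀ V ∈ B.admissible (π q), S.card ≤ V.card := by
      intro V hV
      by_contra hlt
      refine (hle _ V hV).not_gt ?_
      rw [← hSv, value_lt_iff rfl]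
      exact .inl (not_le.mp hlt)
    have hsc := h.sum_eq _ hpY
    have hbc := h.le
    rw [hs, T.b_eq] at hsum
    rw [← hSv, value_lt_iff T.b_eq, Finset.card_insert_of_notMem hnot, Finset.card_map, hs, hsc]
    by_cases hc1 : S.card ≤ U.card
    · left; omega
    have hUn : B.exponentSum (π q) U < B.b := by
      by_contra hUb
      exact hc1 (hmin U (mem_admissible.mpr ⟨fun j hj => (h1 j hj).1, not_lt.mp hUb⟩))
    right
    refine ⟨?_, .inl (by omega)⟩
    by_contra hc2
    obtain ⟨j, hjS, hjU⟩ : ∃ j ∈ S, j ∉ U := by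
      by_contra! hsub
      exact hc1 (Finset.card_le_card hsub)
    have hSthr := (mem_admissible.mp hSadm).1
    have h2 : B.exponentAt j (π q) + B.exponentSum (π q) (S.erase j) = c := by
      rw [← hsc]
      exact Finset.add_sum_erase S (fun j => B.exponentAt j (π q)) hjS
    have h3 : B.exponentSum (π q) (S.erase j) < B.b := by
      by_contra hb
      have := hmin (S.erase j) (mem_admissible.mpr
        ⟨fun i hi => hSthr i (Finset.mem_of_mem_erase hi), not_lt.mp hb⟩)
      rw [Finset.card_erase_of_mem hjS] at this
      have := Finset.card_pos.mpr ⟨j, hjS⟩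
      omega
    have h4 : B.exponentSum (π q) (insert j U) =
        B.exponentAt j (π q) + B.exponentSum (π q) U := Finset.sum_insert hjU
    have := hmin (insert j U) (mem_admissible.mpr ⟨fun i hi => ?_, by omega⟩)
    · rw [Finset.card_insert_of_notMem hjU] at this
      omega
    · rcases Finset.mem_insert.mp hi with rfl | hi
      · exact hSthr _ hjS
      · exact (h1 i hi).1

theorem exists_isTransformation_MaxΓ (hB : B.IsMonomial) (hne : B.Sing.Nonempty) :
    ∃ (Y : Closeds B.W) (γ : ℤ ×ₗ ℚ ×ₗ Lex (Fin d → ℕ)),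
      (Y : Set B.W) = B.MaxΓ ∧ IsGreatest (B.Γ '' B.Sing) γ ∧ B.IsPermissible Y ∧
      (∃ (B₁ : BasicObject k d) (π : B₁.W ⟶ B.W), IsTransformation π Y) ∧
      ∀ (B₁ : BasicObject k d) (π : B₁.W ⟶ B.W), IsTransformation π Y →
        B₁.IsMonomial ∧ ∀ p ∈ B₁.Sing, B₁.Γ p < γ := by
  obtain ⟨Y, γ, S, c, hY, hγ, h, hS, huniq⟩ := exists_isCenter hB hne
  refine ⟨Y, γ, hY, hγ, h.isPermissible, h.exists_isTransformation hB (hY ▸ fun p hp => hp.1),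
    fun B₁ π T => ⟨T.isMonomial hB h, fun p hp => ?_⟩⟩
  obtain ⟨q, hq, hqS, -, hC⟩ := exists_isClosed_mem_sing hp
  rw [← Γ_congr hC]
  obtain ⟨S', hS', e⟩ := (isGreatest_Γ ((T.isMonomial hB h).admissible_nonempty hqS)).1
  rw [← e]
  exact T.value_lt hB h hY hγ hS huniq hq hS'

/-! ### Termination -/

variable (B) in
/-- The invariant, with values in a well-ordered set. -/
def rank (p : B.W) : ℕ ×ₗ ℕ ×ₗ Lex (Fin d → ℕ) :=
  toLex (d - B.negΓ₁ p, toLex (B.bΓ₂ p, B.Γ₃ p))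

lemma IsMonomial.negΓ₁_le (hB : B.IsMonomial) {p : B.W} (hp : p ∈ B.Sing) : B.negΓ₁ p ≤ d := by
  obtain ⟨S, hS⟩ := hB.admissible_nonempty hp
  have h1 : B.negΓ₁ p ≤ S.card := Nat.sInf_le ⟨S, hS, rfl⟩
  exact h1.trans (card_le_of_mem_admissible hB hS)

omit [IsAlgClosed k] in
lemma rank_lt_rank (hb : B₁.b = B.b) {q : B₁.W} {p : B.W} (hq : B₁.negΓ₁ q ≤ d)
    (hp : B.negΓ₁ p ≤ d) (h : B₁.Γ q < B.Γ p) : B₁.rank q < B.rank p := by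
  have hb' : (0 : ℚ) < B.b := Nat.cast_pos.mpr B.b_pos
  rw [Γ, Γ, Prod.Lex.toLex_lt_toLex, Prod.Lex.toLex_lt_toLex, hb] at h
  simp only [neg_lt_neg_iff, Nat.cast_lt, neg_inj, Nat.cast_inj,
    div_lt_div_iff_of_pos_right hb', div_left_inj' hb'.ne'] at h
  rw [rank, rank, Prod.Lex.toLex_lt_toLex, Prod.Lex.toLex_lt_toLex]
  rcases h with h | ⟨h, h'⟩
  · left; dsimp only; omega
  · exact .inr ⟨by dsimp only; omega, h'⟩

/-- `B₁` is a transformation of `B` whose center is the locus where the invariant is maximal, and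
the invariant drops. -/
def Step (B B₁ : BasicObject k d) : Prop :=
  ∃ (π : B₁.W ⟶ B.W) (Y : Closeds B.W) (γ : ℤ ×ₗ ℚ ×ₗ Lex (Fin d → ℕ)),
    (Y : Set B.W) = B.MaxΓ ∧ IsTransformation π Y ∧ IsGreatest (B.Γ '' B.Sing) γ ∧
      ∀ p ∈ B₁.Sing, B₁.Γ p < γ

theorem exists_chain (hB : B.IsMonomial) :
    ∃ (N : ℕ) (C : Fin (N + 1) → BasicObject k d), C 0 = B ∧ (∀ i, (C i).IsMonomial) ∧
      (∀ i : Fin N, Step (C i.castSucc) (C i.succ)) ∧ (C (Fin.last N)).Sing = ∅ := by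
  have key : ∀ (w : ℕ ×ₗ ℕ ×ₗ Lex (Fin d → ℕ)) (B : BasicObject k d), B.IsMonomial →
      (∀ p ∈ B.Sing, B.rank p < w) →
      ∃ (N : ℕ) (C : Fin (N + 1) → BasicObject k d), C 0 = B ∧ (∀ i, (C i).IsMonomial) ∧
        (∀ i : Fin N, Step (C i.castSucc) (C i.succ)) ∧ (C (Fin.last N)).Sing = ∅ := by
    intro w
    induction w using WellFoundedLT.induction with
    | ind w ih =>
      intro B hB hw
      rcases B.Sing.eq_empty_or_nonempty with h0 | hne
      · exact ⟨0, fun _ => B, rfl, fun _ => hB, fun i => i.elim0, h0⟩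
      obtain ⟨Y, γ, hY, hγ, -, ⟨B₁, π, T⟩, hdrop⟩ := exists_isTransformation_MaxΓ hB hne
      obtain ⟨hB₁, hlt⟩ := hdrop B₁ π T
      obtain ⟨p, hp, hpγ⟩ := hγ.1
      obtain ⟨N, C, hC0, hCm, hCs, hCN⟩ := ih _ (hw p hp) B₁ hB₁ fun q hq =>
        rank_lt_rank T.b_eq (hB₁.negΓ₁_le hq) (hB.negΓ₁_le hp) (hpγ ▸ hlt q hq)
      refine ⟨N + 1, Fin.cons B C, rfl, fun i => ?_, fun i => ?_, hCN⟩
      · induction i using Fin.cases with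
        | zero => exact hB
        | succ i => exact hCm i
      · induction i using Fin.cases with
        | zero =>
          change Step B (C 0)
          rw [hC0]
          exact ⟨π, Y, γ, hY, T, hγ, hlt⟩
        | succ i => exact hCs i
  refine key (toLex (d + 1, toLex (0, 0))) B hB fun p hp => ?_
  rw [rank, Prod.Lex.toLex_lt_toLex]
  left
  dsimp only
  omega

end BasicObject

end MonomialResolution

end

theorem mainTheorem11 {k : Type u} [Field k] [IsAlgClosed k] [CharZero k] {d : ℕ}
    (B₀ : MonomialResolution.BasicObject k d) (hB₀ : B₀.IsMonomial) :
    -- one step: `Max Γ` is a permissible center, and blowing it up strictly lowers `max Γ`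
    (B₀.Sing.Nonempty →
      ∃ (Y : Closeds B₀.W) (γ : ℤ ×ₗ ℚ ×ₗ Lex (Fin d → ℕ)),
        (Y : Set B₀.W) = B₀.MaxΓ ∧ IsGreatest (B₀.Γ '' B₀.Sing) γ ∧ B₀.IsPermissible Y ∧
        (∃ (B₁ : MonomialResolution.BasicObject k d) (π : B₁.W ⟶ B₀.W),
          MonomialResolution.BasicObject.IsTransformation π Y) ∧
        ∀ (B₁ : MonomialResolution.BasicObject k d) (π : B₁.W ⟶ B₀.W),
          MonomialResolution.BasicObject.IsTransformation π Y →
            B₁.IsMonomial ∧ ∀ p ∈ B₁.Sing, B₁.Γ p < γ) ∧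
    -- the resolution sequence
    ∃ (N : ℕ) (B : Fin (N + 1) → MonomialResolution.BasicObject k d)
      (π : ∀ i : Fin N, (B i.succ).W ⟶ (B i.castSucc).W)
      (Y : ∀ i : Fin N, Closeds (B i.castSucc).W)
      (γ : Fin N → ℤ ×ₗ ℚ ×ₗ Lex (Fin d → ℕ)),
      B 0 = B₀ ∧
      (∀ i, (B i).IsMonomial) ∧
      (∀ i : Fin N,
        (Y i : Set (B i.castSucc).W) = (B i.castSucc).MaxΓ ∧
        MonomialResolution.BasicObject.IsTransformation (π i) (Y i) ∧
        IsGreatest ((B i.castSucc).Γ '' (B i.castSucc).Sing) (γ i) ∧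
        ∀ p ∈ (B i.succ).Sing, (B i.succ).Γ p < γ i) ∧
      (B (Fin.last N)).Sing = ∅ := by
  refine ⟨fun h => MonomialResolution.BasicObject.exists_isTransformation_MaxΓ hB₀ h, ?_⟩
  obtain ⟨N, B, h0, hm, hs, hN⟩ := MonomialResolution.BasicObject.exists_chain hB₀
  choose π Y γ h using hs
  exact ⟨N, B, π, Y, γ, h0, hm, h, hN⟩
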